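/- For integers $d,n\ge 1$ and real $\tau>0$ let $$E(\tau,d,n)=\{x\in\mathbb{R}^{nd}: |xq-r|_\infty<|q|_\infty^{-\tau}\text{ for infinitely many }(q,r)\in\mathbb{Z}^d\times\mathbb{Z}^n\text{ with }q\neq 0\},$$ where $x\in\mathbb{R}^{nd}$ is regarded as a real $n\times d$ matrix and $|\cdot|_\infty$ is the maximum norm. For a Borel probability measure $\mu$ on $\mathbb{R}^N$ put $\widehat\mu(\xi)=\int e^{-2\pi i x\cdot\xi}\,d\mu(x)$ and $$\dim_F\mu=\sup\{s\in[0,N]: |\widehat\mu(\xi)|\le C|\xi|^{-s/2}\text{ for all }\xi\ne0\text{, for some constant }C\}.$$ For $E\subseteq\mathbb{R}^N$ let $\dim_F E$ be the supremum of $\dim_F\mu$ over all Borel probability measures $\mu$ on $\mathbb{R}^N$ whose support is a compact subset of $E$. A Salem set is a Borel set $E\subseteq\mathbb{R}^N$ whose Hausdorff dimension equals $\dim_F E$. **Theorem.** Let $d,n\ge1$ be integers and let $\tau>d/n$. Then $E(\tau,d,n)$ is a Borel set and $$\dim_F E(\tau,d,n)=\frac{2d}{1+\tau}.$$ In particular,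 $E(\tau,d,n)$ is not a Salem set unless $n=d=1$. -/

import Mathlib

noncomputable section

/-- The Fourier transform `ξ ↦ ∫ exp (-2 π i x · ξ) dμ(x)` of a measure on Euclidean space. -/
def fourierTransformMeasure {ι : Type*} [Fintype ι]
    (μ : MeasureTheory.Measure (EuclideanSpace ℝ ι)) (ξ : EuclideanSpace ℝ ι) : ℂ :=
  ∫ x, Complex.exp (-2 * (Real.pi : ℂ) * Complex.I * ((inner ℝ x ξ : ℝ) : ℂ)) ∂μ

/-- The Fourier dimension of a (probability) measure `μ` on `ℝ ^ N`, `N = #ι`: the supremum of the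
`s ∈ [0, N]` with `|μ̂(ξ)| ≪ |ξ| ^ (-s / 2)`. The set of such `s` is bounded, and it contains `0`
when `μ` is a probability measure. -/
def measureFourierDim {ι : Type*} [Fintype ι]
    (μ : MeasureTheory.Measure (EuclideanSpace ℝ ι)) : ℝ :=
  sSup {s : ℝ | s ∈ Set.Icc (0 : ℝ) (Fintype.card ι) ∧
    ∃ C : ℝ, ∀ ξ : EuclideanSpace ℝ ι, ξ ≠ 0 →
      ‖fourierTransformMeasure μ ξ‖ ≤ C * ‖ξ‖ ^ (-s / 2)}

/-- The Fourier dimension of a set `E`: the supremum of the Fourier dimensions of the Borel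
probability measures whose support is a compact subset of `E` (and `0` if there are none). -/
def fourierDim {ι : Type*} [Fintype ι] (E : Set (EuclideanSpace ℝ ι)) : ℝ :=
  sSup {t : ℝ | ∃ μ : MeasureTheory.Measure (EuclideanSpace ℝ ι),
    MeasureTheory.IsProbabilityMeasure μ ∧ IsCompact μ.support ∧ μ.support ⊆ E ∧
      t = measureFourierDim μ}

/-- A Salem set is a Borel set whose Hausdorff and Fourier dimensions agree. -/
def IsSalem {ι : Type*} [Fintype ι] (E : Set (EuclideanSpace ℝ ι)) : Prop :=
  MeasurableSet E ∧ dimH E = ENNReal.ofReal (fourierDim E)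

/-- The set `E(τ, d, n)` of `τ`-well approximable `n × d` real matrices `x`, inside `ℝ ^ (n d)`
with its Euclidean structure: those with `|x q - r|_∞ < |q|_∞ ^ (-τ)` for infinitely many
`(q, r) ∈ ℤ ^ d × ℤ ^ n` with `q ≠ 0`. The norms on `Fin n → ℝ` and `Fin d → ℤ` are the maximum
norms. -/
def wellApproxMatrices (τ : ℝ) (d n : ℕ) : Set (EuclideanSpace ℝ (Fin n × Fin d)) :=
  {x | {p : (Fin d → ℤ) × (Fin n → ℤ) | p.1 ≠ 0 ∧
    ‖(fun i : Fin n => (∑ j : Fin d, x (i, j) * (p.1 j : ℝ)) - (p.2 i : ℝ))‖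
      < ‖p.1‖ ^ (-τ)}.Infinite}

end

/-! Upper bound. Let μ be a probability measure with |μ̂(ξ)| ≪ |ξ|^(-t), t < n, and fix q ≠ 0. The
trigonometric sum over the frequencies a ⊗ q, a ∈ [0, L)^n with L about |q|^τ, has modulus
comparable to L^n wherever x q is within |q|^(-τ) of ℤ^n, while its μ-mean square only involves μ̂
at the frequencies (a - b) ⊗ q. Markov's inequality bounds the μ-mass of this neighbourhood by a
constant times |q|^(-τ n) + |q|^(-t (1 + τ)) (`exists_measureReal_nearIntegerSet_le`). Since τ n >
d, this is summable over q ∈ ℤ^d once t (1 + τ) > d, and Borel–Cantelli gives μ(E) = 0. So no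
measure supported in E decays faster than |ξ|^(-d/(1+τ)).

Lower bound. A smooth density G is multiplied by the average, over q with entries in (M, 2M], of a
periodic bump in x q of width ε = (2M)^(-τ). On the Fourier side this adds M^(-d) ∑ c(m) Ĝ(ξ - m ⊗
q) over m ≠ 0 and q, where |c(m)| ≪ (ε |m|)^(-κ) for every κ ≥ 0
(`IsRapidDensity.exists_refinement`). By the divisor bound an integer matrix η has at most about
|η|^δ factorizations m ⊗ q, so these translates hardly overlap. For large M the added term is small
both in the sup norm with weight (1 + |ξ|)^a, when a (1 + τ) < d, and in L² with weight (1 +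
|ξ|)^(-β), when τ n - d < β (1 + τ) and β ≤ n. Iterating with summable errors and taking a weak
limit gives a measure on a compact subset of E with decay a and finite energy
(`exists_finite_measure_wellApproxMatrices`).

Letting a approach d/(1+τ) gives the Fourier dimension. Letting β approach (τ n - d)/(1+τ), the
energy method gives Hausdorff dimension at least n d - (τ n - d)/(1+τ), which exceeds 2d/(1+τ)
unless n = d = 1. -/

/-! ### The divisor bound -/

open Finset in
/-- A power of two beats a linear function of the exponent. -/
theorem natCast_add_one_le_mul_two_rpow {δ : ℝ} (hδ : 0 < δ) (a : ℕ) :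
    (a : ℝ) + 1 ≤ (1 + 1 / (δ * Real.log 2)) * (2 : ℝ) ^ (a * δ) := by
  have hl : 0 < Real.log 2 := Real.log_pos (by norm_num)
  have h1 : 1 + a * δ * Real.log 2 ≤ (2 : ℝ) ^ (a * δ) := by
    rw [Real.rpow_def_of_pos (by norm_num)]
    have := Real.add_one_le_exp (Real.log 2 * (a * δ))
    linarith
  have h2 : (a : ℝ) + 1 ≤ (1 + 1 / (δ * Real.log 2)) * (1 + a * δ * Real.log 2) := by
    have : (1 + 1 / (δ * Real.log 2)) * (1 + a * δ * Real.log 2)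
        = 1 + a + a * δ * Real.log 2 + 1 / (δ * Real.log 2) := by
      field_simp
      ring
    rw [this]
    have : 0 ≤ a * δ * Real.log 2 := by positivity
    have : 0 ≤ 1 / (δ * Real.log 2) := by positivity
    linarith
  exact h2.trans (mul_le_mul_of_nonneg_left h1 (by positivity))

/-- The divisor bound `d(n) ≪ n ^ δ`. -/
theorem exists_card_divisors_le_rpow {δ : ℝ} (hδ : 0 < δ) :
    ∃ C : ℝ, 0 < C ∧ ∀ n : ℕ, n ≠ 0 → (n.divisors.card : ℝ) ≤ C * (n : ℝ) ^ δ := by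
  have hl : 0 < Real.log 2 := Real.log_pos (by norm_num)
  set K : ℝ := 1 + 1 / (δ * Real.log 2) with hK
  have hK1 : 1 ≤ K := by
    have : 0 ≤ 1 / (δ * Real.log 2) := by positivity
    linarith
  -- A prime p ≥ 2^(1/δ) has p^δ ≥ 2, so its factor a + 1 ≤ 2^a ≤ p^(aδ) costs nothing. Only the
  -- primes below `B` cost a factor `K`.
  obtain ⟨B, hB⟩ := exists_nat_ge ((2 : ℝ) ^ (1 / δ))
  refine ⟨K ^ B, by positivity, fun n hn => ?_⟩
  have hlocal : ∀ p ∈ n.primeFactors, ((n.factorization p : ℝ) + 1) ≤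
      (if p < B then K else 1) * ((p : ℝ) ^ (n.factorization p)) ^ δ := by
    intro p hp
    have hp2 : 2 ≤ p := (Nat.prime_of_mem_primeFactors hp).two_le
    have hp2' : (2 : ℝ) ≤ p := by exact_mod_cast hp2
    have hpow : ((p : ℝ) ^ (n.factorization p)) ^ δ = (p : ℝ) ^ (n.factorization p * δ) := by
      rw [← Real.rpow_natCast, ← Real.rpow_mul (by positivity)]
    rw [hpow]
    split_ifs with h
    · refine (natCast_add_one_le_mul_two_rpow hδ _).trans ?_
      rw [← hK]
      gcongr
    · have hpB : (2 : ℝ) ^ (1 / δ) ≤ p := hB.trans (by exact_mod_cast not_lt.1 h)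
      have h2 : (2 : ℝ) ≤ (p : ℝ) ^ δ := by
        calc (2 : ℝ) = ((2 : ℝ) ^ (1 / δ)) ^ δ := by
              rw [← Real.rpow_mul (by norm_num), one_div_mul_cancel hδ.ne', Real.rpow_one]
          _ ≤ (p : ℝ) ^ δ := by gcongr
      rw [one_mul, mul_comm, Real.rpow_mul (by positivity), Real.rpow_natCast]
      calc ((n.factorization p : ℝ) + 1) ≤ (2 : ℝ) ^ (n.factorization p) := by
            exact_mod_cast Nat.lt_two_pow_self
        _ ≤ _ := by gcongr
  have hprod : ∏ p ∈ n.primeFactors, ((p : ℝ) ^ (n.factorization p)) ^ δ = (n : ℝ) ^ δ := by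
    rw [Real.finsetProd_rpow _ _ (fun _ _ => by positivity)]
    congr 1
    have := Nat.prod_factorization_pow_eq_self hn
    conv_rhs => rw [← this]
    rw [Finsupp.prod, Nat.support_factorization]
    push_cast
    rfl
  have hif : ∏ p ∈ n.primeFactors, (if p < B then K else 1) ≤ K ^ B := by
    rw [Finset.prod_ite, Finset.prod_const_one, mul_one, Finset.prod_const]
    refine pow_le_pow_right₀ hK1 ?_
    calc (n.primeFactors.filter (· < B)).card ≤ (Finset.range B).card :=
          Finset.card_le_card fun p hp => by simpa using (Finset.mem_filter.1 hp).2
      _ = B := Finset.card_range B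
  calc (n.divisors.card : ℝ) = ∏ p ∈ n.primeFactors, ((n.factorization p : ℝ) + 1) := by
        rw [Nat.card_divisors hn]
        push_cast
        rfl
    _ ≤ ∏ p ∈ n.primeFactors,
        ((if p < B then K else 1) * ((p : ℝ) ^ (n.factorization p)) ^ δ) :=
        Finset.prod_le_prod (fun _ _ => by positivity) hlocal
    _ = (∏ p ∈ n.primeFactors, (if p < B then K else 1)) * (n : ℝ) ^ δ := by
        rw [Finset.prod_mul_distrib, hprod]
    _ ≤ K ^ B * (n : ℝ) ^ δ := by gcongr

/-! ### Lattice sums and power sums -/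

/-- A product of absolutely convergent series is the absolutely convergent sum over all choices
of terms. -/
theorem summable_norm_and_hasSum_prod {R κ : Type*} [RCLike R]
    (n : ℕ) (f : Fin n → κ → R) (hf : ∀ i, Summable fun k => ‖f i k‖) :
    (Summable fun m : Fin n → κ => ‖∏ i, f i (m i)‖) ∧
      HasSum (fun m : Fin n → κ => ∏ i, f i (m i)) (∏ i, ∑' k, f i k) := by
  induction n with
  | zero =>
    simp only [Finset.univ_eq_empty, Finset.prod_empty]
    exact ⟨Summable.of_finite, hasSum_unique _⟩
  | succ n ih =>
    obtain ⟨h1, h2⟩ := ih (fun i => f i.succ) (fun i => hf i.succ)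
    have h0 : Summable fun k => ‖f 0 k‖ := hf 0
    obtain ⟨g, hg⟩ : ∃ g : (Fin n → κ) → R, ∀ m, g m = ∏ i, f i.succ (m i) := ⟨_, fun _ => rfl⟩
    simp only [← hg] at h1 h2
    have hs : Summable fun x : κ × (Fin n → κ) => ‖f 0 x.1 * g x.2‖ := h0.mul_norm h1
    let e : κ × (Fin n → κ) ≃ (Fin (n + 1) → κ) := Fin.consEquiv fun _ => κ
    have key : ∀ x, ∏ i, f i (e x i) = f 0 x.1 * g x.2 := by
      intro x
      rw [hg, Fin.prod_univ_succ]
      rfl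
    constructor
    · rw [← e.summable_iff]
      refine hs.congr fun x => ?_
      rw [← key]
      rfl
    · rw [← e.hasSum_iff, Fin.prod_univ_succ]
      refine (h0.of_norm.hasSum.mul h2 hs.of_norm).congr_fun ?_
      intro x
      exact key x

theorem summable_one_add_abs_int_rpow {p : ℝ} (hp : 1 < p) :
    Summable fun k : ℤ => (1 + |(k : ℝ)|) ^ (-p) := by
  have h : Summable fun k : ℕ => (1 + (k : ℝ)) ^ (-p) := by
    have := (summable_nat_add_iff 1).2 (Real.summable_nat_rpow.2 (by linarith : -p < -1))
    simpa [add_comm] using this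
  refine Summable.of_nat_of_neg ?_ ?_ <;> simpa using h

/-- Convergence of the lattice sum `∑ (1 + ‖η‖) ^ (-p)` for `p` above the dimension. -/
theorem summable_one_add_norm_int_rpow {ι : Type*} [Fintype ι] {p : ℝ}
    (hp : (Fintype.card ι : ℝ) < p) :
    Summable fun η : ι → ℤ => (1 + ‖η‖) ^ (-p) := by
  rcases isEmpty_or_nonempty ι with hι | hι
  · exact Summable.of_finite
  set N : ℕ := Fintype.card ι with hN
  have hN0 : (0 : ℝ) < N := by exact_mod_cast Fintype.card_pos
  have hp0 : 0 < p := hN0.trans hp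
  -- The norm dominates every coordinate, so the summand is at most a product of one-dimensional
  -- terms with exponent p / N > 1.
  have h1 := (summable_norm_and_hasSum_prod N
    (fun _ (k : ℤ) => (1 + |(k : ℝ)|) ^ (-(p / N))) (fun _ => by
      refine (summable_one_add_abs_int_rpow (p := p / N) ?_).norm
      rwa [lt_div_iff₀ hN0, one_mul])).2.summable
  let e : (ι → ℤ) ≃ (Fin N → ℤ) := (Fintype.equivFin ι).arrowCongr (Equiv.refl ℤ)
  refine Summable.of_nonneg_of_le (fun _ => by positivity) (fun η => ?_)
    (e.summable_iff.2 h1)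
  have h2 : (∏ i, (1 + |((e η i : ℤ) : ℝ)|) ^ (-(p / N)))
      = ∏ i, (1 + |(η i : ℝ)|) ^ (-(p / N)) := by
    rw [← (Fintype.equivFin ι).prod_comp]
    simp [e]
  simp only [Function.comp]
  rw [h2]
  calc (1 + ‖η‖) ^ (-p) = ∏ _i : ι, (1 + ‖η‖) ^ (-(p / N)) := by
        rw [Finset.prod_const, Finset.card_univ, ← hN, ← Real.rpow_natCast,
          ← Real.rpow_mul (by positivity)]
        congr 1
        field_simp
    _ ≤ _ := by
        refine Finset.prod_le_prod (fun _ _ => by positivity) fun i _ => ?_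
        refine Real.rpow_le_rpow_of_nonpos (by positivity) ?_ (by
          rw [neg_nonpos]; positivity)
        have := norm_le_pi_norm η i
        rw [Int.norm_eq_abs] at this
        linarith

/-- Induction on `L`: the increment is Bernoulli's inequality for the exponent 1 - u at the point -1
/ (L + 1). -/
theorem sum_Icc_rpow_neg_le {u : ℝ} (hu0 : 0 ≤ u) (hu : u < 1) (L : ℕ) :
    (1 - u) * ∑ k ∈ Finset.Icc 1 L, (k : ℝ) ^ (-u) ≤ (L : ℝ) ^ (1 - u) := by
  induction L with
  | zero => simp [Real.zero_rpow (by linarith : (1 - u) ≠ 0)]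
  | succ L ih =>
    rw [Finset.sum_Icc_succ_top (by omega), mul_add]
    have hpos : (0 : ℝ) < (L + 1 : ℕ) := by positivity
    have h := rpow_one_add_le_one_add_mul_self (s := -1 / ((L + 1 : ℕ) : ℝ)) (by
      rw [le_div_iff₀ hpos]
      push_cast
      linarith [(Nat.cast_nonneg L : (0 : ℝ) ≤ L)]) (p := 1 - u) (by linarith) (by linarith)
    have e1 : (1 + -1 / ((L + 1 : ℕ) : ℝ)) = L / ((L + 1 : ℕ) : ℝ) := by
      field_simp
      push_cast
      ring
    rw [e1, Real.div_rpow (by positivity) (by positivity), div_le_iff₀ (by positivity)] at h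
    have e2 : ((L + 1 : ℕ) : ℝ) ^ (-u) = ((L + 1 : ℕ) : ℝ) ^ (1 - u) / ((L + 1 : ℕ) : ℝ) := by
      rw [← Real.rpow_sub_one hpos.ne']
      congr 1
      ring
    rw [e2]
    have e3 : (1 + (1 - u) * (-1 / ((L + 1 : ℕ) : ℝ))) * ((L + 1 : ℕ) : ℝ) ^ (1 - u)
        = ((L + 1 : ℕ) : ℝ) ^ (1 - u)
          - (1 - u) * (((L + 1 : ℕ) : ℝ) ^ (1 - u) / ((L + 1 : ℕ) : ℝ)) := by
      ring
    linarith [e3 ▸ h]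

/-! ### Integer vectors and rank one matrices -/

/-- An integer vector, seen in Euclidean space. -/
def latticeVec {ι : Type*} (η : ι → ℤ) : EuclideanSpace ℝ ι :=
  WithLp.toLp 2 fun i => (η i : ℝ)

/-- The rank one integer matrix `m ⊗ q`. -/
def outerProd {n d : ℕ} (m : Fin n → ℤ) (q : Fin d → ℤ) : Fin n × Fin d → ℤ :=
  fun p => m p.1 * q p.2

theorem latticeVec_sub {ι : Type*} (η ζ : ι → ℤ) :
    latticeVec η - latticeVec ζ = latticeVec (η - ζ) := by
  ext i
  simp [latticeVec]

theorem outerProd_sub {n d : ℕ} (m m' : Fin n → ℤ) (q : Fin d → ℤ) :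
    outerProd m q - outerProd m' q = outerProd (m - m') q := by
  ext i
  simp [outerProd, sub_mul]

theorem latticeVec_zero {ι : Type*} : latticeVec (0 : ι → ℤ) = 0 := by
  ext i
  simp [latticeVec]

theorem outerProd_zero {n d : ℕ} (q : Fin d → ℤ) : outerProd (0 : Fin n → ℤ) q = 0 := by
  ext i
  simp [outerProd]

theorem norm_le_norm_latticeVec {ι : Type*} [Fintype ι] (η : ι → ℤ) :
    ‖η‖ ≤ ‖latticeVec η‖ := by
  refine (pi_norm_le_iff_of_nonneg (norm_nonneg _)).2 fun i => ?_
  have := PiLp.norm_apply_le (latticeVec η) i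
  simpa [latticeVec, Int.norm_eq_abs] using this

theorem norm_latticeVec_le {ι : Type*} [Fintype ι] (η : ι → ℤ) :
    ‖latticeVec η‖ ≤ Fintype.card ι * ‖η‖ := by
  rw [EuclideanSpace.norm_eq]
  refine Real.sqrt_le_iff.2 ⟨by positivity, ?_⟩
  have h : ∀ i ∈ Finset.univ, ‖latticeVec η i‖ ^ 2 ≤ ‖η‖ ^ 2 := fun i _ => by
    have := norm_le_pi_norm η i
    gcongr
    simpa [latticeVec, Int.norm_eq_abs] using this
  refine (Finset.sum_le_card_nsmul _ _ _ h).trans ?_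
  rw [Finset.card_univ, nsmul_eq_mul, mul_pow]
  gcongr
  exact_mod_cast Nat.le_self_pow two_ne_zero _

theorem inner_latticeVec_outerProd {n d : ℕ} (x : EuclideanSpace ℝ (Fin n × Fin d))
    (m : Fin n → ℤ) (q : Fin d → ℤ) :
    inner ℝ x (latticeVec (outerProd m q)) = ∑ i, (m i : ℝ) * ∑ j, x (i, j) * (q j : ℝ) := by
  simp only [PiLp.inner_apply, latticeVec, outerProd, Fintype.sum_prod_type, Finset.mul_sum]
  refine Finset.sum_congr rfl fun i _ => Finset.sum_congr rfl fun j _ => ?_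
  simp
  ring

theorem exists_norm_apply_eq_norm {ι : Type*} [Fintype ι] [Nonempty ι] (η : ι → ℤ) :
    ∃ i, ‖η i‖ = ‖η‖ := by
  obtain ⟨i, hi⟩ := Finite.exists_max fun i => ‖η i‖
  exact ⟨i, le_antisymm (norm_le_pi_norm η i)
    ((pi_norm_le_iff_of_nonneg (norm_nonneg _)).2 hi)⟩

theorem norm_outerProd {n d : ℕ} [NeZero n] [NeZero d] (m : Fin n → ℤ) (q : Fin d → ℤ) :
    ‖outerProd m q‖ = ‖m‖ * ‖q‖ := by
  refine le_antisymm ((pi_norm_le_iff_of_nonneg (by positivity)).2 fun p => ?_) ?_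
  · rw [outerProd, norm_mul]
    gcongr <;> exact norm_le_pi_norm _ _
  · obtain ⟨i, hi⟩ := exists_norm_apply_eq_norm m
    obtain ⟨j, hj⟩ := exists_norm_apply_eq_norm q
    rw [← hi, ← hj, ← norm_mul]
    exact norm_le_pi_norm (outerProd m q) (i, j)

theorem one_le_norm_of_ne_zero {ι : Type*} [Fintype ι] {η : ι → ℤ} (h : η ≠ 0) : 1 ≤ ‖η‖ := by
  obtain ⟨i, hi⟩ := Function.ne_iff.1 h
  refine le_trans ?_ (norm_le_pi_norm η i)
  rw [Int.norm_eq_abs]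
  exact_mod_cast Int.one_le_abs hi

/-! ### Phases and exponential sums -/

theorem norm_fourier_phase {a : ℝ} :
    ‖Complex.exp (-2 * (Real.pi : ℂ) * Complex.I * (a : ℂ))‖ = 1 := by
  rw [show (-2 * (Real.pi : ℂ) * Complex.I * (a : ℂ)) = ((-2 * Real.pi * a : ℝ) : ℂ) * Complex.I by
    push_cast; ring]
  exact Complex.norm_exp_ofReal_mul_I _

open MeasureTheory in
theorem integrable_fourier_phase {ι : Type*} [Fintype ι] (μ : Measure (EuclideanSpace ℝ ι))
    [IsFiniteMeasure μ] (ξ : EuclideanSpace ℝ ι) :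
    Integrable (fun x => Complex.exp (-2 * (Real.pi : ℂ) * Complex.I * ((inner ℝ x ξ : ℝ) : ℂ)))
      μ := by
  refine Integrable.of_bound (C := 1) ?_ (.of_forall fun x => norm_fourier_phase.le)
  exact Continuous.aestronglyMeasurable (by fun_prop)

open MeasureTheory in
theorem norm_fourierTransformMeasure_le {ι : Type*} [Fintype ι]
    (μ : Measure (EuclideanSpace ℝ ι)) (ξ : EuclideanSpace ℝ ι) :
    ‖fourierTransformMeasure μ ξ‖ ≤ μ.real Set.univ := by
  refine (norm_integral_le_integral_norm _).trans ?_
  simp_rw [norm_fourier_phase]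
  simp

open MeasureTheory in
/-- The mean square of a trigonometric polynomial, in terms of the Fourier transform. -/
theorem integral_norm_sum_phase_sq {ι α : Type*} [Fintype ι] (μ : Measure (EuclideanSpace ℝ ι))
    [IsFiniteMeasure μ] (F : Finset α) (v : α → EuclideanSpace ℝ ι) :
    ∫ x, ‖∑ a ∈ F, Complex.exp (-2 * (Real.pi : ℂ) * Complex.I * ((inner ℝ x (v a) : ℝ) : ℂ))‖ ^ 2
      ∂μ ≤ ∑ a ∈ F, ∑ b ∈ F, ‖fourierTransformMeasure μ (v a - v b)‖ := by
  have key : ∀ x, ((‖∑ a ∈ F,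
      Complex.exp (-2 * (Real.pi : ℂ) * Complex.I * ((inner ℝ x (v a) : ℝ) : ℂ))‖ ^ 2 : ℝ) : ℂ)
      = ∑ a ∈ F, ∑ b ∈ F,
        Complex.exp (-2 * (Real.pi : ℂ) * Complex.I * ((inner ℝ x (v a - v b) : ℝ) : ℂ)) := by
    intro x
    rw [Complex.ofReal_pow, ← Complex.mul_conj', map_sum, Finset.sum_mul_sum]
    refine Finset.sum_congr rfl fun a _ => Finset.sum_congr rfl fun b _ => ?_
    rw [← Complex.exp_conj, ← Complex.exp_add]
    congr 1
    simp only [map_mul, map_neg, Complex.conj_ofReal, Complex.conj_I, map_ofNat, inner_sub_right]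
    push_cast
    ring
  have h : ((∫ x, ‖∑ a ∈ F,
      Complex.exp (-2 * (Real.pi : ℂ) * Complex.I * ((inner ℝ x (v a) : ℝ) : ℂ))‖ ^ 2 ∂μ : ℝ) : ℂ)
      = ∑ a ∈ F, ∑ b ∈ F, fourierTransformMeasure μ (v a - v b) := by
    rw [← integral_complex_ofReal]
    simp_rw [key]
    rw [integral_finsetSum _ fun a _ => integrable_finsetSum _ fun b _ =>
      integrable_fourier_phase μ _]
    refine Finset.sum_congr rfl fun a _ => ?_
    rw [integral_finsetSum _ fun b _ => integrable_fourier_phase μ _]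
    rfl
  refine (le_abs_self _).trans ?_
  rw [← Real.norm_eq_abs, ← Complex.norm_real, h]
  refine (norm_sum_le _ _).trans (Finset.sum_le_sum fun a _ => norm_sum_le _ _)

/-- A geometric sum of phases is large near the integers. -/
theorem le_norm_sum_phase_sq {L : ℕ} {y δ : ℝ} {r : ℤ} (hy : |y - r| ≤ δ)
    (hL : ((L : ℝ) - 1) * δ ≤ 1 / 8) :
    (L : ℝ) ^ 2 / 2 ≤
      ‖∑ j ∈ Finset.range L, Complex.exp (-2 * (Real.pi : ℂ) * Complex.I * (((j : ℝ) * y : ℝ) : ℂ))‖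
        ^ 2 := by
  -- Modulo 1 each j y lies within 1/8 of 0, so each phase has argument at most π/4 in absolute
  -- value. No cancellation can occur, and squaring √2 / 2 gives the factor 1/2.
  have hterm : ∀ j ∈ Finset.range L, √2 / 2 ≤
      (Complex.exp (-2 * (Real.pi : ℂ) * Complex.I * (((j : ℝ) * y : ℝ) : ℂ))).re := by
    intro j hj
    have hj' : (j : ℝ) ≤ L - 1 := by
      have : j + 1 ≤ L := Finset.mem_range.1 hj
      have : (j : ℝ) + 1 ≤ L := by exact_mod_cast this
      linarith
    have hsmall : |(j : ℝ) * (y - r)| ≤ 1 / 8 := by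
      rw [abs_mul, Nat.abs_cast]
      have h0 : 0 ≤ δ := (abs_nonneg _).trans hy
      calc (j : ℝ) * |y - r| ≤ (L - 1) * δ :=
            mul_le_mul hj' hy (abs_nonneg _) ((Nat.cast_nonneg j).trans hj')
        _ ≤ 1 / 8 := hL
    have e1 : Complex.exp (-2 * (Real.pi : ℂ) * Complex.I * (((j : ℝ) * y : ℝ) : ℂ))
        = Complex.exp (((-(2 * Real.pi * (j * (y - r))) : ℝ) : ℂ) * Complex.I) := by
      rw [Complex.exp_eq_exp_iff_exists_int]
      refine ⟨-(j * r), ?_⟩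
      push_cast
      ring
    rw [e1, Complex.exp_ofReal_mul_I_re, Real.cos_neg, ← Real.cos_abs, ← Real.cos_pi_div_four]
    refine Real.cos_le_cos_of_nonneg_of_le_pi (abs_nonneg _) ?_ ?_
    · linarith [Real.pi_pos]
    · rw [abs_mul, abs_of_pos Real.two_pi_pos]
      nlinarith [Real.pi_pos]
  have hre : L * (√2 / 2) ≤
      ‖∑ j ∈ Finset.range L,
        Complex.exp (-2 * (Real.pi : ℂ) * Complex.I * (((j : ℝ) * y : ℝ) : ℂ))‖ := by
    refine le_trans ?_ (Complex.re_le_norm _)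
    rw [Complex.re_sum]
    have := Finset.card_nsmul_le_sum _ _ _ hterm
    simpa using this
  calc (L : ℝ) ^ 2 / 2 = (L * (√2 / 2)) ^ 2 := by
        rw [mul_pow, div_pow, Real.sq_sqrt (by norm_num)]
        ring
    _ ≤ _ := by gcongr

theorem sum_union_le_add {α : Type*} [DecidableEq α] {s t : Finset α} {f : α → ℝ}
    (hf : ∀ a, 0 ≤ f a) : ∑ a ∈ s ∪ t, f a ≤ ∑ a ∈ s, f a + ∑ a ∈ t, f a := by
  rw [← Finset.sum_union_inter]
  exact le_add_of_nonneg_right (Finset.sum_nonneg fun a _ => hf a)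

/-- A sum over pairs in an interval of a negative power of the distance. -/
theorem sum_range_sum_range_max_rpow_le {u : ℝ} (hu0 : 0 ≤ u) (hu : u < 1) {L : ℕ} (hL : 1 ≤ L) :
    ∑ a ∈ Finset.range L, ∑ b ∈ Finset.range L, (max 1 |(a : ℝ) - b|) ^ (-u)
      ≤ (1 + 2 / (1 - u)) * (L : ℝ) ^ (2 - u) := by
  have hu1 : 0 < 1 - u := by linarith
  have hL0 : (0 : ℝ) < L := by exact_mod_cast hL
  have hrow : ∀ a ∈ Finset.range L, ∑ b ∈ Finset.range L, (max 1 |(a : ℝ) - b|) ^ (-u)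
      ≤ (1 + 2 / (1 - u)) * (L : ℝ) ^ (1 - u) := by
    intro a ha
    have ha' : a < L := Finset.mem_range.1 ha
    set S := ∑ k ∈ Finset.Icc 1 L, (k : ℝ) ^ (-u) with hS
    have hSle : S ≤ (L : ℝ) ^ (1 - u) / (1 - u) := by
      rw [le_div_iff₀ hu1, mul_comm]
      exact sum_Icc_rpow_neg_le hu0 hu L
    -- The diagonal term, then b = a - k and b = a + k with k ≥ 1: both sides are dominated by the
    -- same power sum `S`.
    have hsplit : Finset.range L ⊆ {a} ∪ (Finset.Icc 1 a).image (fun k => a - k)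
        ∪ (Finset.Icc 1 L).image (fun k => a + k) := by
      intro b hb
      have hb' := Finset.mem_range.1 hb
      simp only [Finset.mem_union, Finset.mem_singleton, Finset.mem_image, Finset.mem_Icc]
      rcases lt_trichotomy b a with h | h | h
      · exact Or.inl (Or.inr ⟨a - b, by omega, by omega⟩)
      · exact Or.inl (Or.inl h)
      · exact Or.inr ⟨b - a, by omega, by omega⟩
    have h1 : ∑ b ∈ (Finset.Icc 1 a).image (fun k => a - k), (max 1 |(a : ℝ) - b|) ^ (-u) ≤ S := by
      refine (Finset.sum_image_le_of_nonneg (fun _ _ => by positivity)).trans ?_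
      refine (Finset.sum_le_sum (g := fun k : ℕ => (k : ℝ) ^ (-u)) fun k hk => ?_).trans
        (Finset.sum_le_sum_of_subset_of_nonneg
          (Finset.Icc_subset_Icc_right ha'.le) fun _ _ _ => by positivity)
      obtain ⟨hk1, hk2⟩ := Finset.mem_Icc.1 hk
      refine Real.rpow_le_rpow_of_nonpos (by exact_mod_cast hk1) (le_max_of_le_right ?_)
        (by linarith)
      rw [Nat.cast_sub hk2, sub_sub_cancel, Nat.abs_cast]
    have h2 : ∑ b ∈ (Finset.Icc 1 L).image (fun k => a + k), (max 1 |(a : ℝ) - b|) ^ (-u) ≤ S := by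
      refine (Finset.sum_image_le_of_nonneg (fun _ _ => by positivity)).trans ?_
      refine Finset.sum_le_sum fun k hk => ?_
      obtain ⟨hk1, hk2⟩ := Finset.mem_Icc.1 hk
      refine Real.rpow_le_rpow_of_nonpos (by exact_mod_cast hk1) (le_max_of_le_right ?_)
        (by linarith)
      rw [Nat.cast_add, sub_add_cancel_left, abs_neg, Nat.abs_cast]
    have h3 : (1 : ℝ) ≤ (L : ℝ) ^ (1 - u) :=
      Real.one_le_rpow (by exact_mod_cast hL) hu1.le
    calc ∑ b ∈ Finset.range L, (max 1 |(a : ℝ) - b|) ^ (-u)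
        ≤ ∑ b ∈ {a} ∪ (Finset.Icc 1 a).image (fun k => a - k)
            ∪ (Finset.Icc 1 L).image (fun k => a + k), (max 1 |(a : ℝ) - b|) ^ (-u) :=
          Finset.sum_le_sum_of_subset_of_nonneg hsplit fun _ _ _ => by positivity
      _ ≤ (∑ b ∈ {a} ∪ (Finset.Icc 1 a).image (fun k => a - k), (max 1 |(a : ℝ) - b|) ^ (-u))
            + S := by
          refine (sum_union_le_add fun _ => by positivity).trans ?_
          gcongr
      _ ≤ (1 + S) + S := by
          gcongr
          refine (sum_union_le_add fun _ => by positivity).trans ?_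
          simpa using h1
      _ ≤ _ := by
          have : 2 / (1 - u) * (L : ℝ) ^ (1 - u) = 2 * ((L : ℝ) ^ (1 - u) / (1 - u)) := by ring
          rw [add_mul, this]
          linarith
  refine (Finset.sum_le_card_nsmul _ _ _ hrow).trans (le_of_eq ?_)
  rw [Finset.card_range, nsmul_eq_mul, show (2 - u) = 1 + (1 - u) by ring,
    Real.rpow_add hL0, Real.rpow_one]
  ring

/-! ### Upper bound for the Fourier dimension -/

section

open MeasureTheory

/-- The matrices `x` for which `x q` is within `δ` of an integer vector. -/
def nearIntegerSet (d n : ℕ) (q : Fin d → ℤ) (δ : ℝ) : Set (EuclideanSpace ℝ (Fin n × Fin d)) :=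
  {x | ∃ r : Fin n → ℤ, ‖(fun i : Fin n => (∑ j : Fin d, x (i, j) * (q j : ℝ)) - (r i : ℝ))‖ < δ}

/-- A box trigonometric sum is a product of geometric sums. -/
theorem sum_phase_box_eq_prod {n d : ℕ} (L : ℕ) (q : Fin d → ℤ)
    (x : EuclideanSpace ℝ (Fin n × Fin d)) :
    ∑ a ∈ Fintype.piFinset (fun _ : Fin n => Finset.range L),
      Complex.exp (-2 * (Real.pi : ℂ) * Complex.I *
        ((inner ℝ x (latticeVec (outerProd (fun i => (a i : ℤ)) q)) : ℝ) : ℂ)) =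
    ∏ i, ∑ j ∈ Finset.range L, Complex.exp (-2 * (Real.pi : ℂ) * Complex.I *
      (((j : ℝ) * ∑ k, x (i, k) * (q k : ℝ) : ℝ) : ℂ)) := by
  rw [Finset.prod_univ_sum]
  refine Finset.sum_congr rfl fun a _ => ?_
  rw [inner_latticeVec_outerProd, ← Complex.exp_sum, ← Finset.mul_sum]
  push_cast
  rfl

/-- The kernel factorizes over coordinates, so the double sum is the n-th power of a one-dimensional
one. Each coordinate carries the exponent t / n, which must stay below 1: this is where t < n comes
from. -/
theorem sum_box_sum_box_prod_rpow_le {n : ℕ} {t : ℝ} (ht0 : 0 ≤ t) (htn : t < n) {L : ℕ}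
    (hL : 1 ≤ L) :
    ∑ a ∈ Fintype.piFinset (fun _ : Fin n => Finset.range L),
      ∑ b ∈ Fintype.piFinset (fun _ : Fin n => Finset.range L),
        ∏ i, (max 1 |(a i : ℝ) - b i|) ^ (-(t / n))
      ≤ (1 + 2 / (1 - t / n)) ^ n * (L : ℝ) ^ (2 * n - t) := by
  have hn : (0 : ℝ) < n := ht0.trans_lt htn
  have h1 : ∀ a : Fin n → ℕ, ∑ b ∈ Fintype.piFinset (fun _ : Fin n => Finset.range L),
        ∏ i, (max 1 |(a i : ℝ) - b i|) ^ (-(t / n))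
      = ∏ i, ∑ b ∈ Finset.range L, (max 1 |(a i : ℝ) - b|) ^ (-(t / n)) := fun a => by
    rw [Finset.prod_univ_sum]
  simp_rw [h1]
  rw [← Finset.prod_univ_sum (fun _ : Fin n => Finset.range L)
    (fun _ a => ∑ b ∈ Finset.range L, (max 1 |(a : ℝ) - b|) ^ (-(t / n)))]
  rw [Finset.prod_const, Finset.card_univ, Fintype.card_fin]
  have h2 := sum_range_sum_range_max_rpow_le (u := t / n) (by positivity)
    (by rwa [div_lt_one hn]) hL
  refine (pow_le_pow_left₀ (by positivity) h2 n).trans (le_of_eq ?_)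
  rw [mul_pow, ← Real.rpow_natCast ((L : ℝ) ^ _), ← Real.rpow_mul (by positivity)]
  congr 2
  field_simp

/-- The diagonal a = b is bounded trivially, by 1 per term, and gives L^n. Off the diagonal the
frequency m ⊗ q, m = a - b, has norm at least ‖m‖ ‖q‖, and ‖m‖^(-t) is at most the product of max(1,
|m_i|)^(-t/n), which decouples the coordinates. -/
theorem sum_norm_fourierTransformMeasure_box_le {n d : ℕ} [NeZero n] [NeZero d]
    {μ : Measure (EuclideanSpace ℝ (Fin n × Fin d))} [IsProbabilityMeasure μ] {C t : ℝ}
    (hC : 0 ≤ C) (ht0 : 0 ≤ t) (htn : t < n)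
    (hμ : ∀ ξ, 1 ≤ ‖ξ‖ → ‖fourierTransformMeasure μ ξ‖ ≤ C * ‖ξ‖ ^ (-t))
    {q : Fin d → ℤ} (hq : q ≠ 0) {L : ℕ} (hL : 1 ≤ L) :
    ∑ a ∈ Fintype.piFinset (fun _ : Fin n => Finset.range L),
      ∑ b ∈ Fintype.piFinset (fun _ : Fin n => Finset.range L),
        ‖fourierTransformMeasure μ (latticeVec (outerProd (fun i => (a i : ℤ)) q) -
          latticeVec (outerProd (fun i => (b i : ℤ)) q))‖
      ≤ (L : ℝ) ^ n + C * ‖q‖ ^ (-t) *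
        ((1 + 2 / (1 - t / n)) ^ n * (L : ℝ) ^ (2 * n - t)) := by
  classical
  have hn : (0 : ℝ) < n := ht0.trans_lt htn
  have hQ : 1 ≤ ‖q‖ := one_le_norm_of_ne_zero hq
  have hterm : ∀ a b : Fin n → ℕ,
      ‖fourierTransformMeasure μ (latticeVec (outerProd (fun i => (a i : ℤ)) q) -
          latticeVec (outerProd (fun i => (b i : ℤ)) q))‖ ≤
        (if a = b then 1 else 0) +
          C * ‖q‖ ^ (-t) * ∏ i, (max 1 |(a i : ℝ) - b i|) ^ (-(t / n)) := by
    intro a b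
    rw [latticeVec_sub, outerProd_sub]
    split_ifs with hab
    · refine (norm_fourierTransformMeasure_le μ _).trans ?_
      rw [probReal_univ]
      exact le_add_of_nonneg_right (by positivity)
    · set m : Fin n → ℤ := (fun i => (a i : ℤ)) - fun i => (b i : ℤ) with hm
      have hm0 : m ≠ 0 := by
        intro h
        refine hab (funext fun i => ?_)
        have := congrFun h i
        simp only [hm, Pi.sub_apply, Pi.zero_apply] at this
        omega
      have hm1 : 1 ≤ ‖m‖ := one_le_norm_of_ne_zero hm0
      have hlow : ‖m‖ * ‖q‖ ≤ ‖latticeVec (outerProd m q)‖ := by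
        rw [← norm_outerProd]
        exact norm_le_norm_latticeVec _
      have hmq : 1 ≤ ‖m‖ * ‖q‖ := one_le_mul_of_one_le_of_one_le hm1 hQ
      rw [zero_add]
      calc _ ≤ C * ‖latticeVec (outerProd m q)‖ ^ (-t) := hμ _ (hmq.trans hlow)
        _ ≤ C * (‖m‖ * ‖q‖) ^ (-t) := by
          gcongr C * ?_
          exact Real.rpow_le_rpow_of_nonpos (by positivity) hlow (by linarith)
        _ = C * ‖q‖ ^ (-t) * ∏ _i : Fin n, ‖m‖ ^ (-(t / n)) := by
          rw [Finset.prod_const, Finset.card_univ, Fintype.card_fin, ← Real.rpow_natCast,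
            ← Real.rpow_mul (by positivity), Real.mul_rpow (by positivity) (by positivity)]
          rw [show -(t / n) * n = -t by field_simp]
          ring
        _ ≤ _ := by
          gcongr C * ‖q‖ ^ (-t) * ?_
          refine Finset.prod_le_prod (fun _ _ => by positivity) fun i _ => ?_
          refine Real.rpow_le_rpow_of_nonpos (by positivity) (max_le hm1 ?_)
            (by rw [neg_nonpos]; positivity)
          have := norm_le_pi_norm m i
          rw [Int.norm_eq_abs] at this
          simpa [hm] using this
  refine (Finset.sum_le_sum fun a _ => Finset.sum_le_sum fun b _ => hterm a b).trans ?_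
  simp_rw [Finset.sum_add_distrib, ← Finset.mul_sum]
  gcongr
  · have hbox : ((Fintype.piFinset fun _ : Fin n => Finset.range L).card : ℝ) = (L : ℝ) ^ n := by
      simp
    rw [← hbox, Finset.card_eq_sum_ones, Nat.cast_sum]
    refine Finset.sum_le_sum fun a _ => ?_
    rw [Finset.sum_ite_eq]
    split_ifs
    simp
  · exact sum_box_sum_box_prod_rpow_le ht0 htn hL

/-- A measure with Fourier decay gives little mass to the neighbourhood of radius `‖q‖ ^ (-τ)` of
the rational points of denominator `q`. -/
theorem exists_measureReal_nearIntegerSet_le {n d : ℕ} [NeZero n] [NeZero d]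
    {μ : Measure (EuclideanSpace ℝ (Fin n × Fin d))} [IsProbabilityMeasure μ] {C t τ : ℝ}
    (hC : 0 ≤ C) (ht0 : 0 ≤ t) (htn : t < n)
    (hμ : ∀ ξ, 1 ≤ ‖ξ‖ → ‖fourierTransformMeasure μ ξ‖ ≤ C * ‖ξ‖ ^ (-t)) :
    ∃ K : ℝ, ∀ q : Fin d → ℤ, q ≠ 0 →
      μ.real (nearIntegerSet d n q (‖q‖ ^ (-τ))) ≤
        K * (‖q‖ ^ (-(τ * n)) + ‖q‖ ^ (-(t * (1 + τ)))) := by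
  have hn : (0 : ℝ) < n := ht0.trans_lt htn
  set B : ℝ := (1 + 2 / (1 - t / n)) ^ n with hB
  have hB0 : 0 ≤ B := by
    have : 0 < 1 - t / n := by rw [sub_pos, div_lt_one hn]; exact htn
    positivity
  refine ⟨2 ^ n * (8 ^ n + C * B * 8 ^ t), fun q hq => ?_⟩
  have hQ : 1 ≤ ‖q‖ := one_le_norm_of_ne_zero hq
  set Q := ‖q‖ with hQdef
  have hQ0 : 0 < Q := by linarith
  -- Essentially the longest box whose phases stay within an eighth of a turn when x q is
  -- Q^(-τ)-close to an integer vector. The added 1 gives both L ≥ 1 and L ≥ Q^τ / 8, and only L - 1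
  -- enters the phase condition.
  set L : ℕ := ⌊Q ^ τ / 8⌋₊ + 1 with hLdef
  have hL1 : 1 ≤ L := by omega
  have hL0 : (0 : ℝ) < L := by exact_mod_cast hL1
  have hLlow : Q ^ τ / 8 ≤ L := by
    rw [hLdef]
    push_cast
    exact (Nat.lt_floor_add_one _).le
  have hLup : ((L : ℝ) - 1) * Q ^ (-τ) ≤ 1 / 8 := by
    have h1 : ((L : ℝ) - 1) ≤ Q ^ τ / 8 := by
      rw [hLdef]
      push_cast
      rw [add_sub_cancel_right]
      exact Nat.floor_le (by positivity)
    calc ((L : ℝ) - 1) * Q ^ (-τ) ≤ Q ^ τ / 8 * Q ^ (-τ) := by gcongr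
      _ = 1 / 8 := by
        rw [Real.rpow_neg hQ0.le]
        field_simp
  set box := Fintype.piFinset (fun _ : Fin n => Finset.range L) with hbox
  set f : EuclideanSpace ℝ (Fin n × Fin d) → ℝ := fun x =>
    ‖∑ a ∈ box, Complex.exp (-2 * (Real.pi : ℂ) * Complex.I *
        ((inner ℝ x (latticeVec (outerProd (fun i => (a i : ℤ)) q)) : ℝ) : ℂ))‖ ^ 2 with hf
  have hsub : nearIntegerSet d n q (Q ^ (-τ)) ⊆ {x | ((L : ℝ) ^ 2 / 2) ^ n ≤ f x} := by
    rintro x ⟨r, hr⟩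
    simp only [Set.mem_ofPred_eq, hf, hbox]
    rw [sum_phase_box_eq_prod, norm_prod, ← Finset.prod_pow]
    calc ((L : ℝ) ^ 2 / 2) ^ n = ∏ _i : Fin n, ((L : ℝ) ^ 2 / 2) := by
            rw [Finset.prod_const, Finset.card_univ, Fintype.card_fin]
      _ ≤ _ := by
        refine Finset.prod_le_prod (fun _ _ => by positivity) fun i _ => ?_
        refine le_norm_sum_phase_sq (r := r i) (δ := Q ^ (-τ)) ?_ hLup
        exact ((norm_le_pi_norm _ i).trans hr.le)
  have hfc : Continuous f := by
    simp only [hf]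
    fun_prop
  have hfi : Integrable f μ := by
    refine Integrable.of_bound (C := (box.card : ℝ) ^ 2) hfc.aestronglyMeasurable
      (.of_forall fun x => ?_)
    rw [Real.norm_of_nonneg (by positivity)]
    simp only [hf]
    gcongr
    refine (norm_sum_le _ _).trans ?_
    simp_rw [norm_fourier_phase]
    simp
  -- Markov's inequality for `f`. Dividing the mean square by (L² / 2)^n leaves L^(-n) from the
  -- diagonal and (Q L)^(-t) from the rest, with L at least Q^τ / 8.
  have hmarkov := mul_meas_ge_le_integral_of_nonneg (μ := μ) (f := f)
    (.of_forall fun x => by positivity) hfi (((L : ℝ) ^ 2 / 2) ^ n)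
  have hint : ∫ x, f x ∂μ ≤ (L : ℝ) ^ n + C * Q ^ (-t) * (B * (L : ℝ) ^ (2 * n - t)) :=
    (integral_norm_sum_phase_sq μ box _).trans
      (sum_norm_fourierTransformMeasure_box_le hC ht0 htn hμ hq hL1)
  have hmain : ((L : ℝ) ^ 2 / 2) ^ n * μ.real (nearIntegerSet d n q (Q ^ (-τ))) ≤
      (L : ℝ) ^ n + C * Q ^ (-t) * (B * (L : ℝ) ^ (2 * n - t)) := by
    refine le_trans ?_ (hmarkov.trans hint)
    exact mul_le_mul_of_nonneg_left (measureReal_mono hsub) (by positivity)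
  have hLn : (L : ℝ) ^ n = (L : ℝ) ^ (n : ℝ) := (Real.rpow_natCast _ _).symm
  have e1 : ((L : ℝ) ^ 2 / 2) ^ n = (L : ℝ) ^ (2 * n : ℝ) / 2 ^ n := by
    rw [div_pow, ← pow_mul, ← Real.rpow_natCast]
    push_cast
    rfl
  rw [e1, hLn, div_mul_eq_mul_div, div_le_iff₀ (by positivity), ← le_div_iff₀' (by positivity)]
    at hmain
  have e2 : ((L : ℝ) ^ (n : ℝ) + C * Q ^ (-t) * (B * (L : ℝ) ^ (2 * n - t))) * 2 ^ n
      / (L : ℝ) ^ (2 * n : ℝ) = 2 ^ n * ((L : ℝ) ^ (-(n : ℝ)) + C * B * Q ^ (-t) * (L : ℝ) ^ (-t)) := by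
    have h1 : (L : ℝ) ^ (-(n : ℝ)) = (L : ℝ) ^ (n : ℝ) / (L : ℝ) ^ (2 * n : ℝ) := by
      rw [← Real.rpow_sub hL0]
      congr 1
      ring
    have h2 : (L : ℝ) ^ (-t) = (L : ℝ) ^ (2 * n - t) / (L : ℝ) ^ (2 * n : ℝ) := by
      rw [← Real.rpow_sub hL0]
      congr 1
      ring
    rw [h1, h2]
    ring
  rw [e2] at hmain
  refine hmain.trans ?_
  rw [mul_assoc (2 ^ n : ℝ) (8 ^ n + _)]
  refine mul_le_mul_of_nonneg_left ?_ (by positivity)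
  have hneg : ∀ p : ℝ, 0 ≤ p → (L : ℝ) ^ (-p) ≤ 8 ^ p * Q ^ (-(τ * p)) := by
    intro p hp
    calc (L : ℝ) ^ (-p) ≤ (Q ^ τ / 8) ^ (-p) :=
          Real.rpow_le_rpow_of_nonpos (by positivity) hLlow (by linarith)
      _ = 8 ^ p * Q ^ (-(τ * p)) := by
        rw [Real.div_rpow (by positivity) (by positivity), ← Real.rpow_mul hQ0.le,
          Real.rpow_neg (by norm_num : (0 : ℝ) ≤ 8), mul_neg]
        field_simp
  have h1 : (L : ℝ) ^ (-(n : ℝ)) ≤ 8 ^ n * Q ^ (-(τ * n)) := by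
    simpa using hneg n hn.le
  have h2 : Q ^ (-t) * (L : ℝ) ^ (-t) ≤ 8 ^ t * Q ^ (-(t * (1 + τ))) := by
    calc Q ^ (-t) * (L : ℝ) ^ (-t) ≤ Q ^ (-t) * (8 ^ t * Q ^ (-(τ * t))) := by
          gcongr
          exact hneg t ht0
      _ = 8 ^ t * Q ^ (-(t * (1 + τ))) := by
        rw [show -(t * (1 + τ)) = -t + -(τ * t) by ring, Real.rpow_add hQ0]
        ring
  have hp1 : 0 ≤ Q ^ (-(τ * n)) := by positivity
  have hp2 : 0 ≤ Q ^ (-(t * (1 + τ))) := by positivity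
  have hp3 : (0 : ℝ) ≤ C * B * 8 ^ t := by positivity
  calc _ = (L : ℝ) ^ (-(n : ℝ)) + C * B * (Q ^ (-t) * (L : ℝ) ^ (-t)) := by ring
    _ ≤ 8 ^ n * Q ^ (-(τ * n)) + C * B * (8 ^ t * Q ^ (-(t * (1 + τ)))) := by gcongr
    _ ≤ _ := by nlinarith [mul_nonneg hp3 hp1, mul_nonneg (by positivity : (0:ℝ) ≤ 8 ^ n) hp2]

/-- Borel–Cantelli over q ∈ ℤ^d: the two powers of ‖q‖ bounding the mass are summable because τ n >
d and t (1 + τ) > d. -/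
theorem measure_wellApproxMatrices_eq_zero {n d : ℕ} [NeZero n] [NeZero d]
    {μ : Measure (EuclideanSpace ℝ (Fin n × Fin d))} [IsProbabilityMeasure μ] {C t τ : ℝ}
    (hC : 0 ≤ C) (hτ : (d : ℝ) / n < τ) (htd : d / (1 + τ) < t) (htn : t < n)
    (hμ : ∀ ξ, 1 ≤ ‖ξ‖ → ‖fourierTransformMeasure μ ξ‖ ≤ C * ‖ξ‖ ^ (-t)) :
    μ (wellApproxMatrices τ d n) = 0 := by
  have hn : (0 : ℝ) < n := by exact_mod_cast NeZero.pos n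
  have hτ0 : 0 < τ := lt_of_le_of_lt (by positivity) hτ
  have ht0 : 0 ≤ t := le_trans (by positivity) htd.le
  obtain ⟨K, hK⟩ := exists_measureReal_nearIntegerSet_le (τ := τ) hC ht0 htn hμ
  have hsummable : ∀ p : ℝ, (d : ℝ) < p → Summable fun q : Fin d → ℤ =>
      if q = 0 then 0 else ‖q‖ ^ (-p) := by
    intro p hp
    have hp0 : 0 < p := lt_of_le_of_lt (by positivity) hp
    have h := (summable_one_add_norm_int_rpow (ι := Fin d) (p := p)
      (by simpa using hp)).mul_left (2 ^ p)
    refine Summable.of_nonneg_of_le (fun q => by positivity) (fun q => ?_) h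
    split_ifs with hq
    · positivity
    · have h1 := one_le_norm_of_ne_zero hq
      rw [Real.rpow_neg (by positivity), Real.rpow_neg (by positivity), ← div_eq_mul_inv,
        inv_eq_one_div, div_le_div_iff₀ (by positivity) (by positivity), one_mul,
        ← Real.mul_rpow (by positivity) (by positivity)]
      gcongr
      linarith
  set A : (Fin d → ℤ) → Set (EuclideanSpace ℝ (Fin n × Fin d)) := fun q =>
    if q = 0 then ∅ else nearIntegerSet d n q (‖q‖ ^ (-τ)) with hA
  have hsum : ∑' q, μ (A q) ≠ ⊤ := by
    have h : Summable fun q : Fin d → ℤ => μ.real (A q) := by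
      refine Summable.of_nonneg_of_le (fun q => measureReal_nonneg) (fun q => ?_)
        (((hsummable (τ * n) ?_).add (hsummable (t * (1 + τ)) ?_)).mul_left K)
      · by_cases hq : q = 0
        · simp [hA, hq]
        · simp only [hA, hq, if_false]
          exact hK q hq
      · rwa [div_lt_iff₀ hn] at hτ
      · rwa [div_lt_iff₀ (by linarith)] at htd
    have h2 : ∀ q, μ (A q) = ENNReal.ofReal (μ.real (A q)) := fun q =>
      (ofReal_measureReal (measure_ne_top _ _)).symm
    simp_rw [h2]
    exact h.tsum_ofReal_ne_top
  have hzero := measure_limsup_cofinite_eq_zero hsum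
  refine measure_mono_null (fun x hx => ?_) hzero
  rw [Filter.cofinite.limsup_set_eq, Set.mem_ofPred_eq]
  by_contra hfin
  rw [Set.not_infinite] at hfin
  -- Infinitely many pairs (q, r) yield infinitely many q: for given q every r_i lies within 1 of
  -- the i-th entry of x q, which leaves finitely many r.
  refine hx (((hfin.biUnion (t := fun q => {q} ×ˢ {r : Fin n → ℤ | ∀ i, r i ∈
    Set.Icc ⌊(∑ j, x (i, j) * (q j : ℝ)) - 1⌋ ⌈(∑ j, x (i, j) * (q j : ℝ)) + 1⌉}) fun q _ =>
      (Set.finite_singleton q).prod (Set.Finite.pi' fun i => Set.finite_Icc _ _))).subset ?_)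
  rintro ⟨q, r⟩ ⟨hq, hr⟩
  simp only [Set.mem_iUnion, Set.mem_prod, Set.mem_singleton_iff, Set.mem_ofPred_eq, Set.mem_Icc]
  refine ⟨q, ?_, rfl, fun i => ?_⟩
  · simp only [hA, show q ≠ 0 from hq, if_false]
    exact ⟨r, hr⟩
  · have h1 : |(∑ j, x (i, j) * (q j : ℝ)) - r i| ≤ 1 :=
      (norm_le_pi_norm (fun i : Fin n => (∑ j : Fin d, x (i, j) * (q j : ℝ)) - (r i : ℝ)) i).trans
        (hr.le.trans (Real.rpow_le_one_of_one_le_of_nonpos (one_le_norm_of_ne_zero hq)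
          (by linarith)))
    rw [abs_le] at h1
    constructor
    · have h2 := Int.floor_le ((∑ j, x (i, j) * (q j : ℝ)) - 1)
      have h3 : ((⌊(∑ j, x (i, j) * (q j : ℝ)) - 1⌋ : ℤ) : ℝ) ≤ r i := by linarith
      exact_mod_cast h3
    · have h2 := Int.le_ceil ((∑ j, x (i, j) * (q j : ℝ)) + 1)
      have h3 : (r i : ℝ) ≤ ((⌈(∑ j, x (i, j) * (q j : ℝ)) + 1⌉ : ℤ) : ℝ) := by linarith
      exact_mod_cast h3

/-- The Fourier dimension of `E(τ, d, n)` is at most `2 d / (1 + τ)`, one measure at a time. -/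
theorem measureFourierDim_le_of_support_subset {n d : ℕ} [NeZero n] [NeZero d]
    {μ : Measure (EuclideanSpace ℝ (Fin n × Fin d))} [IsProbabilityMeasure μ] {τ : ℝ}
    (hτ : (d : ℝ) / n < τ) (hsupp : μ.support ⊆ wellApproxMatrices τ d n) :
    measureFourierDim μ ≤ 2 * d / (1 + τ) := by
  have hn : (0 : ℝ) < n := by exact_mod_cast NeZero.pos n
  have hτ0 : 0 < τ := lt_of_le_of_lt (by positivity) hτ
  refine Real.sSup_le ?_ (by positivity)
  rintro s ⟨-, C, hC⟩
  by_contra! hs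
  have hdn : (d : ℝ) / (1 + τ) < n := by
    rw [div_lt_iff₀ (by linarith)]
    rw [div_lt_iff₀ hn] at hτ
    nlinarith
  have hs2 : d / (1 + τ) < s / 2 := by
    rw [mul_div_assoc] at hs
    linarith
  -- The rate s / 2 may exceed n, where the box estimate fails. Lowering it to some t < n is
  -- harmless for ‖ξ‖ ≥ 1 and still leaves t > d / (1 + τ), because d / (1 + τ) < n.
  obtain ⟨t, ht1, ht2⟩ := exists_between (lt_min hs2 hdn)
  have hzero := measure_wellApproxMatrices_eq_zero (μ := μ) (C := |C|) (t := t) (abs_nonneg C) hτ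
    ht1 (ht2.trans_le (min_le_right _ _)) (fun ξ hξ => by
      refine (hC ξ (by rintro rfl; simp at hξ; linarith)).trans ?_
      gcongr
      · exact le_abs_self C
      · have := ht2.le.trans (min_le_left _ _)
        linarith)
  have h1 := measure_mono_null hsupp hzero
  have h2 := Measure.measure_compl_support (μ := μ)
  have h3 := measure_univ (μ := μ)
  rw [← Set.union_compl_self μ.support] at h3
  have h4 := measure_union_null h1 h2
  rw [h4] at h3
  exact zero_ne_one h3

end

/-! ### Fourier energy and Hausdorff dimension -/

section

open MeasureTheory

/-- The Gaussian `exp (-π ‖z‖² / r²)` is the Fourier transform of a Gaussian of width `1 / r`. -/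
theorem integral_gaussian_mul_phase {ι : Type*} [Fintype ι] {r : ℝ} (hr : 0 < r)
    (z : EuclideanSpace ℝ ι) :
    ∫ ξ : EuclideanSpace ℝ ι, ((r ^ (Fintype.card ι : ℝ) *
        Real.exp (-(Real.pi * r ^ 2) * ‖ξ‖ ^ 2) : ℝ) : ℂ) *
        Complex.exp (-2 * (Real.pi : ℂ) * Complex.I * ((inner ℝ z ξ : ℝ) : ℂ))
      = ((Real.exp (-Real.pi * ‖z‖ ^ 2 / r ^ 2) : ℝ) : ℂ) := by
  have hb : 0 < (((Real.pi * r ^ 2 : ℝ)) : ℂ).re := by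
    rw [Complex.ofReal_re]
    positivity
  have h := fourier_gaussian_innerProductSpace hb z
  rw [Real.fourier_eq'] at h
  have hpow : ((Real.pi : ℂ) / ((Real.pi * r ^ 2 : ℝ) : ℂ)) ^
      ((Module.finrank ℝ (EuclideanSpace ℝ ι) : ℂ) / 2) =
      (((r ^ (Fintype.card ι : ℝ))⁻¹ : ℝ) : ℂ) := by
    have e1 : (Real.pi : ℂ) / ((Real.pi * r ^ 2 : ℝ) : ℂ) = ((r ^ (-2 : ℝ) : ℝ) : ℂ) := by
      rw [← Complex.ofReal_div]
      congr 1
      rw [Real.rpow_neg hr.le, Real.rpow_two]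
      field_simp
    rw [e1, finrank_euclideanSpace, show ((Fintype.card ι : ℂ) / 2) =
      (((Fintype.card ι : ℝ) / 2 : ℝ) : ℂ) by push_cast; rfl,
      ← Complex.ofReal_cpow (by positivity), ← Real.rpow_mul hr.le, ← Real.rpow_neg hr.le]
    congr 2
    ring
  rw [hpow] at h
  have hr' : (r ^ (Fintype.card ι : ℝ) : ℝ) ≠ 0 := by positivity
  calc _ = ((r ^ (Fintype.card ι : ℝ) : ℝ) : ℂ) * ∫ v : EuclideanSpace ℝ ι,
        Complex.exp (((-2 * Real.pi * inner ℝ v z : ℝ) : ℂ) * Complex.I) •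
          Complex.exp (-((Real.pi * r ^ 2 : ℝ) : ℂ) * ‖v‖ ^ 2) := by
        rw [← integral_const_mul]
        refine integral_congr_ae (.of_forall fun ξ => ?_)
        simp only [smul_eq_mul]
        rw [real_inner_comm]
        push_cast
        rw [show (-2 * (Real.pi : ℂ) * Complex.I * ((inner ℝ ξ z : ℝ) : ℂ)) =
          -2 * (Real.pi : ℂ) * ((inner ℝ ξ z : ℝ) : ℂ) * Complex.I by ring]
        ring
    _ = _ := by
        rw [h, ← mul_assoc, ← Complex.ofReal_mul, mul_inv_cancel₀ hr', Complex.ofReal_one, one_mul]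
        rw [Complex.ofReal_exp]
        congr 1
        push_cast
        have : (Real.pi : ℂ) ≠ 0 := by exact_mod_cast Real.pi_ne_zero
        have : (r : ℂ) ≠ 0 := by exact_mod_cast hr.ne'
        field_simp

/-- The Gaussian energy of a measure at scale `r`, on the Fourier side. -/
theorem integral_prod_gaussian {ι : Type*} [Fintype ι] (μ : Measure (EuclideanSpace ℝ ι))
    [IsFiniteMeasure μ] {r : ℝ} (hr : 0 < r) :
    ∫ z, Real.exp (-Real.pi * ‖z.1 - z.2‖ ^ 2 / r ^ 2) ∂(μ.prod μ) =
      ∫ ξ : EuclideanSpace ℝ ι, r ^ (Fintype.card ι : ℝ) *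
        Real.exp (-(Real.pi * r ^ 2) * ‖ξ‖ ^ 2) * ‖fourierTransformMeasure μ ξ‖ ^ 2 := by
  set g : EuclideanSpace ℝ ι → ℝ := fun ξ => r ^ (Fintype.card ι : ℝ) *
        Real.exp (-(Real.pi * r ^ 2) * ‖ξ‖ ^ 2) with hg
  have hgi : Integrable g := by
    have h := GaussianFourier.integrable_cexp_neg_mul_sq_norm_add (V := EuclideanSpace ℝ ι)
      (b := ((Real.pi * r ^ 2 : ℝ) : ℂ)) (by rw [Complex.ofReal_re]; positivity) 0 0
    have h2 := (h.norm).const_mul (r ^ (Fintype.card ι : ℝ))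
    refine h2.congr (.of_forall fun ξ => ?_)
    simp only [hg]
    congr 1
    rw [Complex.norm_exp]
    congr 1
    simp [← Complex.ofReal_pow]
  rw [← Complex.ofReal_inj, ← integral_complex_ofReal, ← integral_complex_ofReal]
  calc _ = ∫ z, ∫ ξ, (g ξ : ℂ) * Complex.exp (-2 * (Real.pi : ℂ) * Complex.I *
          ((inner ℝ (z.1 - z.2) ξ : ℝ) : ℂ)) ∂(volume : Measure (EuclideanSpace ℝ ι))
          ∂(μ.prod μ) := by
        refine integral_congr_ae (.of_forall fun z => ?_)
        exact (integral_gaussian_mul_phase hr (z.1 - z.2)).symm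
    _ = ∫ ξ, ∫ z, (g ξ : ℂ) * Complex.exp (-2 * (Real.pi : ℂ) * Complex.I *
          ((inner ℝ (z.1 - z.2) ξ : ℝ) : ℂ)) ∂(μ.prod μ) := by
        refine integral_integral_swap ?_
        refine Integrable.mono' (g := fun p => |g p.2|) (hgi.abs.comp_snd _) ?_
          (.of_forall fun p => ?_)
        · refine Continuous.aestronglyMeasurable ?_
          simp only [Function.uncurry_def, hg]
          fun_prop
        · simp only [Function.uncurry_def]
          rw [norm_mul, norm_fourier_phase, mul_one, Complex.norm_real, Real.norm_eq_abs]
    _ = _ := by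
        refine integral_congr_ae (.of_forall fun ξ => ?_)
        simp only
        rw [integral_const_mul, Complex.ofReal_mul _ (‖fourierTransformMeasure μ ξ‖ ^ 2)]
        congr 1
        rw [Complex.ofReal_pow, ← Complex.mul_conj', fourierTransformMeasure, ← integral_conj,
          ← integral_prod_mul]
        refine integral_congr_ae (.of_forall fun z => ?_)
        simp only
        rw [← Complex.exp_conj, ← Complex.exp_add]
        congr 1
        simp only [map_mul, map_neg, Complex.conj_ofReal, Complex.conj_I, map_ofNat,
          inner_sub_left]
        push_cast
        ring

/-- Trades the Gaussian for the energy weight at the price of r^(-β). Since r ≤ 1, r (1 + y) ≤ 1 + r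
y ≤ exp(r y), and β u - π u² ≤ β² with u = r y. -/
theorem gaussian_le_rpow {N β r y : ℝ} (hβ : 0 ≤ β) (hr : 0 < r) (hr1 : r ≤ 1) (hy : 0 ≤ y) :
    r ^ N * Real.exp (-(Real.pi * r ^ 2) * y ^ 2) ≤
      Real.exp (β ^ 2) * r ^ (N - β) * (1 + y) ^ (-β) := by
  have h1 : (r * (1 + y)) ^ β ≤ Real.exp (β * (r * y)) := by
    calc (r * (1 + y)) ^ β ≤ (Real.exp (r * y)) ^ β := by
          refine Real.rpow_le_rpow (by positivity) ?_ hβ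
          have := Real.add_one_le_exp (r * y)
          nlinarith
      _ = _ := by rw [← Real.exp_mul, mul_comm]
  have h2 : (r * (1 + y)) ^ β * Real.exp (-(Real.pi * r ^ 2) * y ^ 2) ≤ Real.exp (β ^ 2) := by
    refine (mul_le_mul_of_nonneg_right h1 (Real.exp_pos _).le).trans ?_
    rw [← Real.exp_add]
    refine Real.exp_le_exp.2 ?_
    nlinarith [Real.pi_gt_three, sq_nonneg (β - r * y), sq_nonneg (r * y), sq_nonneg β]
  have h3 : r ^ N = r ^ (N - β) * (1 + y) ^ (-β) * (r * (1 + y)) ^ β := by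
    rw [Real.mul_rpow hr.le (by positivity), Real.rpow_sub hr, Real.rpow_neg (by positivity)]
    have : (1 + y) ^ β ≠ 0 := by positivity
    have : r ^ β ≠ 0 := by positivity
    field_simp
  rw [h3]
  calc _ = r ^ (N - β) * (1 + y) ^ (-β) *
        ((r * (1 + y)) ^ β * Real.exp (-(Real.pi * r ^ 2) * y ^ 2)) := by ring
    _ ≤ r ^ (N - β) * (1 + y) ^ (-β) * Real.exp (β ^ 2) := by gcongr
    _ = _ := by ring

theorem measurable_measure_closedBall_center {X : Type*} [PseudoMetricSpace X]
    [SecondCountableTopology X] [MeasurableSpace X] [BorelSpace X] (μ : Measure X)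
    [SFinite μ] (r : ℝ) : Measurable fun x => μ (Metric.closedBall x r) := by
  have h : MeasurableSet {p : X × X | dist p.2 p.1 ≤ r} :=
    (isClosed_le (by fun_prop) continuous_const).measurableSet
  exact measurable_measure_prodMk_left h

/-- A non-integrable function has Bochner integral 0, so no integrability need be checked when
passing to the extended energy integral. -/
theorem ofReal_integral_le_lintegral_ofReal {X : Type*} [MeasurableSpace X] {μ : Measure X}
    {f : X → ℝ} (hf : ∀ x, 0 ≤ f x) :
    ENNReal.ofReal (∫ x, f x ∂μ) ≤ ∫⁻ x, ENNReal.ofReal (f x) ∂μ := by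
  by_cases hi : Integrable f μ
  · rw [ofReal_integral_eq_lintegral_ofReal hi (.of_forall hf)]
  · simp [integral_undef hi]

/-- Average mass of balls of radius `r`, for a measure of finite energy. -/
theorem lintegral_measure_closedBall_le {ι : Type*} [Fintype ι]
    (μ : Measure (EuclideanSpace ℝ ι)) [IsFiniteMeasure μ] {β r : ℝ} (hβ : 0 ≤ β) (hr : 0 < r)
    (hr1 : r ≤ 1) :
    ∫⁻ x, μ (Metric.closedBall x r) ∂μ ≤
      ENNReal.ofReal (Real.exp Real.pi * Real.exp (β ^ 2)) *
        (∫⁻ ξ, ‖fourierTransformMeasure μ ξ‖ₑ ^ 2 * ENNReal.ofReal ((1 + ‖ξ‖) ^ (-β))) *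
        ENNReal.ofReal (r ^ (Fintype.card ι - β)) := by
  set k : EuclideanSpace ℝ ι × EuclideanSpace ℝ ι → ℝ := fun z =>
    Real.exp (-Real.pi * ‖z.1 - z.2‖ ^ 2 / r ^ 2) with hk
  have hkc : Continuous k := by
    simp only [hk]
    fun_prop
  have hk0 : ∀ z, 0 ≤ k z := fun z => (Real.exp_pos _).le
  have hki : Integrable k (μ.prod μ) := by
    refine Integrable.of_bound (C := 1) hkc.aestronglyMeasurable (.of_forall fun z => ?_)
    rw [Real.norm_of_nonneg (hk0 z)]
    refine Real.exp_le_one_iff.2 ?_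
    rw [neg_mul, neg_div]
    exact neg_nonpos.2 (by positivity)
  -- On the ball of radius r the kernel is at least exp(-π), so exp(π) times the kernel dominates
  -- the indicator.
  have hball : ∀ x, μ (Metric.closedBall x r) ≤
      ENNReal.ofReal (Real.exp Real.pi) * ∫⁻ y, ENNReal.ofReal (k (x, y)) ∂μ := by
    intro x
    rw [← lintegral_const_mul _ (by fun_prop), ← lintegral_indicator_one
      Metric.isClosed_closedBall.measurableSet]
    refine lintegral_mono fun y => Set.indicator_le (g := fun y => ENNReal.ofReal (Real.exp Real.pi) *
      ENNReal.ofReal (k (x, y))) (fun y hy => ?_) y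
    rw [← ENNReal.ofReal_mul (Real.exp_pos _).le, Pi.one_apply, ← ENNReal.ofReal_one]
    refine ENNReal.ofReal_le_ofReal ?_
    rw [hk, ← Real.exp_add]
    refine Real.one_le_exp ?_
    rw [Metric.mem_closedBall, dist_comm, dist_eq_norm] at hy
    have h1 : ‖x - y‖ ^ 2 / r ^ 2 ≤ 1 := by
      rw [div_le_one (by positivity)]
      gcongr
    have h2 : Real.pi * (‖x - y‖ ^ 2 / r ^ 2) ≤ Real.pi * 1 := by gcongr
    simp only
    rw [neg_mul, neg_div, mul_div_assoc]
    linarith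
  calc ∫⁻ x, μ (Metric.closedBall x r) ∂μ
      ≤ ∫⁻ x, ENNReal.ofReal (Real.exp Real.pi) * ∫⁻ y, ENNReal.ofReal (k (x, y)) ∂μ ∂μ :=
        lintegral_mono hball
    _ = ENNReal.ofReal (Real.exp Real.pi) * ∫⁻ z, ENNReal.ofReal (k z) ∂(μ.prod μ) := by
        rw [lintegral_prod _ (by fun_prop), lintegral_const_mul]
        exact Measurable.lintegral_prod_right' (f := fun z => ENNReal.ofReal (k z)) (by fun_prop)
    _ = ENNReal.ofReal (Real.exp Real.pi) * ENNReal.ofReal (∫ z, k z ∂(μ.prod μ)) := by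
        rw [ofReal_integral_eq_lintegral_ofReal hki (.of_forall hk0)]
    _ ≤ ENNReal.ofReal (Real.exp Real.pi) * ∫⁻ ξ, ENNReal.ofReal (Real.exp (β ^ 2) *
          r ^ (Fintype.card ι - β)) * (‖fourierTransformMeasure μ ξ‖ₑ ^ 2 *
          ENNReal.ofReal ((1 + ‖ξ‖) ^ (-β))) := by
        gcongr
        rw [integral_prod_gaussian μ hr]
        refine (ofReal_integral_le_lintegral_ofReal fun ξ => by positivity).trans (lintegral_mono fun ξ => ?_)
        rw [mul_comm (‖fourierTransformMeasure μ ξ‖ₑ ^ 2), ← mul_assoc,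
          ← ENNReal.ofReal_mul (by positivity), ENNReal.ofReal_mul (by positivity),
          ENNReal.ofReal_pow (norm_nonneg _), ofReal_norm]
        refine mul_le_mul_left (ENNReal.ofReal_le_ofReal ?_) _
        exact gaussian_le_rpow hβ hr hr1 (norm_nonneg ξ)
    _ = _ := by
        rw [lintegral_const_mul' _ _ ENNReal.ofReal_ne_top, ENNReal.ofReal_mul (by positivity),
          ENNReal.ofReal_mul (by positivity)]
        ring

/-- Mass distribution principle along the scales `2 ^ (-k)`. -/
theorem ofReal_le_dimH_of_measure_closedBall_le {X : Type*} [MetricSpace X] [MeasurableSpace X]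
    [BorelSpace X] {μ : Measure X} {A E : Set X} {s : ℝ} (hs : 0 < s) (hA : MeasurableSet A)
    (hμA : μ A ≠ 0) (hE : μ Eᶜ = 0) {c : ℝ} (hc : 0 < c)
    (h : ∀ x ∈ A, ∀ k : ℕ, μ (Metric.closedBall x ((1 / 2) ^ k)) ≤
      ENNReal.ofReal (c * ((1 / 2) ^ k) ^ s)) :
    ENNReal.ofReal s ≤ dimH E := by
  have hbase : ∀ S : Set X, Metric.ediam S ≤ 1 →
      μ.restrict A S ≤ ENNReal.ofReal (c * 2 ^ s) * Metric.ediam S ^ s := by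
    intro S hS
    rw [Measure.restrict_apply' hA]
    rcases (S ∩ A).eq_empty_or_nonempty with he | ⟨x, hxS, hxA⟩
    · simp [he]
    have hfin : Metric.ediam S ≠ ⊤ := ne_top_of_le_ne_top ENNReal.one_ne_top hS
    set D : ℝ := (Metric.ediam S).toReal with hD
    have hD0 : 0 ≤ D := ENNReal.toReal_nonneg
    have hD1 : D ≤ 1 := by
      rw [hD, ← ENNReal.toReal_one]
      exact ENNReal.toReal_mono ENNReal.one_ne_top hS
    have hDS : Metric.ediam S = ENNReal.ofReal D := (ENNReal.ofReal_toReal hfin).symm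
    have hk : ∀ k : ℕ, D ≤ (1 / 2) ^ k → μ (S ∩ A) ≤ ENNReal.ofReal (c * ((1 / 2) ^ k) ^ s) := by
      intro k hk
      refine le_trans (measure_mono fun y hy => ?_) (h x hxA k)
      rw [Metric.mem_closedBall]
      refine le_trans ?_ hk
      rw [hD, dist_edist]
      exact ENNReal.toReal_mono hfin (Metric.edist_le_ediam_of_mem hy.1 hxS)
    -- If the diameter is 0, the set fits in balls of every scale and is null since s > 0. Otherwise
    -- the dyadic scale just above the diameter is less than twice it, whence the factor 2^s.
    rcases hD0.eq_or_lt with h0 | hpos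
    · have hlim : Filter.Tendsto (fun k : ℕ => ENNReal.ofReal (c * ((1 / 2) ^ k) ^ s))
          Filter.atTop (nhds 0) := by
        rw [← ENNReal.ofReal_zero]
        refine ENNReal.tendsto_ofReal ?_
        rw [show (0 : ℝ) = c * 0 ^ s by rw [Real.zero_rpow hs.ne', mul_zero]]
        refine Filter.Tendsto.const_mul c ?_
        exact ((Real.continuousAt_rpow_const 0 s (Or.inr hs.le)).tendsto).comp
          (tendsto_pow_atTop_nhds_zero_of_lt_one (by norm_num) (by norm_num))
      refine (ge_of_tendsto' hlim fun k => hk k ?_).trans zero_le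
      rw [← h0]
      positivity
    · obtain ⟨k, hk1, hk2⟩ := exists_nat_pow_near_of_lt_one hpos hD1
        (by norm_num : (0 : ℝ) < 1 / 2) (by norm_num)
      refine (hk k hk2).trans ?_
      rw [hDS, ENNReal.ofReal_rpow_of_pos hpos, ← ENNReal.ofReal_mul (by positivity)]
      refine ENNReal.ofReal_le_ofReal ?_
      rw [mul_assoc, ← Real.mul_rpow (by norm_num) hD0]
      gcongr
      rw [pow_succ] at hk1
      linarith
  set c' : ENNReal := ENNReal.ofReal (c * 2 ^ s) with hc'
  have hc0 : c' ≠ 0 := by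
    rw [hc', Ne, ENNReal.ofReal_eq_zero, not_le]
    positivity
  have hle : c'⁻¹ • μ.restrict A ≤ Measure.hausdorffMeasure s := by
    refine Measure.le_hausdorffMeasure s _ 1 one_pos fun S hS => ?_
    rw [Measure.smul_apply, smul_eq_mul]
    calc c'⁻¹ * μ.restrict A S ≤ c'⁻¹ * (c' * Metric.ediam S ^ s) := by
          gcongr
          exact hbase S hS
      _ = Metric.ediam S ^ s := by
          rw [← mul_assoc, ENNReal.inv_mul_cancel hc0 ENNReal.ofReal_ne_top, one_mul]
  have hpos : (Measure.hausdorffMeasure s) E ≠ 0 := by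
    intro h0
    have h1 := hle E
    rw [h0, nonpos_iff_eq_zero, Measure.smul_apply, smul_eq_mul, mul_eq_zero,
      Measure.restrict_apply' hA] at h1
    rcases h1 with h1 | h1
    · exact ENNReal.ofReal_ne_top (ENNReal.inv_eq_zero.1 h1)
    · refine hμA (measure_mono_null (fun x hx => ?_) (measure_union_null h1 hE))
      by_cases hxE : x ∈ E
      · exact Or.inl ⟨hxE, hx⟩
      · exact Or.inr hxE
  refine le_dimH_of_hausdorffMeasure_ne_zero (d := s.toNNReal) ?_
  rwa [Real.coe_toNNReal _ hs.le]

/-- Lower bound for the Hausdorff dimension by the Fourier energy of a measure. -/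
theorem ofReal_le_dimH_of_energy_ne_top {ι : Type*} [Fintype ι]
    {μ : Measure (EuclideanSpace ℝ ι)} [IsFiniteMeasure μ] (hμ : μ ≠ 0)
    {E : Set (EuclideanSpace ℝ ι)} (hE : μ Eᶜ = 0) {β s : ℝ} (hβ : 0 ≤ β) (hs : 0 < s)
    (hsβ : s < Fintype.card ι - β)
    (hen : ∫⁻ ξ, ‖fourierTransformMeasure μ ξ‖ₑ ^ 2 * ENNReal.ofReal ((1 + ‖ξ‖) ^ (-β)) ≠ ⊤) :
    ENNReal.ofReal s ≤ dimH E := by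
  set w : ℕ → ENNReal := fun k => ENNReal.ofReal (((1 / 2 : ℝ) ^ k) ^ (-s)) with hw
  -- A weighted sum of ball masses over all scales. The average mass at scale 2^(-k) is
  -- O(2^(-k(N-β))), N being the dimension, so the integral of `H` is dominated by a geometric
  -- series of ratio 2^(-(N-β-s)) < 1. Hence `H` is bounded on a set of positive measure, and there
  -- each single term gives the bound needed for mass distribution.
  set H : EuclideanSpace ℝ ι → ENNReal := fun x =>
    ∑' k : ℕ, w k * μ (Metric.closedBall x ((1 / 2) ^ k)) with hH
  have hHm : Measurable H :=
    Measurable.tsum fun k => (measurable_measure_closedBall_center μ _).const_mul _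
  have hfin : ∫⁻ x, H x ∂μ ≠ ⊤ := by
    rw [hH, lintegral_tsum fun k =>
      ((measurable_measure_closedBall_center μ _).const_mul _).aemeasurable]
    set K := ENNReal.ofReal (Real.exp Real.pi * Real.exp (β ^ 2)) *
        (∫⁻ ξ, ‖fourierTransformMeasure μ ξ‖ₑ ^ 2 * ENNReal.ofReal ((1 + ‖ξ‖) ^ (-β))) with hK
    have hKt : K ≠ ⊤ := ENNReal.mul_ne_top ENNReal.ofReal_ne_top hen
    set ρ : ℝ := (1 / 2 : ℝ) ^ (Fintype.card ι - β - s) with hρ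
    have hρ1 : ρ < 1 := Real.rpow_lt_one (by norm_num) (by norm_num) (by linarith)
    have hρ0 : 0 ≤ ρ := by positivity
    have hterm : ∀ k : ℕ, ∫⁻ x, w k * μ (Metric.closedBall x ((1 / 2) ^ k)) ∂μ ≤
        K * ENNReal.ofReal (ρ ^ k) := by
      intro k
      rw [lintegral_const_mul _ (measurable_measure_closedBall_center μ _)]
      calc _ ≤ w k * (K * ENNReal.ofReal (((1 / 2 : ℝ) ^ k) ^ (Fintype.card ι - β))) := by
            gcongr
            exact lintegral_measure_closedBall_le μ hβ (by positivity)
              (pow_le_one₀ (by norm_num) (by norm_num))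
        _ = K * ENNReal.ofReal (ρ ^ k) := by
            rw [mul_left_comm, hw, ← ENNReal.ofReal_mul (by positivity),
              ← Real.rpow_add (by positivity), hρ, ← Real.rpow_natCast,
              ← Real.rpow_mul (by norm_num), ← Real.rpow_natCast (_ ^ _),
              ← Real.rpow_mul (by norm_num)]
            congr 3
            ring
    refine ne_top_of_le_ne_top ?_ (ENNReal.tsum_le_tsum hterm)
    rw [ENNReal.tsum_mul_left]
    exact ENNReal.mul_ne_top hKt (summable_geometric_of_lt_one hρ0 hρ1).tsum_ofReal_ne_top
  have hae := ae_lt_top hHm hfin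
  have hex : ∃ m : ℕ, μ {x | H x ≤ m} ≠ 0 := by
    by_contra! hall
    have h1 : μ (⋃ m : ℕ, {x | H x ≤ m}) = 0 := measure_iUnion_null hall
    have h2 : μ {x | ¬ H x < ⊤} = 0 := hae
    refine hμ (Measure.measure_univ_eq_zero.1 (measure_mono_null (fun x _ => ?_)
      (measure_union_null h1 h2)))
    by_cases hx : H x < ⊤
    · obtain ⟨m, hm⟩ := ENNReal.exists_nat_gt hx.ne
      exact Or.inl (Set.mem_iUnion.2 ⟨m, hm.le⟩)
    · exact Or.inr hx
  obtain ⟨m, hm⟩ := hex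
  refine ofReal_le_dimH_of_measure_closedBall_le hs (hHm measurableSet_Iic) hm hE
    (c := m + 1) (by positivity) fun x hx k => ?_
  have hx' : w k * μ (Metric.closedBall x ((1 / 2) ^ k)) ≤ m := (ENNReal.le_tsum k).trans hx
  have hw0 : w k ≠ 0 := by
    rw [hw, Ne, ENNReal.ofReal_eq_zero, not_le]
    positivity
  have hinv : ENNReal.ofReal ((((1 / 2 : ℝ) ^ k) ^ s)) * w k = 1 := by
    rw [hw, ← ENNReal.ofReal_mul (by positivity), ← Real.rpow_add (by positivity), add_neg_cancel,
      Real.rpow_zero, ENNReal.ofReal_one]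
  calc μ (Metric.closedBall x ((1 / 2) ^ k))
      = ENNReal.ofReal ((((1 / 2 : ℝ) ^ k) ^ s)) *
          (w k * μ (Metric.closedBall x ((1 / 2) ^ k))) := by rw [← mul_assoc, hinv, one_mul]
    _ ≤ ENNReal.ofReal ((((1 / 2 : ℝ) ^ k) ^ s)) * ENNReal.ofReal (m + 1) := by
        gcongr
        refine hx'.trans ?_
        rw [← ENNReal.ofReal_natCast]
        exact ENNReal.ofReal_le_ofReal (by linarith)
    _ = _ := by
        rw [← ENNReal.ofReal_mul (by positivity), mul_comm]

end

/-! ### Periodic bumps and their Fourier coefficients -/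

section

open MeasureTheory
open scoped FourierTransform SchwartzMap ContDiff

/-- A fixed smooth bump function on the line, of integral `1`, supported in `[-1/2, 1/2]`. -/
noncomputable def lineBump : ℝ → ℝ :=
  (⟨1 / 4, 1 / 2, by norm_num, by norm_num⟩ : ContDiffBump (0 : ℝ)).normed volume

theorem contDiff_lineBump : ContDiff ℝ ∞ lineBump := ContDiffBump.contDiff_normed _

theorem lineBump_nonneg (y : ℝ) : 0 ≤ lineBump y := ContDiffBump.nonneg_normed _ y

theorem hasCompactSupport_lineBump : HasCompactSupport lineBump :=
  ContDiffBump.hasCompactSupport_normed _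

theorem integral_lineBump : ∫ y, lineBump y = 1 := ContDiffBump.integral_normed _

theorem abs_le_of_lineBump_ne_zero {y : ℝ} (h : lineBump y ≠ 0) : |y| ≤ 1 / 2 := by
  have h1 : y ∈ Function.support lineBump := h
  rw [lineBump, ContDiffBump.support_normed_eq, Metric.mem_ball, dist_zero_right] at h1
  exact h1.le

/-- The Fourier transform of the bump on the line. -/
noncomputable def bumpCoeff (x : ℝ) : ℂ := 𝓕 (fun y : ℝ => (lineBump y : ℂ)) x

theorem bumpCoeff_zero : bumpCoeff 0 = 1 := by
  rw [bumpCoeff, Real.fourier_eq']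
  simp [integral_complex_ofReal, integral_lineBump]

theorem norm_bumpCoeff_le_one (x : ℝ) : ‖bumpCoeff x‖ ≤ 1 := by
  rw [bumpCoeff, Real.fourier_eq']
  refine (norm_integral_le_integral_norm _).trans (le_of_eq ?_)
  rw [← integral_lineBump]
  refine integral_congr_ae (.of_forall fun y => ?_)
  simp only [norm_smul, Complex.norm_exp_ofReal_mul_I, one_mul, Complex.norm_real]
  exact Real.norm_of_nonneg (lineBump_nonneg y)

/-- The transform of a Schwartz function is Schwartz. The integer exponent ⌈κ⌉ serves for |x| ≥ 1,
and the trivial bound by 1 serves for |x| ≤ 1. -/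
theorem exists_norm_bumpCoeff_le_rpow {κ : ℝ} (hκ : 0 ≤ κ) :
    ∃ C : ℝ, 0 < C ∧ ∀ x : ℝ, x ≠ 0 → ‖bumpCoeff x‖ ≤ C * |x| ^ (-κ) := by
  have hcs : HasCompactSupport fun y : ℝ => (lineBump y : ℂ) :=
    hasCompactSupport_lineBump.comp_left Complex.ofReal_zero
  have hcd : ContDiff ℝ ∞ fun y : ℝ => (lineBump y : ℂ) :=
    Complex.ofRealCLM.contDiff.comp contDiff_lineBump
  set S : 𝓢(ℝ, ℂ) := hcs.toSchwartzMap hcd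
  obtain ⟨C, hC0, hC⟩ := (𝓕 S).decay ⌈κ⌉₊ 0
  refine ⟨max C 1, by positivity, fun x hx => ?_⟩
  have hx0 : 0 < |x| := abs_pos.2 hx
  have hF : (𝓕 S) x = bumpCoeff x := by
    rw [SchwartzMap.fourier_coe]
    rfl
  have hCx : |x| ^ ⌈κ⌉₊ * ‖bumpCoeff x‖ ≤ C := by
    have := hC x
    rwa [norm_iteratedFDeriv_zero, hF, Real.norm_eq_abs] at this
  rw [Real.rpow_neg hx0.le, ← div_eq_mul_inv, le_div_iff₀ (by positivity), mul_comm]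
  rcases le_total |x| 1 with h1 | h1
  · calc |x| ^ κ * ‖bumpCoeff x‖ ≤ 1 * 1 := by
          gcongr
          · exact Real.rpow_le_one hx0.le h1 hκ
          · exact norm_bumpCoeff_le_one x
      _ ≤ max C 1 := by simp
  · calc |x| ^ κ * ‖bumpCoeff x‖ ≤ |x| ^ ⌈κ⌉₊ * ‖bumpCoeff x‖ := by
          gcongr
          rw [← Real.rpow_natCast]
          exact Real.rpow_le_rpow_of_exponent_le h1 (Nat.le_ceil κ)
      _ ≤ max C 1 := hCx.trans (le_max_left _ _)

/-- Poisson summation for the rescaled bump. -/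
theorem exists_periodic_bump {ε : ℝ} (hε : 0 < ε) :
    ∃ φ : ℝ → ℝ, (∀ y, 0 ≤ φ y) ∧ (∀ y, φ y ≠ 0 → ∃ k : ℤ, |y - k| ≤ ε / 2) ∧
      (Summable fun j : ℤ => ‖bumpCoeff (ε * j)‖) ∧
      ∀ y : ℝ, ∑' j : ℤ, bumpCoeff (ε * j) * Complex.exp (2 * (Real.pi : ℂ) * Complex.I * (j * y))
        = φ y := by
  -- With this L¹ normalization the transform at x is `bumpCoeff (ε * x)`, equal to 1 at x = 0. The
  -- periodic bump is the sum of the integer translates of `f`.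
  set f : ℝ → ℝ := fun y => ε⁻¹ * lineBump (y / ε) with hf
  have hf0 : ∀ y, 0 ≤ f y := fun y => mul_nonneg (by positivity) (lineBump_nonneg _)
  have hfs : ∀ y, f y ≠ 0 → |y| ≤ ε / 2 := by
    intro y hy
    have h1 := abs_le_of_lineBump_ne_zero (right_ne_zero_of_mul hy)
    rw [abs_div, abs_of_pos hε, div_le_iff₀ hε] at h1
    linarith
  have hcd : ContDiff ℝ ∞ fun y : ℝ => (f y : ℂ) :=
    Complex.ofRealCLM.contDiff.comp
      (contDiff_const.mul (contDiff_lineBump.comp (contDiff_id.div_const ε)))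
  have hcs : HasCompactSupport fun y : ℝ => (f y : ℂ) := by
    refine HasCompactSupport.of_support_subset_isCompact
      (isCompact_closedBall (0 : ℝ) (ε / 2)) fun y hy => ?_
    rw [mem_closedBall_zero_iff]
    exact hfs y fun h => hy (by simp [h])
  set S : 𝓢(ℝ, ℂ) := hcs.toSchwartzMap hcd with hS
  have hF : ∀ x, (𝓕 S) x = bumpCoeff (ε * x) := by
    intro x
    rw [SchwartzMap.fourier_coe, bumpCoeff, Real.fourier_eq', Real.fourier_eq']
    set G : ℝ → ℂ := fun u => Complex.exp (((-2 * Real.pi * inner ℝ u (ε * x) : ℝ) : ℂ) *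
      Complex.I) • (lineBump u : ℂ) with hG
    have h1 := Measure.integral_comp_div G ε
    rw [abs_of_pos hε] at h1
    have h2 : ∫ u, G u = (ε⁻¹ : ℝ) • ∫ v, G (v / ε) := by
      rw [h1, smul_smul, inv_mul_cancel₀ hε.ne', one_smul]
    rw [h2, ← integral_smul]
    refine integral_congr_ae (.of_forall fun v => ?_)
    simp only [hG, hS, hf, HasCompactSupport.toSchwartzMap_toFun, smul_eq_mul, Complex.real_smul,
      RCLike.inner_apply, conj_trivial]
    have e' : ε * x * (v / ε) = x * v := by field_simp
    simp only [e']
    push_cast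
    ring
  have hsum : Summable fun j : ℤ => ‖bumpCoeff (ε * j)‖ := by
    obtain ⟨C, hC0, hC⟩ := exists_norm_bumpCoeff_le_rpow (κ := 2) (by norm_num)
    refine Summable.of_norm_bounded_eventually
      (g := fun j : ℤ => C * ε ^ (-2 : ℝ) * |(j : ℝ)| ^ (-2 : ℝ))
      ((Real.summable_abs_int_rpow one_lt_two).mul_left _) ?_
    filter_upwards [(Set.finite_singleton (0 : ℤ)).compl_mem_cofinite] with j hj
    have hj0 : (j : ℝ) ≠ 0 := by exact_mod_cast hj
    refine (norm_norm _).le.trans ((hC _ (mul_ne_zero hε.ne' hj0)).trans (le_of_eq ?_))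
    rw [abs_mul, abs_of_pos hε, Real.mul_rpow hε.le (abs_nonneg _), mul_assoc]
  refine ⟨fun y => ∑' k : ℤ, f (y + k), fun y => tsum_nonneg fun k => hf0 _, fun y hy => ?_, hsum,
    fun y => ?_⟩
  · by_contra! hcon
    have hz : ∀ k : ℤ, f (y + k) = 0 := fun k => ?_
    · exact hy (by simp only [hz, tsum_zero])
    by_contra hne
    have h1 := hfs _ hne
    have h2 := hcon (-k)
    push_cast at h2
    rw [sub_neg_eq_add] at h2
    linarith
  · have h := SchwartzMap.tsum_eq_tsum_fourier S y
    simp only [hF] at h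
    rw [Complex.ofReal_tsum]
    refine Eq.trans ?_ h.symm
    refine tsum_congr fun j => ?_
    rw [fourier_coe_apply]
    congr 2
    simp
    ring

/-- The Fourier coefficients of the product bump of width `ε` on the torus. -/
noncomputable def boxCoeff {n : ℕ} (ε : ℝ) (m : Fin n → ℤ) : ℂ := ∏ i, bumpCoeff (ε * m i)

theorem boxCoeff_zero {n : ℕ} (ε : ℝ) : boxCoeff ε (0 : Fin n → ℤ) = 1 := by
  simp [boxCoeff, bumpCoeff_zero]

/-- A coordinate of maximal size supplies all the decay and the other factors are at most 1. The
constant does not depend on ε, as needed when ε shrinks with M. -/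
theorem exists_norm_boxCoeff_le_rpow (n : ℕ) [NeZero n] {κ : ℝ} (hκ : 0 ≤ κ) :
    ∃ C : ℝ, 0 < C ∧ ∀ ε : ℝ, 0 < ε → ∀ m : Fin n → ℤ, m ≠ 0 →
      ‖boxCoeff ε m‖ ≤ C * (ε * ‖m‖) ^ (-κ) := by
  obtain ⟨C, hC0, hC⟩ := exists_norm_bumpCoeff_le_rpow hκ
  refine ⟨C, hC0, fun ε hε m hm => ?_⟩
  obtain ⟨i, hi⟩ := exists_norm_apply_eq_norm m
  have hmi : (m i : ℝ) ≠ 0 := by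
    have h1 := one_le_norm_of_ne_zero hm
    rw [← hi, Int.norm_eq_abs] at h1
    exact abs_pos.1 (by linarith)
  rw [boxCoeff, norm_prod, ← Finset.mul_prod_erase _ _ (Finset.mem_univ i)]
  calc _ ≤ ‖bumpCoeff (ε * m i)‖ * 1 := by
        gcongr
        exact Finset.prod_le_one (fun _ _ => norm_nonneg _) fun _ _ => norm_bumpCoeff_le_one _
    _ ≤ _ := by
        rw [mul_one, ← hi, Int.norm_eq_abs]
        refine (hC _ (mul_ne_zero hε.ne' hmi)).trans (le_of_eq ?_)
        rw [abs_mul, abs_of_pos hε]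

theorem summable_norm_boxCoeff_mul_pow (n : ℕ) [NeZero n] {ε : ℝ} (hε : 0 < ε) (k : ℕ) :
    Summable fun m : Fin n → ℤ => ‖boxCoeff ε m‖ * (1 + ‖m‖) ^ k := by
  obtain ⟨C, hC0, hC⟩ := exists_norm_boxCoeff_le_rpow n (κ := k + (n + 1)) (by positivity)
  have hs := (summable_one_add_norm_int_rpow (ι := Fin n) (p := n + 1)
    (by simp)).mul_left (C * ε ^ (-(k + (n + 1) : ℝ)) * 2 ^ (k + (n + 1) : ℝ))
  refine Summable.of_norm_bounded_eventually hs ?_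
  filter_upwards [(Set.finite_singleton (0 : Fin n → ℤ)).compl_mem_cofinite] with m hm
  have hm1 : 1 ≤ ‖m‖ := one_le_norm_of_ne_zero hm
  rw [Real.norm_of_nonneg (by positivity)]
  have h2 : ‖m‖ ^ (-(k + (n + 1) : ℝ)) ≤
      2 ^ (k + (n + 1) : ℝ) * (1 + ‖m‖) ^ (-(k + (n + 1) : ℝ)) := by
    rw [Real.rpow_neg (by positivity), Real.rpow_neg (by positivity), ← div_eq_mul_inv,
      inv_eq_one_div, div_le_div_iff₀ (by positivity) (by positivity), one_mul,
      ← Real.mul_rpow (by positivity) (by positivity)]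
    gcongr
    linarith
  calc ‖boxCoeff ε m‖ * (1 + ‖m‖) ^ k
      ≤ C * (ε * ‖m‖) ^ (-(k + (n + 1) : ℝ)) * (1 + ‖m‖) ^ k := by
        gcongr
        exact hC ε hε m hm
    _ = C * ε ^ (-(k + (n + 1) : ℝ)) * ‖m‖ ^ (-(k + (n + 1) : ℝ)) * (1 + ‖m‖) ^ k := by
        rw [Real.mul_rpow hε.le (by positivity), ← mul_assoc C]
    _ ≤ C * ε ^ (-(k + (n + 1) : ℝ)) * (2 ^ (k + (n + 1) : ℝ) *
          (1 + ‖m‖) ^ (-(k + (n + 1) : ℝ))) * (1 + ‖m‖) ^ k := by gcongr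
    _ = C * ε ^ (-(k + (n + 1) : ℝ)) * 2 ^ (k + (n + 1) : ℝ) *
          ((1 + ‖m‖) ^ (-(k + (n + 1) : ℝ)) * (1 + ‖m‖) ^ (k : ℝ)) := by
        rw [Real.rpow_natCast]
        ring
    _ = _ := by
        rw [← Real.rpow_add (by positivity)]
        congr 2
        ring

/-- A nonnegative function on the torus concentrated near `0`, with its Fourier series. -/
theorem exists_periodic_box_bump (n : ℕ) [NeZero n] {ε : ℝ} (hε : 0 < ε) :
    ∃ Φ : (Fin n → ℝ) → ℝ, (∀ y, 0 ≤ Φ y) ∧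
      (∀ y, Φ y ≠ 0 → ∃ k : Fin n → ℤ, ∀ i, |y i - k i| ≤ ε / 2) ∧
      ∀ y : Fin n → ℝ, HasSum (fun m : Fin n → ℤ => boxCoeff ε m *
        Complex.exp (2 * (Real.pi : ℂ) * Complex.I * ((∑ i, (m i : ℝ) * y i : ℝ) : ℂ))) (Φ y) := by
  obtain ⟨φ, hφ0, hφs, hsum, hφ⟩ := exists_periodic_bump hε
  refine ⟨fun y => ∏ i, φ (y i), fun y => Finset.prod_nonneg fun i _ => hφ0 _, fun y hy => ?_,
    fun y => ?_⟩
  · have h := fun i => hφs (y i) (Finset.prod_ne_zero_iff.1 hy i (Finset.mem_univ i))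
    choose k hk using h
    exact ⟨k, hk⟩
  · have hexp : ∀ (j : ℤ) (x : ℝ),
        ‖Complex.exp (2 * (Real.pi : ℂ) * Complex.I * (j * x))‖ = 1 := by
      intro j x
      rw [show 2 * (Real.pi : ℂ) * Complex.I * (j * x) =
        ((2 * Real.pi * (j * x) : ℝ) : ℂ) * Complex.I by push_cast; ring]
      exact Complex.norm_exp_ofReal_mul_I _
    have h := (summable_norm_and_hasSum_prod n (fun i (j : ℤ) => bumpCoeff (ε * j) *
      Complex.exp (2 * (Real.pi : ℂ) * Complex.I * (j * y i))) fun i => by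
        simpa only [norm_mul, hexp, mul_one] using hsum).2
    simp only [hφ] at h
    rw [Complex.ofReal_prod]
    convert! h using 2 with m
    rw [Finset.prod_mul_distrib, ← Complex.exp_sum, ← Finset.mul_sum, boxCoeff]
    push_cast
    rfl

end

/-! ### Rapidly decaying densities -/

section

open MeasureTheory

/-- The Fourier transform of the measure with density `G`. -/
noncomputable def densityFourier {ι : Type*} [Fintype ι] (G : EuclideanSpace ℝ ι → ℝ)
    (ξ : EuclideanSpace ℝ ι) : ℂ :=
  ∫ x, Complex.exp (-2 * (Real.pi : ℂ) * Complex.I * ((inner ℝ x ξ : ℝ) : ℂ)) * (G x : ℂ)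

/-- Continuous compactly supported densities with rapidly decaying Fourier transform. -/
structure IsRapidDensity {ι : Type*} [Fintype ι] (G : EuclideanSpace ℝ ι → ℝ) : Prop where
  continuous : Continuous G
  hasCompactSupport : HasCompactSupport G
  nonneg : ∀ x, 0 ≤ G x
  decay : ∀ k : ℕ, ∃ A : ℝ, 0 ≤ A ∧ ∀ ξ, ‖densityFourier G ξ‖ ≤ A * (1 + ‖ξ‖) ^ (-(k : ℝ))

/-- Peetre's inequality, used throughout to move a polynomial weight across a translation. -/
theorem one_add_norm_le_mul_sub {V : Type*} [SeminormedAddCommGroup V] (x y : V) :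
    1 + ‖x‖ ≤ (1 + ‖y‖) * (1 + ‖x - y‖) := by
  have h := norm_add_le y (x - y)
  rw [add_sub_cancel] at h
  nlinarith [norm_nonneg y, norm_nonneg (x - y)]

theorem one_add_norm_rpow_neg_le {V : Type*} [SeminormedAddCommGroup V] (x y : V) {k : ℝ}
    (hk : 0 ≤ k) : (1 + ‖x - y‖) ^ (-k) ≤ (1 + ‖x‖) ^ (-k) * (1 + ‖y‖) ^ k := by
  have h : (1 + ‖x‖) ^ k ≤ (1 + ‖y‖) ^ k * (1 + ‖x - y‖) ^ k := by
    rw [← Real.mul_rpow (by positivity) (by positivity)]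
    exact Real.rpow_le_rpow (by positivity) (one_add_norm_le_mul_sub x y) hk
  rw [Real.rpow_neg (by positivity), Real.rpow_neg (by positivity), inv_mul_eq_div,
    inv_eq_one_div, div_le_div_iff₀ (by positivity) (by positivity), one_mul]
  exact h

namespace IsRapidDensity

variable {ι : Type*} [Fintype ι] {G : EuclideanSpace ℝ ι → ℝ}

theorem integrable (hG : IsRapidDensity G) : Integrable G :=
  hG.continuous.integrable_of_hasCompactSupport hG.hasCompactSupport

theorem integrable_phase_mul (hG : IsRapidDensity G) (ξ : EuclideanSpace ℝ ι) :
    Integrable fun x =>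
      Complex.exp (-2 * (Real.pi : ℂ) * Complex.I * ((inner ℝ x ξ : ℝ) : ℂ)) * (G x : ℂ) := by
  refine hG.integrable.ofReal.bdd_mul (c := 1) ?_ (.of_forall fun x => norm_fourier_phase.le)
  exact Continuous.aestronglyMeasurable (by fun_prop)

theorem continuous_densityFourier (hG : IsRapidDensity G) : Continuous (densityFourier G) := by
  refine continuous_of_dominated (bound := fun x => ‖G x‖) (fun ξ => ?_) (fun ξ => ?_)
    hG.integrable.norm (.of_forall fun x => by fun_prop)
  · exact (hG.integrable_phase_mul ξ).aestronglyMeasurable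
  · refine .of_forall fun x => ?_
    rw [norm_mul, norm_fourier_phase, one_mul, Complex.norm_real]

theorem exists_rpow_decay (hG : IsRapidDensity G) (p : ℝ) :
    ∃ A : ℝ, 0 ≤ A ∧ ∀ ξ, ‖densityFourier G ξ‖ ≤ A * (1 + ‖ξ‖) ^ (-p) := by
  obtain ⟨A, hA0, hA⟩ := hG.decay ⌈p⌉₊
  refine ⟨A, hA0, fun ξ => (hA ξ).trans ?_⟩
  gcongr
  · linarith [norm_nonneg ξ]
  · exact Nat.le_ceil p

/-- Uniformity in ξ is the point. Replacing ξ by the lattice vector `z` of its integer parts, at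
distance at most N, the dimension, turns the sum into a fixed convergent one shifted by `z`. -/
theorem exists_lattice_sum_le (hG : IsRapidDensity G) (a : ℝ) :
    ∃ A : ℝ, 0 ≤ A ∧ ∀ ξ, ∑' η : ι → ℤ, ENNReal.ofReal ((1 + ‖ξ - latticeVec η‖) ^ a) *
      ‖densityFourier G (ξ - latticeVec η)‖ₑ ≤ ENNReal.ofReal A := by
  set N : ℝ := (Fintype.card ι : ℝ) with hN
  have hN0 : 0 ≤ N := by positivity
  obtain ⟨A, hA0, hA⟩ := hG.exists_rpow_decay (a + (N + 1))
  have hs := summable_one_add_norm_int_rpow (ι := ι) (p := N + 1) (by linarith)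
  refine ⟨A * (1 + N) ^ (N + 1) * ∑' η : ι → ℤ, (1 + ‖η‖) ^ (-(N + 1)),
    mul_nonneg (by positivity) (tsum_nonneg fun _ => by positivity), fun ξ => ?_⟩
  set z : ι → ℤ := fun i => ⌊ξ i⌋ with hz
  have hξz : ‖ξ - latticeVec z‖ ≤ N := by
    rw [EuclideanSpace.norm_eq]
    refine Real.sqrt_le_iff.2 ⟨hN0, ?_⟩
    have h1 : ∀ i ∈ Finset.univ, ‖(ξ - latticeVec z) i‖ ^ 2 ≤ 1 := fun i _ => by
      have e : (ξ - latticeVec z) i = Int.fract (ξ i) := rfl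
      rw [e, Real.norm_of_nonneg (Int.fract_nonneg _)]
      exact pow_le_one₀ (Int.fract_nonneg _) (Int.fract_lt_one _).le
    refine (Finset.sum_le_card_nsmul _ _ _ h1).trans ?_
    rw [Finset.card_univ, nsmul_eq_mul, mul_one, hN]
    exact_mod_cast Nat.le_self_pow two_ne_zero _
  have hterm : ∀ η : ι → ℤ, ENNReal.ofReal ((1 + ‖ξ - latticeVec η‖) ^ a) *
      ‖densityFourier G (ξ - latticeVec η)‖ₑ ≤
      ENNReal.ofReal (A * (1 + N) ^ (N + 1) * (1 + ‖η - z‖) ^ (-(N + 1))) := by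
    intro η
    rw [← ofReal_norm, ← ENNReal.ofReal_mul (by positivity)]
    refine ENNReal.ofReal_le_ofReal ?_
    have h1 : 1 + ‖η - z‖ ≤ (1 + N) * (1 + ‖ξ - latticeVec η‖) := by
      have h2 : ‖η - z‖ ≤ ‖ξ - latticeVec z‖ + ‖ξ - latticeVec η‖ := by
        refine (norm_le_norm_latticeVec _).trans ?_
        rw [← latticeVec_sub]
        refine le_trans (le_of_eq ?_) (norm_sub_le _ _)
        congr 1
        abel
      nlinarith [norm_nonneg (ξ - latticeVec η)]
    have h3 : (1 + ‖ξ - latticeVec η‖) ^ (-(N + 1)) ≤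
        (1 + N) ^ (N + 1) * (1 + ‖η - z‖) ^ (-(N + 1)) := by
      rw [Real.rpow_neg (by positivity), Real.rpow_neg (by positivity), ← div_eq_mul_inv,
        inv_eq_one_div, div_le_div_iff₀ (by positivity) (by positivity), one_mul,
        ← Real.mul_rpow (by positivity) (by positivity)]
      gcongr
    calc (1 + ‖ξ - latticeVec η‖) ^ a * ‖densityFourier G (ξ - latticeVec η)‖
        ≤ (1 + ‖ξ - latticeVec η‖) ^ a *
          (A * (1 + ‖ξ - latticeVec η‖) ^ (-(a + (N + 1)))) := by
          gcongr
          exact hA _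
      _ = A * (1 + ‖ξ - latticeVec η‖) ^ (-(N + 1)) := by
          rw [mul_left_comm, ← Real.rpow_add (by positivity)]
          congr 2
          ring
      _ ≤ _ := by
          rw [mul_assoc]
          gcongr
  refine (ENNReal.tsum_le_tsum hterm).trans (le_of_eq ?_)
  rw [← (Equiv.subRight z).tsum_eq (fun η : ι → ℤ => (1 + ‖η‖) ^ (-(N + 1))), ← tsum_mul_left,
    ENNReal.ofReal_tsum_of_nonneg (fun _ => by positivity)]
  · rfl
  · exact ((Equiv.subRight z).summable_iff.2 hs).mul_left _

theorem lintegral_rpow_mul_ne_top (hG : IsRapidDensity G) (b : ℝ) :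
    ∫⁻ ξ, ENNReal.ofReal ((1 + ‖ξ‖) ^ b) * ‖densityFourier G ξ‖ₑ ≠ ⊤ := by
  obtain ⟨A, hA0, hA⟩ := hG.exists_rpow_decay (b + (Fintype.card ι + 1))
  have hfin := finite_integral_one_add_norm (E := EuclideanSpace ℝ ι) (μ := volume)
    (r := Fintype.card ι + 1) (by simp)
  have hle : ∀ ξ, ENNReal.ofReal ((1 + ‖ξ‖) ^ b) * ‖densityFourier G ξ‖ₑ ≤
      ENNReal.ofReal A * ENNReal.ofReal ((1 + ‖ξ‖) ^ (-(Fintype.card ι + 1 : ℝ))) := by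
    intro ξ
    rw [← ofReal_norm, ← ENNReal.ofReal_mul (by positivity), ← ENNReal.ofReal_mul hA0]
    refine ENNReal.ofReal_le_ofReal ?_
    calc (1 + ‖ξ‖) ^ b * ‖densityFourier G ξ‖
        ≤ (1 + ‖ξ‖) ^ b * (A * (1 + ‖ξ‖) ^ (-(b + (Fintype.card ι + 1)))) := by
          gcongr
          exact hA _
      _ = _ := by
          rw [mul_left_comm, ← Real.rpow_add (by positivity)]
          congr 2
          ring
  refine ne_top_of_le_ne_top ?_ (lintegral_mono hle)
  rw [lintegral_const_mul' _ _ ENNReal.ofReal_ne_top]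
  exact ENNReal.mul_ne_top ENNReal.ofReal_ne_top hfin.ne

end IsRapidDensity

/-! ### Denominators and factorizations of rank one matrices -/

/-- Cauchy–Schwarz for series in `[0, ∞]`. -/
theorem ENNReal_sq_tsum_le_mul {T : Type*} {t U V : T → ENNReal}
    (h : ∀ p, t p ^ 2 ≤ U p * V p) : (∑' p, t p) ^ 2 ≤ (∑' p, U p) * ∑' p, V p := by
  let : MeasurableSpace T := ⊤
  have hroot : ∀ x : ENNReal, (x ^ (1 / 2 : ℝ)) ^ (2 : ℝ) = x := fun x => by
    rw [← ENNReal.rpow_mul]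
    norm_num
  have h1 := ENNReal.lintegral_mul_le_Lp_mul_Lq (Measure.count : Measure T)
    Real.HolderConjugate.two_two (f := fun p => U p ^ (1 / 2 : ℝ))
    (g := fun p => V p ^ (1 / 2 : ℝ)) measurable_from_top.aemeasurable
    measurable_from_top.aemeasurable
  simp only [hroot, lintegral_count, Pi.mul_apply] at h1
  have h2 : ∑' p, t p ≤ ∑' p, U p ^ (1 / 2 : ℝ) * V p ^ (1 / 2 : ℝ) := by
    refine ENNReal.tsum_le_tsum fun p => ?_
    rw [← ENNReal.mul_rpow_of_nonneg _ _ (by norm_num)]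
    refine le_trans (le_of_eq ?_) (ENNReal.rpow_le_rpow (h p) (by norm_num : (0 : ℝ) ≤ 1 / 2))
    rw [← ENNReal.rpow_natCast, ← ENNReal.rpow_mul]
    norm_num
  calc (∑' p, t p) ^ 2 ≤ ((∑' p, U p) ^ (1 / 2 : ℝ) * (∑' p, V p) ^ (1 / 2 : ℝ)) ^ 2 := by
        gcongr
        exact h2.trans h1
    _ = _ := by
        rw [mul_pow, ← ENNReal.rpow_natCast, ← ENNReal.rpow_natCast]
        push_cast
        rw [hroot, hroot]

/-- Integer vectors with all entries in `(M, 2M]`. -/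
noncomputable def dyadicBox (d M : ℕ) : Finset (Fin d → ℤ) :=
  Fintype.piFinset fun _ => Finset.Ioc (M : ℤ) (2 * M)

theorem card_dyadicBox (d M : ℕ) : (dyadicBox d M).card = M ^ d := by
  simp only [dyadicBox, Fintype.card_piFinset, Int.card_Ioc, Finset.prod_const, Finset.card_univ,
    Fintype.card_fin]
  congr 1
  omega

theorem norm_bounds_of_mem_dyadicBox {d M : ℕ} [NeZero d] {q : Fin d → ℤ}
    (hq : q ∈ dyadicBox d M) : (M : ℝ) ≤ ‖q‖ ∧ ‖q‖ ≤ 2 * M := by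
  simp only [dyadicBox, Fintype.mem_piFinset, Finset.mem_Ioc] at hq
  constructor
  · refine le_trans ?_ (norm_le_pi_norm q 0)
    rw [Int.norm_eq_abs]
    refine le_trans ?_ (le_abs_self _)
    exact_mod_cast (hq 0).1.le
  · refine (pi_norm_le_iff_of_nonneg (by positivity)).2 fun i => ?_
    have h1 : (0 : ℤ) ≤ q i := by have := (hq i).1; omega
    rw [Int.norm_eq_abs, abs_of_nonneg (by exact_mod_cast h1)]
    exact_mod_cast (hq i).2

/-- Pairs `(m, q)` of a nonzero vector and a denominator of size about `M`. -/
abbrev FrequencyPair (n d M : ℕ) : Type :=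
  {m : Fin n → ℤ // m ≠ 0} × {q : Fin d → ℤ // q ∈ dyadicBox d M}

/-- The frequency `m ⊗ q` of a pair. -/
def FrequencyPair.freq {n d M : ℕ} (p : FrequencyPair n d M) : Fin n × Fin d → ℤ :=
  outerProd p.1.1 p.2.1

/-- A rank one integer matrix has few factorizations: sums over factorizations are controlled by
sums over the lattice. -/
theorem exists_tsum_frequencyPair_le (n d : ℕ) [NeZero d] {δ : ℝ} (hδ : 0 < δ) :
    ∃ C : ℝ, 0 ≤ C ∧ ∀ (M : ℕ) (h : (Fin n × Fin d → ℤ) → ENNReal),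
      ∑' p : FrequencyPair n d M, ENNReal.ofReal ((1 + ‖latticeVec p.freq‖) ^ (-δ)) * h p.freq ≤
        ENNReal.ofReal C * ∑' η, h η := by
  obtain ⟨C, hC0, hC⟩ := exists_card_divisors_le_rpow hδ
  refine ⟨C, hC0.le, fun M h => ?_⟩
  rw [← ENNReal.tsum_fiberwise _ (FrequencyPair.freq (n := n) (d := d) (M := M)),
    ← ENNReal.tsum_mul_left]
  refine ENNReal.tsum_le_tsum fun η => ?_
  set F : Set (FrequencyPair n d M) := FrequencyPair.freq ⁻¹' {η} with hF
  have hconst : ∀ p : F, ENNReal.ofReal ((1 + ‖latticeVec p.1.freq‖) ^ (-δ)) * h p.1.freq =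
      ENNReal.ofReal ((1 + ‖latticeVec η‖) ^ (-δ)) * h η := fun p => by
    rw [show p.1.freq = η from p.2]
  simp_rw [hconst]
  rcases isEmpty_or_nonempty F with hemp | ⟨⟨p₀, hp₀⟩⟩
  · simp
  obtain ⟨i, hi⟩ := Function.ne_iff.1 p₀.1.2
  rw [Pi.zero_apply] at hi
  have hqpos : ∀ p : FrequencyPair n d M, 0 < p.2.1 0 := by
    intro p
    have h1 := p.2.2
    simp only [dyadicBox, Fintype.mem_piFinset, Finset.mem_Ioc] at h1
    have := (h1 0).1
    omega
  have hη : ∀ p ∈ F, ∀ i j, p.1.1 i * p.2.1 j = η (i, j) := fun p hp i j =>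
    congrFun (show p.freq = η from hp) (i, j)
  have hne : η (i, 0) ≠ 0 := by
    rw [← hη p₀ hp₀ i 0]
    exact mul_ne_zero hi (hqpos p₀).ne'
  -- A factorization of η is determined by the single entry q_0: column 0 of η recovers m, then row
  -- i, where m_i ≠ 0, recovers q. As q_0 is a positive divisor of the nonzero entry η(i, 0), the
  -- divisor bound applies.
  let g : F → (η (i, 0)).natAbs.divisors := fun p => ⟨(p.1.2.1 0).natAbs, by
    rw [Nat.mem_divisors]
    exact ⟨Int.natAbs_dvd_natAbs.2 ⟨p.1.1.1 i, by rw [← hη p.1 p.2 i 0, mul_comm]⟩,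
      Int.natAbs_ne_zero.2 hne⟩⟩
  have hg : Function.Injective g := by
    intro p p' hpp
    have h1 : (p.1.2.1 0).natAbs = (p'.1.2.1 0).natAbs := congrArg Subtype.val hpp
    have h2 : p.1.2.1 0 = p'.1.2.1 0 := by
      have := hqpos p.1
      have := hqpos p'.1
      omega
    have hm : p.1.1.1 = p'.1.1.1 := by
      funext i'
      have h3 := (hη p.1 p.2 i' 0).trans (hη p'.1 p'.2 i' 0).symm
      rw [h2] at h3
      exact mul_right_cancel₀ (hqpos p'.1).ne' h3
    have hmi : p.1.1.1 i ≠ 0 := by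
      intro h0
      apply hne
      rw [← hη p.1 p.2 i 0, h0, zero_mul]
    have hq : p.1.2.1 = p'.1.2.1 := by
      funext j
      have h3 := (hη p.1 p.2 i j).trans (hη p'.1 p'.2 i j).symm
      rw [← hm] at h3
      exact mul_left_cancel₀ hmi h3
    exact Subtype.ext (Prod.ext (Subtype.ext hm) (Subtype.ext hq))
  have : Finite F := Finite.of_injective g hg
  have := Fintype.ofFinite F
  rw [tsum_fintype, Finset.sum_const, Finset.card_univ, nsmul_eq_mul, ← mul_assoc]
  gcongr
  have hcard : (Fintype.card F : ℝ) ≤ C * (1 + ‖latticeVec η‖) ^ δ := by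
    have h1 := Fintype.card_le_of_injective g hg
    rw [Fintype.card_coe] at h1
    refine le_trans (by exact_mod_cast h1) ((hC _ (Int.natAbs_ne_zero.2 hne)).trans ?_)
    gcongr
    have h2 := (norm_le_pi_norm η (i, 0)).trans (norm_le_norm_latticeVec η)
    rw [Int.norm_eq_abs] at h2
    rw [Nat.cast_natAbs, Int.cast_abs]
    linarith
  rw [← ENNReal.ofReal_natCast, ← ENNReal.ofReal_mul (by positivity)]
  refine ENNReal.ofReal_le_ofReal ?_
  rw [Real.rpow_neg (by positivity), ← div_eq_mul_inv, div_le_iff₀ (by positivity)]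
  exact hcard

end

/-! ### One refinement step -/

section

open MeasureTheory

/-- The matrices `x` for which `x q` is within `(2 M) ^ (-τ) / 2` of an integer vector, for some
`q` with entries in `(M, 2 M]`. -/
def dyadicApproxSet (τ : ℝ) (d n M : ℕ) : Set (EuclideanSpace ℝ (Fin n × Fin d)) :=
  {x | ∃ q ∈ dyadicBox d M, ∀ i, ∃ k : ℤ,
    |(∑ j, x (i, j) * (q j : ℝ)) - k| ≤ (2 * M : ℝ) ^ (-τ) / 2}

/-- Distance to the nearest integer is the norm on ℝ/ℤ, and only finitely many q occur. Closedness
lets the supports of the refined densities control the support of a weak limit. -/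
theorem isClosed_dyadicApproxSet (τ : ℝ) (d n M : ℕ) : IsClosed (dyadicApproxSet τ d n M) := by
  have h : dyadicApproxSet τ d n M = ⋃ q ∈ dyadicBox d M, ⋂ i,
      {x | ‖((∑ j, x (i, j) * (q j : ℝ) : ℝ) : UnitAddCircle)‖ ≤ (2 * M : ℝ) ^ (-τ) / 2} := by
    ext x
    simp only [dyadicApproxSet, Set.mem_ofPred_eq, Set.mem_iUnion, Set.mem_iInter, exists_prop,
      UnitAddCircle.norm_eq]
    refine exists_congr fun q => and_congr_right fun _ => forall_congr' fun i => ?_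
    exact ⟨fun ⟨k, hk⟩ => (round_le _ _).trans hk, fun h => ⟨_, h⟩⟩
  rw [h]
  refine Set.Finite.isClosed_biUnion (Finset.finite_toSet _) fun q _ =>
    isClosed_iInter fun i => isClosed_le ?_ continuous_const
  exact continuous_norm.comp ((AddCircle.continuous_mk' (1 : ℝ)).comp (by fun_prop))

theorem norm_phase_pos {a : ℝ} :
    ‖Complex.exp (2 * (Real.pi : ℂ) * Complex.I * (a : ℂ))‖ = 1 := by
  have h := norm_fourier_phase (a := -a)
  rwa [Complex.ofReal_neg, show -2 * (Real.pi : ℂ) * Complex.I * -(a : ℂ) =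
    2 * (Real.pi : ℂ) * Complex.I * (a : ℂ) by ring] at h

/-- Multiplying a density by an absolutely convergent Fourier series in `x q` shifts its Fourier
transform by multiples of `q`. -/
theorem IsRapidDensity.hasSum_densityFourier_mul {n d : ℕ}
    {G : EuclideanSpace ℝ (Fin n × Fin d) → ℝ} (hG : IsRapidDensity G) {c : (Fin n → ℤ) → ℂ}
    (hc : Summable fun m => ‖c m‖) {Φ : (Fin n → ℝ) → ℝ}
    (hΦ : ∀ y : Fin n → ℝ, HasSum (fun m : Fin n → ℤ => c m *
      Complex.exp (2 * (Real.pi : ℂ) * Complex.I * ((∑ i, (m i : ℝ) * y i : ℝ) : ℂ))) (Φ y))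
    (q : Fin d → ℤ) (ξ : EuclideanSpace ℝ (Fin n × Fin d)) :
    HasSum (fun m : Fin n → ℤ => c m * densityFourier G (ξ - latticeVec (outerProd m q)))
      (densityFourier (fun x => G x * Φ fun i => ∑ j, x (i, j) * (q j : ℝ)) ξ) := by
  set F : (Fin n → ℤ) → EuclideanSpace ℝ (Fin n × Fin d) → ℂ := fun m x => c m *
    (Complex.exp (-2 * (Real.pi : ℂ) * Complex.I *
      ((inner ℝ x (ξ - latticeVec (outerProd m q)) : ℝ) : ℂ)) * (G x : ℂ)) with hF
  have hFi : ∀ m, Integrable (F m) := fun m => (hG.integrable_phase_mul _).const_mul _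
  have hFn : ∀ m, ∫ x, ‖F m x‖ = ‖c m‖ * ∫ x, ‖G x‖ := fun m => by
    rw [← integral_const_mul]
    refine integral_congr_ae (.of_forall fun x => ?_)
    simp only [hF]
    rw [norm_mul, norm_mul, norm_fourier_phase, one_mul, Complex.norm_real]
  -- Termwise integration, justified by absolute summability of the coefficients. The shift appears
  -- because m · (x q) is the inner product of x with m ⊗ q.
  have h := hasSum_integral_of_summable_integral_norm hFi (by
    simp_rw [hFn]
    exact hc.mul_right _)
  have h1 : ∀ m, ∫ x, F m x = c m * densityFourier G (ξ - latticeVec (outerProd m q)) := fun m => by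
    simp only [hF]
    rw [integral_const_mul]
    rfl
  have h2 : ∫ x, ∑' m, F m x =
      densityFourier (fun x => G x * Φ fun i => ∑ j, x (i, j) * (q j : ℝ)) ξ := by
    refine integral_congr_ae (.of_forall fun x => ?_)
    simp only
    have h3 := ((hΦ fun i => ∑ j, x (i, j) * (q j : ℝ)).mul_left
      (Complex.exp (-2 * (Real.pi : ℂ) * Complex.I * ((inner ℝ x ξ : ℝ) : ℂ)) * (G x : ℂ))).tsum_eq
    rw [Complex.ofReal_mul, ← mul_assoc, ← h3]
    refine tsum_congr fun m => ?_
    simp only [hF]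
    rw [inner_sub_right, inner_latticeVec_outerProd, Complex.ofReal_sub, mul_sub, sub_eq_add_neg,
      Complex.exp_add]
    rw [show -(-2 * (Real.pi : ℂ) * Complex.I *
      ((∑ i, (m i : ℝ) * ∑ j, x (i, j) * (q j : ℝ) : ℝ) : ℂ)) = 2 * (Real.pi : ℂ) * Complex.I *
      ((∑ i, (m i : ℝ) * ∑ j, x (i, j) * (q j : ℝ) : ℝ) : ℂ) by ring]
    ring
  rw [h2] at h
  simpa only [h1] using h

/-- Keeps the class stable, so that refinement can be iterated. The new transform is a superposition
of translates of Ĝ. Moving the decay back to ξ costs (1 + ‖m ⊗ q‖)^k ≪ (1 + ‖m‖)^k for fixed q,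
which the coefficients absorb. -/
theorem IsRapidDensity.mul_periodic {n d : ℕ} [NeZero n] [NeZero d]
    {G : EuclideanSpace ℝ (Fin n × Fin d) → ℝ} (hG : IsRapidDensity G) {c : (Fin n → ℤ) → ℂ}
    (hc : ∀ k : ℕ, Summable fun m => ‖c m‖ * (1 + ‖m‖) ^ k) {Φ : (Fin n → ℝ) → ℝ}
    (hΦ0 : ∀ y, 0 ≤ Φ y)
    (hΦ : ∀ y : Fin n → ℝ, HasSum (fun m : Fin n → ℤ => c m *
      Complex.exp (2 * (Real.pi : ℂ) * Complex.I * ((∑ i, (m i : ℝ) * y i : ℝ) : ℂ))) (Φ y))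
    (q : Fin d → ℤ) :
    IsRapidDensity (fun x => G x * Φ fun i => ∑ j, x (i, j) * (q j : ℝ)) := by
  have hc0 : Summable fun m => ‖c m‖ := by simpa using hc 0
  have hΦc : Continuous Φ := by
    have h1 : Continuous fun y : Fin n → ℝ => (Φ y : ℂ) := by
      simp_rw [← (hΦ _).tsum_eq]
      refine continuous_tsum (fun m => by fun_prop) hc0 fun m y => ?_
      rw [norm_mul, norm_phase_pos, mul_one]
    exact Complex.continuous_re.comp h1
  refine ⟨hG.continuous.mul (hΦc.comp (by fun_prop)), hG.hasCompactSupport.mul_right,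
    fun x => mul_nonneg (hG.nonneg x) (hΦ0 _), fun k => ?_⟩
  obtain ⟨A, hA0, hA⟩ := hG.decay k
  set N : ℝ := (Fintype.card (Fin n × Fin d) : ℝ) with hN
  have hN0 : 0 ≤ N := by positivity
  set B : ℝ := 1 + N * ‖q‖ with hB
  have hB1 : 1 ≤ B := by
    have : 0 ≤ N * ‖q‖ := by positivity
    linarith
  refine ⟨∑' m, A * B ^ k * (‖c m‖ * (1 + ‖m‖) ^ k), tsum_nonneg fun m => by positivity,
    fun ξ => ?_⟩
  have h := hG.hasSum_densityFourier_mul hc0 hΦ q ξ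
  have hs := ((hc k).mul_left (A * B ^ k)).mul_right ((1 + ‖ξ‖) ^ (-(k : ℝ)))
  rw [← h.tsum_eq, ← tsum_mul_right]
  refine tsum_of_norm_bounded hs.hasSum fun m => ?_
  have hη : 1 + ‖latticeVec (outerProd m q)‖ ≤ B * (1 + ‖m‖) := by
    have h1 := norm_latticeVec_le (outerProd m q)
    rw [norm_outerProd] at h1
    have h2 : 0 ≤ N * ‖q‖ := by positivity
    nlinarith [norm_nonneg m]
  rw [norm_mul]
  calc ‖c m‖ * ‖densityFourier G (ξ - latticeVec (outerProd m q))‖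
      ≤ ‖c m‖ * (A * (1 + ‖ξ - latticeVec (outerProd m q)‖) ^ (-(k : ℝ))) := by
        gcongr
        exact hA _
    _ ≤ ‖c m‖ * (A * ((1 + ‖ξ‖) ^ (-(k : ℝ)) * (1 + ‖latticeVec (outerProd m q)‖) ^ (k : ℝ))) := by
        gcongr
        exact one_add_norm_rpow_neg_le _ _ (by positivity)
    _ ≤ ‖c m‖ * (A * ((1 + ‖ξ‖) ^ (-(k : ℝ)) * (B * (1 + ‖m‖)) ^ k)) := by
        rw [Real.rpow_natCast (1 + ‖latticeVec (outerProd m q)‖)]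
        gcongr
    _ = _ := by
        rw [mul_pow]
        ring

theorem densityFourier_const_mul {ι : Type*} [Fintype ι] (G : EuclideanSpace ℝ ι → ℝ) (a : ℝ)
    (ξ : EuclideanSpace ℝ ι) :
    densityFourier (fun x => a * G x) ξ = a * densityFourier G ξ := by
  rw [densityFourier, densityFourier, ← integral_const_mul]
  refine integral_congr_ae (.of_forall fun x => ?_)
  simp only
  push_cast
  ring

theorem densityFourier_finsetSum {ι α : Type*} [Fintype ι] {G : α → EuclideanSpace ℝ ι → ℝ}
    {F : Finset α} (hG : ∀ a ∈ F, IsRapidDensity (G a)) (ξ : EuclideanSpace ℝ ι) :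
    densityFourier (fun x => ∑ a ∈ F, G a x) ξ = ∑ a ∈ F, densityFourier (G a) ξ := by
  simp only [densityFourier]
  rw [← integral_finsetSum _ fun a ha => (hG a ha).integrable_phase_mul ξ]
  refine integral_congr_ae (.of_forall fun x => ?_)
  simp only
  rw [Complex.ofReal_sum, Finset.mul_sum]

theorem IsRapidDensity.finsetSum {ι α : Type*} [Fintype ι] {G : α → EuclideanSpace ℝ ι → ℝ}
    {F : Finset α} (hG : ∀ a ∈ F, IsRapidDensity (G a)) :
    IsRapidDensity (fun x => ∑ a ∈ F, G a x) := by
  classical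
  refine ⟨continuous_finsetSum _ fun a ha => (hG a ha).continuous, ?_,
    fun x => Finset.sum_nonneg fun a ha => (hG a ha).nonneg x, fun k => ?_⟩
  · induction F using Finset.induction_on with
    | empty =>
      simp only [Finset.sum_empty]
      exact HasCompactSupport.zero
    | insert a s ha ih =>
      simp only [Finset.sum_insert ha]
      exact (hG a (Finset.mem_insert_self _ _)).hasCompactSupport.add
        (ih fun b hb => hG b (Finset.mem_insert_of_mem hb))
  · choose! A hA0 hA using fun a ha => (hG a ha).decay k
    refine ⟨∑ a ∈ F, A a, Finset.sum_nonneg hA0, fun ξ => ?_⟩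
    rw [densityFourier_finsetSum hG, Finset.sum_mul]
    exact (norm_sum_le _ _).trans (Finset.sum_le_sum fun a ha => hA a ha ξ)

theorem IsRapidDensity.const_mul {ι : Type*} [Fintype ι] {G : EuclideanSpace ℝ ι → ℝ}
    (hG : IsRapidDensity G) {a : ℝ} (ha : 0 ≤ a) : IsRapidDensity (fun x => a * G x) := by
  refine ⟨continuous_const.mul hG.continuous, hG.hasCompactSupport.mul_left,
    fun x => mul_nonneg ha (hG.nonneg x), fun k => ?_⟩
  obtain ⟨A, hA0, hA⟩ := hG.decay k
  refine ⟨a * A, by positivity, fun ξ => ?_⟩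
  rw [densityFourier_const_mul, norm_mul, Complex.norm_real, Real.norm_of_nonneg ha, mul_assoc]
  exact mul_le_mul_of_nonneg_left (hA ξ) ha

/-- One step of the construction: a density is refined to live near rational points with
denominators of size `M`. -/
theorem IsRapidDensity.exists_refinement {n d : ℕ} [NeZero n] [NeZero d]
    {G : EuclideanSpace ℝ (Fin n × Fin d) → ℝ} (hG : IsRapidDensity G) (τ : ℝ) {M : ℕ}
    (hM : 1 ≤ M) :
    ∃ G' : EuclideanSpace ℝ (Fin n × Fin d) → ℝ, IsRapidDensity G' ∧
      (∀ x, G' x ≠ 0 → G x ≠ 0 ∧ x ∈ dyadicApproxSet τ d n M) ∧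
      ∀ ξ, ‖densityFourier G' ξ - densityFourier G ξ‖ₑ ≤ ∑' p : FrequencyPair n d M,
        ENNReal.ofReal ((M : ℝ) ^ d)⁻¹ * ‖boxCoeff ((2 * M : ℝ) ^ (-τ)) p.1.1‖ₑ *
          ‖densityFourier G (ξ - latticeVec p.freq)‖ₑ := by
  have hM0 : (0 : ℝ) < M := by exact_mod_cast hM
  set ε : ℝ := (2 * M : ℝ) ^ (-τ) with hε
  have hε0 : 0 < ε := by positivity
  obtain ⟨Φ, hΦ0, hΦs, hΦ⟩ := exists_periodic_box_bump n hε0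
  have hc := summable_norm_boxCoeff_mul_pow n hε0
  have hc0 : Summable fun m : Fin n → ℤ => ‖boxCoeff ε m‖ := by simpa using hc 0
  set P : (Fin d → ℤ) → EuclideanSpace ℝ (Fin n × Fin d) → ℝ := fun q x =>
    G x * Φ fun i => ∑ j, x (i, j) * (q j : ℝ) with hP
  have hPr : ∀ q, IsRapidDensity (P q) := fun q => hG.mul_periodic hc hΦ0 hΦ q
  refine ⟨fun x => ((M : ℝ) ^ d)⁻¹ * ∑ q ∈ dyadicBox d M, P q x,
    (IsRapidDensity.finsetSum fun q _ => hPr q).const_mul (by positivity), fun x hx => ?_,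
    fun ξ => ?_⟩
  · obtain ⟨q, hq, hqx⟩ := Finset.exists_ne_zero_of_sum_ne_zero (right_ne_zero_of_mul hx)
    obtain ⟨k, hk⟩ := hΦs _ (right_ne_zero_of_mul hqx)
    exact ⟨left_ne_zero_of_mul hqx, q, hq, fun i => ⟨k i, hk i⟩⟩
  · rw [densityFourier_const_mul, densityFourier_finsetSum fun q _ => hPr q]
    have hcard : (densityFourier G ξ) = (((M : ℝ) ^ d)⁻¹ : ℝ) *
        ∑ q ∈ dyadicBox d M, densityFourier G ξ := by
      rw [Finset.sum_const, card_dyadicBox, nsmul_eq_mul, ← mul_assoc]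
      push_cast
      have hMC : (M : ℂ) ≠ 0 := by exact_mod_cast hM0.ne'
      rw [inv_mul_cancel₀ (pow_ne_zero _ hMC), one_mul]
    have hq : ∀ q : Fin d → ℤ, ‖densityFourier (P q) ξ - densityFourier G ξ‖ₑ ≤
        ∑' m : {m : Fin n → ℤ // m ≠ 0}, ‖boxCoeff ε m.1‖ₑ *
          ‖densityFourier G (ξ - latticeVec (outerProd m.1 q))‖ₑ := by
      intro q
      have h := hG.hasSum_densityFourier_mul hc0 hΦ q ξ
      -- The coefficient at m = 0 is 1 and reproduces Ĝ(ξ), so only m ≠ 0 remains in the difference.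
      have h1 := h.summable.tsum_eq_add_tsum_ite 0
      rw [h.tsum_eq, boxCoeff_zero, outerProd_zero, latticeVec_zero, sub_zero, one_mul] at h1
      have h2 : densityFourier (P q) ξ - densityFourier G ξ = ∑' m : Fin n → ℤ,
          if m = 0 then 0 else
            boxCoeff ε m * densityFourier G (ξ - latticeVec (outerProd m q)) := by
        rw [sub_eq_iff_eq_add']
        exact h1
      rw [h2]
      refine enorm_tsum_le_tsum_enorm.trans (le_of_eq ?_)
      refine Eq.trans ?_ (tsum_subtype {m : Fin n → ℤ | m ≠ 0} fun m => ‖boxCoeff ε m‖ₑ *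
          ‖densityFourier G (ξ - latticeVec (outerProd m q))‖ₑ).symm
      refine tsum_congr fun m => ?_
      by_cases hm : m = 0
      · simp [hm]
      · rw [Set.indicator_of_mem (show m ∈ {m : Fin n → ℤ | m ≠ 0} from hm), if_neg hm, enorm_mul]
    conv_lhs => rw [hcard]
    rw [← mul_sub, ← Finset.sum_sub_distrib, enorm_mul]
    have hcoe : ‖((((M : ℝ) ^ d)⁻¹ : ℝ) : ℂ)‖ₑ = ENNReal.ofReal ((M : ℝ) ^ d)⁻¹ := by
      rw [← ofReal_norm, Complex.norm_real, Real.norm_of_nonneg (by positivity)]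
    rw [hcoe]
    simp_rw [mul_assoc]
    rw [ENNReal.tsum_mul_left]
    gcongr
    refine (enorm_sum_le _ _).trans ((Finset.sum_le_sum fun q _ => hq q).trans (le_of_eq ?_))
    rw [ENNReal.tsum_prod', ENNReal.tsum_comm, ← Finset.tsum_subtype]
    rfl

end

/-! ### Smallness of the refinement error -/

section

open MeasureTheory

theorem eventually_mul_natCast_rpow_le {e η : ℝ} (he : e < 0) (hη : 0 < η) (K : ℝ) :
    ∀ᶠ M : ℕ in Filter.atTop, K * (M : ℝ) ^ e ≤ η := by
  have h := (tendsto_rpow_neg_atTop (neg_pos.2 he)).comp (tendsto_natCast_atTop_atTop (R := ℝ))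
  have h2 := h.const_mul K
  rw [mul_zero] at h2
  filter_upwards [h2.eventually (eventually_le_nhds hη)] with M hM
  simpa using hM

theorem one_add_norm_freq_le {n d M : ℕ} [NeZero n] [NeZero d] (hM : 1 ≤ M)
    (p : FrequencyPair n d M) :
    1 + ‖latticeVec p.freq‖ ≤
      (1 + (Fintype.card (Fin n × Fin d) : ℝ)) * (2 * M * ‖p.1.1‖) := by
  have hM1 : (1 : ℝ) ≤ M := by exact_mod_cast hM
  have hm : 1 ≤ ‖p.1.1‖ := one_le_norm_of_ne_zero p.1.2
  have h1 := norm_latticeVec_le p.freq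
  have h2 : ‖p.freq‖ ≤ 2 * M * ‖p.1.1‖ := by
    rw [FrequencyPair.freq, norm_outerProd, mul_comm]
    gcongr
    exact (norm_bounds_of_mem_dyadicBox p.2.2).2
  have h3 : (Fintype.card (Fin n × Fin d) : ℝ) * ‖p.freq‖ ≤
      Fintype.card (Fin n × Fin d) * (2 * M * ‖p.1.1‖) := by gcongr
  nlinarith

theorem le_one_add_norm_freq {n d M : ℕ} [NeZero n] [NeZero d] (p : FrequencyPair n d M) :
    M * ‖p.1.1‖ ≤ 1 + ‖latticeVec p.freq‖ := by
  have h1 := norm_le_norm_latticeVec p.freq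
  have h2 : M * ‖p.1.1‖ ≤ ‖p.freq‖ := by
    rw [FrequencyPair.freq, norm_outerProd, mul_comm]
    gcongr
    exact (norm_bounds_of_mem_dyadicBox p.2.2).1
  linarith

/-- The coefficient is O((M^(-τ) ‖m‖)^(-κ)) and the frequency has size about M ‖m‖, so ‖m‖ cancels
and M^((1+τ)κ) is left. The averaging factor M^(-d) beats this when κ < d / (1 + τ): the origin of
the critical exponent. -/
theorem exists_norm_boxCoeff_mul_rpow_le (n d : ℕ) [NeZero n] [NeZero d] (τ : ℝ) {κ : ℝ}
    (hκ : 0 ≤ κ) :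
    ∃ K : ℝ, 0 ≤ K ∧ ∀ M : ℕ, 1 ≤ M → ∀ p : FrequencyPair n d M,
      ‖boxCoeff ((2 * M : ℝ) ^ (-τ)) p.1.1‖ * (1 + ‖latticeVec p.freq‖) ^ κ ≤
        K * (M : ℝ) ^ ((1 + τ) * κ) := by
  obtain ⟨C, hC0, hC⟩ := exists_norm_boxCoeff_le_rpow n hκ
  set N : ℝ := (Fintype.card (Fin n × Fin d) : ℝ) with hN
  refine ⟨C * (1 + N) ^ κ * 2 ^ ((1 + τ) * κ), by positivity, fun M hM p => ?_⟩
  have hM0 : (0 : ℝ) < M := by exact_mod_cast hM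
  have hm : 0 < ‖p.1.1‖ := lt_of_lt_of_le one_pos (one_le_norm_of_ne_zero p.1.2)
  calc _ ≤ C * ((2 * M : ℝ) ^ (-τ) * ‖p.1.1‖) ^ (-κ) * ((1 + N) * (2 * M * ‖p.1.1‖)) ^ κ := by
        gcongr
        · exact hC _ (by positivity) _ p.1.2
        · exact one_add_norm_freq_le hM p
    _ = _ := by
        have e1 : ((2 * M : ℝ) ^ (-τ) * ‖p.1.1‖) ^ (-κ) =
            2 ^ (τ * κ) * (M : ℝ) ^ (τ * κ) * ‖p.1.1‖ ^ (-κ) := by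
          rw [Real.mul_rpow (by positivity) hm.le, ← Real.rpow_mul (by positivity), neg_mul_neg,
            Real.mul_rpow (by norm_num) hM0.le]
        have e2 : ((1 + N) * (2 * M * ‖p.1.1‖)) ^ κ =
            (1 + N) ^ κ * (2 ^ κ * (M : ℝ) ^ κ * ‖p.1.1‖ ^ κ) := by
          rw [Real.mul_rpow (by positivity) (by positivity),
            Real.mul_rpow (by positivity) hm.le, Real.mul_rpow (by norm_num) hM0.le]
        have e3 : ‖p.1.1‖ ^ (-κ) * ‖p.1.1‖ ^ κ = 1 := by
          rw [← Real.rpow_add hm, neg_add_cancel, Real.rpow_zero]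
        rw [e1, e2, show (1 + τ) * κ = τ * κ + κ by ring, Real.rpow_add (by norm_num),
          Real.rpow_add hM0]
        calc _ = C * (1 + N) ^ κ * (2 ^ (τ * κ) * 2 ^ κ) * ((M : ℝ) ^ (τ * κ) * (M : ℝ) ^ κ) *
              (‖p.1.1‖ ^ (-κ) * ‖p.1.1‖ ^ κ) := by ring
          _ = _ := by rw [e3, mul_one]

/-- With κ between a and d / (1 + τ), the weight at frequency η splits: exponent a moves (1 + ‖ξ‖)^a
onto ξ - η by Peetre, and the spare factor (1 + ‖η‖)^(-(κ - a)) pays for the number of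
factorizations of η. A uniformly bounded lattice sum of Ĝ times M^((1+τ)κ - d) remains. -/
theorem IsRapidDensity.eventually_refinement_sup_le {n d : ℕ} [NeZero n] [NeZero d]
    {G : EuclideanSpace ℝ (Fin n × Fin d) → ℝ} (hG : IsRapidDensity G) {τ a η : ℝ} (hτ : 0 < τ)
    (ha : 0 ≤ a) (had : a * (1 + τ) < d) (hη : 0 < η) :
    ∀ᶠ M : ℕ in Filter.atTop, ∀ ξ, (∑' p : FrequencyPair n d M,
        ENNReal.ofReal ((M : ℝ) ^ d)⁻¹ * ‖boxCoeff ((2 * M : ℝ) ^ (-τ)) p.1.1‖ₑ *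
          ‖densityFourier G (ξ - latticeVec p.freq)‖ₑ) * ENNReal.ofReal ((1 + ‖ξ‖) ^ a) ≤
      ENNReal.ofReal η := by
  have had' : a < d / (1 + τ) := by rwa [lt_div_iff₀ (by linarith)]
  obtain ⟨κ, hκ1, hκ2⟩ := exists_between had'
  rw [lt_div_iff₀ (by linarith)] at hκ2
  have hδ : 0 < κ - a := by linarith
  have hκ0 : 0 ≤ κ := by linarith
  obtain ⟨K, hK0, hK⟩ := exists_norm_boxCoeff_mul_rpow_le n d τ hκ0
  obtain ⟨C, hC0, hC⟩ := exists_tsum_frequencyPair_le n d hδ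
  obtain ⟨A, hA0, hA⟩ := hG.exists_lattice_sum_le a
  filter_upwards [eventually_mul_natCast_rpow_le (e := (1 + τ) * κ - d) (by linarith) hη
    (K * C * A), Filter.eventually_ge_atTop 1] with M hMη hM ξ
  have hM0 : (0 : ℝ) < M := by exact_mod_cast hM
  rw [← ENNReal.tsum_mul_right]
  set R : ℝ := ((M : ℝ) ^ d)⁻¹ * (K * (M : ℝ) ^ ((1 + τ) * κ)) with hR
  have hR0 : 0 ≤ R := by positivity
  have hterm : ∀ p : FrequencyPair n d M,
      ENNReal.ofReal ((M : ℝ) ^ d)⁻¹ * ‖boxCoeff ((2 * M : ℝ) ^ (-τ)) p.1.1‖ₑ *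
          ‖densityFourier G (ξ - latticeVec p.freq)‖ₑ * ENNReal.ofReal ((1 + ‖ξ‖) ^ a) ≤
      ENNReal.ofReal R * (ENNReal.ofReal ((1 + ‖latticeVec p.freq‖) ^ (-(κ - a))) *
        (ENNReal.ofReal ((1 + ‖ξ - latticeVec p.freq‖) ^ a) *
          ‖densityFourier G (ξ - latticeVec p.freq)‖ₑ)) := by
    intro p
    rw [← ofReal_norm, ← ofReal_norm, ← ENNReal.ofReal_mul (by positivity),
      ← ENNReal.ofReal_mul (by positivity), ← ENNReal.ofReal_mul (by positivity),
      ← ENNReal.ofReal_mul (by positivity), ← ENNReal.ofReal_mul (by positivity),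
      ← ENNReal.ofReal_mul (by positivity)]
    refine ENNReal.ofReal_le_ofReal ?_
    set c := ‖boxCoeff ((2 * M : ℝ) ^ (-τ)) p.1.1‖ with hc
    set g := ‖densityFourier G (ξ - latticeVec p.freq)‖ with hg
    set W := 1 + ‖latticeVec p.freq‖ with hW
    have hW0 : 0 < W := by positivity
    have h1 : (1 + ‖ξ‖) ^ a ≤ W ^ a * (1 + ‖ξ - latticeVec p.freq‖) ^ a := by
      rw [← Real.mul_rpow (by positivity) (by positivity)]
      exact Real.rpow_le_rpow (by positivity) (one_add_norm_le_mul_sub _ _) ha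
    have h2 : W ^ a = W ^ κ * W ^ (-(κ - a)) := by
      rw [← Real.rpow_add hW0]
      congr 1
      ring
    calc ((M : ℝ) ^ d)⁻¹ * c * g * (1 + ‖ξ‖) ^ a
        ≤ ((M : ℝ) ^ d)⁻¹ * c * g * (W ^ a * (1 + ‖ξ - latticeVec p.freq‖) ^ a) := by gcongr
      _ = ((M : ℝ) ^ d)⁻¹ * (c * W ^ κ) *
          (W ^ (-(κ - a)) * ((1 + ‖ξ - latticeVec p.freq‖) ^ a * g)) := by
          rw [h2]
          ring
      _ ≤ ((M : ℝ) ^ d)⁻¹ * (K * (M : ℝ) ^ ((1 + τ) * κ)) *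
          (W ^ (-(κ - a)) * ((1 + ‖ξ - latticeVec p.freq‖) ^ a * g)) := by
          gcongr ((M : ℝ) ^ d)⁻¹ * ?_ * _
          exact hK M hM p
  refine (ENNReal.tsum_le_tsum hterm).trans ?_
  rw [ENNReal.tsum_mul_left]
  calc _ ≤ ENNReal.ofReal R * (ENNReal.ofReal C * ENNReal.ofReal A) := by
        refine mul_le_mul_right ((hC M fun η => ENNReal.ofReal ((1 + ‖ξ - latticeVec η‖) ^ a) *
          ‖densityFourier G (ξ - latticeVec η)‖ₑ).trans ?_) _
        gcongr
        exact hA ξ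
    _ = ENNReal.ofReal (K * C * A * (M : ℝ) ^ ((1 + τ) * κ - d)) := by
        rw [← ENNReal.ofReal_mul hC0, ← ENNReal.ofReal_mul hR0, hR, Real.rpow_sub hM0,
          Real.rpow_natCast]
        congr 1
        ring
    _ ≤ ENNReal.ofReal η := ENNReal.ofReal_le_ofReal hMη

theorem exists_tsum_norm_rpow_le (n : ℕ) {p : ℝ} (hp : (n : ℝ) < p) :
    ∃ S : ℝ, 0 ≤ S ∧ ∑' m : {m : Fin n → ℤ // m ≠ 0}, ENNReal.ofReal (‖m.1‖ ^ (-p)) ≤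
      ENNReal.ofReal S := by
  have hs := (summable_one_add_norm_int_rpow (ι := Fin n) (p := p) (by simpa using hp)).mul_left
    (2 ^ p)
  have hp0 : 0 ≤ p := le_trans (by positivity) hp.le
  refine ⟨∑' m : Fin n → ℤ, 2 ^ p * (1 + ‖m‖) ^ (-p), tsum_nonneg fun _ => by positivity, ?_⟩
  rw [ENNReal.ofReal_tsum_of_nonneg (fun _ => by positivity) hs]
  refine le_trans (ENNReal.tsum_le_tsum fun m => ?_)
    (ENNReal.tsum_comp_le_tsum_of_injective Subtype.val_injective _)
  refine ENNReal.ofReal_le_ofReal ?_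
  have hm1 := one_le_norm_of_ne_zero m.2
  rw [Real.rpow_neg (by positivity), Real.rpow_neg (by positivity), ← div_eq_mul_inv,
    inv_eq_one_div, div_le_div_iff₀ (by positivity) (by positivity), one_mul,
    ← Real.mul_rpow (by positivity) (by positivity)]
  gcongr
  linarith

/-- The translate of Ĝ concentrates near v, so the weight may be evaluated there. Peetre's
inequality charges the error to a higher moment of Ĝ, finite for rapid densities. -/
theorem IsRapidDensity.lintegral_translate_le {ι : Type*} [Fintype ι]
    (G : EuclideanSpace ℝ ι → ℝ) {β : ℝ} (hβ : 0 ≤ β) (v : EuclideanSpace ℝ ι) :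
    ∫⁻ ξ, ‖densityFourier G (ξ - v)‖ₑ * ENNReal.ofReal ((1 + ‖ξ‖) ^ (-β)) ≤
      ENNReal.ofReal ((1 + ‖v‖) ^ (-β)) *
        ∫⁻ ξ, ENNReal.ofReal ((1 + ‖ξ‖) ^ β) * ‖densityFourier G ξ‖ₑ := by
  rw [← lintegral_const_mul' _ _ ENNReal.ofReal_ne_top,
    ← lintegral_sub_right_eq_self (fun ξ => ENNReal.ofReal ((1 + ‖v‖) ^ (-β)) *
      (ENNReal.ofReal ((1 + ‖ξ‖) ^ β) * ‖densityFourier G ξ‖ₑ)) v]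
  refine lintegral_mono fun ξ => ?_
  rw [← mul_assoc, mul_comm, ← ENNReal.ofReal_mul (by positivity)]
  gcongr
  have h := one_add_norm_rpow_neg_le v (v - ξ) hβ
  rwa [sub_sub_cancel, norm_sub_rev v ξ] at h

theorem exists_boxCoeff_energy_le (n d : ℕ) [NeZero n] [NeZero d] (τ : ℝ) {β δ : ℝ}
    (hβ : 0 ≤ β) (hδ : 0 < δ) (hβn : β ≤ n) :
    ∃ K : ℝ, 0 ≤ K ∧ ∀ M : ℕ, 1 ≤ M → ∑' p : FrequencyPair n d M,
      ENNReal.ofReal (‖boxCoeff ((2 * M : ℝ) ^ (-τ)) p.1.1‖ ^ 2 *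
        (1 + ‖latticeVec p.freq‖) ^ δ * (1 + ‖latticeVec p.freq‖) ^ (-β)) ≤
      ENNReal.ofReal (K * (M : ℝ) ^ (d + δ - β + τ * (n + 2 * δ - β))) := by
  -- Chosen so that the total power of ‖m‖, -2κ + δ - β, equals -(n + δ) and is just summable over
  -- ℤ^n. Nonnegativity of κ uses β ≤ n.
  set κ : ℝ := (n + 2 * δ - β) / 2 with hκ
  have hκ0 : 0 ≤ κ := by
    rw [hκ]
    linarith
  obtain ⟨C, hC0, hC⟩ := exists_norm_boxCoeff_le_rpow n hκ0
  obtain ⟨S, hS0, hS⟩ := exists_tsum_norm_rpow_le n (p := n + δ) (by linarith)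
  set N : ℝ := (Fintype.card (Fin n × Fin d) : ℝ) with hN
  set K : ℝ := C ^ 2 * (2 : ℝ) ^ (τ * (2 * κ)) * ((1 + N) * 2) ^ δ with hK
  refine ⟨K * S, by positivity, fun M hM => ?_⟩
  have hM0 : (0 : ℝ) < M := by exact_mod_cast hM
  set R : ℝ := K * (M : ℝ) ^ (τ * (2 * κ) + δ - β) with hR
  have hR0 : 0 ≤ R := by positivity
  have hterm : ∀ p : FrequencyPair n d M,
      ENNReal.ofReal (‖boxCoeff ((2 * M : ℝ) ^ (-τ)) p.1.1‖ ^ 2 *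
        (1 + ‖latticeVec p.freq‖) ^ δ * (1 + ‖latticeVec p.freq‖) ^ (-β)) ≤
      ENNReal.ofReal R * ENNReal.ofReal (‖p.1.1‖ ^ (-(n + δ))) := by
    intro p
    rw [← ENNReal.ofReal_mul hR0]
    refine ENNReal.ofReal_le_ofReal ?_
    have hm : 0 < ‖p.1.1‖ := lt_of_lt_of_le one_pos (one_le_norm_of_ne_zero p.1.2)
    set m := ‖p.1.1‖ with hmdef
    calc _ ≤ (C * ((2 * M : ℝ) ^ (-τ) * m) ^ (-κ)) ^ 2 * ((1 + N) * (2 * M * m)) ^ δ *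
          (M * m) ^ (-β) := by
          gcongr ?_ ^ 2 * ?_ ^ δ * ?_
          · exact hC _ (by positivity) _ p.1.2
          · exact one_add_norm_freq_le hM p
          · exact Real.rpow_le_rpow_of_nonpos (by positivity) (le_one_add_norm_freq p)
              (by linarith)
      _ = _ := by
          have e1 : (((2 * M : ℝ) ^ (-τ) * m) ^ (-κ)) ^ 2 =
              2 ^ (τ * (2 * κ)) * (M : ℝ) ^ (τ * (2 * κ)) * m ^ (-(2 * κ)) := by
            rw [← Real.rpow_natCast, ← Real.rpow_mul (by positivity),
              Real.mul_rpow (by positivity) (by positivity), ← Real.rpow_mul (by positivity),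
              ← Real.mul_rpow (by norm_num) hM0.le]
            congr 2 <;> (push_cast; ring)
          have e2 : ((1 + N) * (2 * M * m)) ^ δ = ((1 + N) * 2) ^ δ * (M : ℝ) ^ δ * m ^ δ := by
            rw [← Real.mul_rpow (by positivity) (by positivity),
              ← Real.mul_rpow (by positivity) (by positivity)]
            congr 1
            ring
          have e3 : (M : ℝ) ^ (τ * (2 * κ) + δ - β) =
              (M : ℝ) ^ (τ * (2 * κ)) * (M : ℝ) ^ δ * (M : ℝ) ^ (-β) := by
            rw [← Real.rpow_add hM0, ← Real.rpow_add hM0]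
            rfl
          have e4 : m ^ (-(n + δ)) = m ^ (-(2 * κ)) * m ^ δ * m ^ (-β) := by
            rw [← Real.rpow_add hm, ← Real.rpow_add hm]
            congr 1
            rw [hκ]
            ring
          rw [mul_pow, e1, e2, Real.mul_rpow hM0.le hm.le, hR, hK, e3, e4]
          ring
  refine (ENNReal.tsum_le_tsum hterm).trans ?_
  rw [ENNReal.tsum_mul_left, ENNReal.tsum_prod', ENNReal.tsum_comm]
  simp only [tsum_fintype, Finset.sum_const, Finset.card_univ, Fintype.card_coe, card_dyadicBox]
  calc _ ≤ ENNReal.ofReal R * (M ^ d • ENNReal.ofReal S) := by gcongr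
    _ = ENNReal.ofReal (R * ((M : ℝ) ^ d * S)) := by
        rw [nsmul_eq_mul, ENNReal.ofReal_mul hR0, ENNReal.ofReal_mul (p := (M:ℝ)^d) (by positivity),
          ← Nat.cast_pow M d, ENNReal.ofReal_natCast]
    _ = _ := by
        congr 1
        rw [hR, show (d + δ - β + τ * (n + 2 * δ - β) : ℝ) =
          (τ * (2 * κ) + δ - β) + d by rw [hκ]; ring, Real.rpow_add hM0, Real.rpow_natCast]
        ring

/-- Cauchy–Schwarz with weights (1 + ‖η‖)^δ and (1 + ‖η‖)^(-δ): the divisor bound and a lattice sum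
control the second factor, so effectively the translates do not overlap. Integrating the first
factor termwise gives M^(-2d) times the coefficient energy. -/
theorem IsRapidDensity.eventually_refinement_energy_le {n d : ℕ} [NeZero n] [NeZero d]
    {G : EuclideanSpace ℝ (Fin n × Fin d) → ℝ} (hG : IsRapidDensity G) {τ β η : ℝ} (hτ : 0 < τ)
    (hβ : 0 ≤ β) (hβn : β ≤ n) (hβτ : τ * n - d < β * (1 + τ)) (hη : 0 < η) :
    ∀ᶠ M : ℕ in Filter.atTop, ∫⁻ ξ, (∑' p : FrequencyPair n d M,
        ENNReal.ofReal ((M : ℝ) ^ d)⁻¹ * ‖boxCoeff ((2 * M : ℝ) ^ (-τ)) p.1.1‖ₑ *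
          ‖densityFourier G (ξ - latticeVec p.freq)‖ₑ) ^ 2 * ENNReal.ofReal ((1 + ‖ξ‖) ^ (-β)) ≤
      ENNReal.ofReal η := by
  obtain ⟨δ, hδ0, hδ⟩ : ∃ δ : ℝ, 0 < δ ∧ -d + δ - β + τ * (n + 2 * δ - β) < 0 := by
    -- The exponent equals δ (1 + 2τ) minus the gap β (1 + τ) - (τ n - d). This δ uses up half of
    -- the gap.
    refine ⟨(β * (1 + τ) - (τ * n - d)) / (2 * (1 + 2 * τ)), by
      have : 0 < β * (1 + τ) - (τ * n - d) := by linarith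
      positivity, ?_⟩
    have h : (β * (1 + τ) - (τ * n - d)) / (2 * (1 + 2 * τ)) * (1 + 2 * τ) =
      (β * (1 + τ) - (τ * n - d)) / 2 := by field_simp
    nlinarith
  obtain ⟨K, hK0, hK⟩ := exists_boxCoeff_energy_le n d τ hβ hδ0 hβn
  obtain ⟨C, hC0, hC⟩ := exists_tsum_frequencyPair_le n d hδ0
  obtain ⟨A, hA0, hA⟩ := hG.exists_lattice_sum_le 0
  set B := ∫⁻ ξ, ENNReal.ofReal ((1 + ‖ξ‖) ^ β) * ‖densityFourier G ξ‖ₑ with hB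
  have hBt : B = ENNReal.ofReal B.toReal :=
    (ENNReal.ofReal_toReal (hG.lintegral_rpow_mul_ne_top β)).symm
  filter_upwards [eventually_mul_natCast_rpow_le hδ hη (K * B.toReal * (C * A)),
    Filter.eventually_ge_atTop 1] with M hMη hM
  have hM0 : (0 : ℝ) < M := by exact_mod_cast hM
  set r : ENNReal := ENNReal.ofReal ((M : ℝ) ^ d)⁻¹ with hr
  set c : FrequencyPair n d M → ENNReal := fun p =>
    ‖boxCoeff ((2 * M : ℝ) ^ (-τ)) p.1.1‖ₑ with hc
  set g : EuclideanSpace ℝ (Fin n × Fin d) → FrequencyPair n d M → ENNReal := fun ξ p =>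
    ‖densityFourier G (ξ - latticeVec p.freq)‖ₑ with hg
  set W : FrequencyPair n d M → ℝ := fun p => 1 + ‖latticeVec p.freq‖ with hW
  have hW0 : ∀ p, 0 < W p := fun p => by positivity
  have hcs : ∀ ξ, (∑' p, r * c p * g ξ p) ^ 2 ≤
      (∑' p, r ^ 2 * c p ^ 2 * ENNReal.ofReal (W p ^ δ) * g ξ p) *
        ENNReal.ofReal (C * A) := by
    intro ξ
    refine (ENNReal_sq_tsum_le_mul (U := fun p => r ^ 2 * c p ^ 2 * ENNReal.ofReal (W p ^ δ) *
      g ξ p) (V := fun p => ENNReal.ofReal (W p ^ (-δ)) * g ξ p) fun p => ?_).trans ?_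
    · have h1 : ENNReal.ofReal (W p ^ δ) * ENNReal.ofReal (W p ^ (-δ)) = 1 := by
        rw [← ENNReal.ofReal_mul (by positivity), ← Real.rpow_add (hW0 p), add_neg_cancel,
          Real.rpow_zero, ENNReal.ofReal_one]
      calc (r * c p * g ξ p) ^ 2 = (ENNReal.ofReal (W p ^ δ) * ENNReal.ofReal (W p ^ (-δ))) *
            (r * c p * g ξ p) ^ 2 := by rw [h1, one_mul]
        _ ≤ _ := le_of_eq (by ring)
    · refine mul_le_mul_right ?_ _
      refine (hC M fun η => ‖densityFourier G (ξ - latticeVec η)‖ₑ).trans ?_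
      rw [ENNReal.ofReal_mul hC0]
      gcongr
      simpa using hA ξ
  have hgm : ∀ p, Measurable fun ξ => g ξ p := fun p =>
    (hG.continuous_densityFourier.comp (continuous_sub_right _)).enorm.measurable
  have hwm : Measurable fun ξ : EuclideanSpace ℝ (Fin n × Fin d) =>
      ENNReal.ofReal ((1 + ‖ξ‖) ^ (-β)) := by fun_prop
  have hgwm : ∀ p, AEMeasurable fun ξ => g ξ p * ENNReal.ofReal ((1 + ‖ξ‖) ^ (-β)) := fun p =>
    ((hgm p).mul hwm).aemeasurable
  calc _ ≤ ∫⁻ ξ, (∑' p, r ^ 2 * c p ^ 2 * ENNReal.ofReal (W p ^ δ) * g ξ p) *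
          ENNReal.ofReal (C * A) * ENNReal.ofReal ((1 + ‖ξ‖) ^ (-β)) :=
        lintegral_mono fun ξ => mul_le_mul_left (hcs ξ) _
    _ = ENNReal.ofReal (C * A) * ∑' p, r ^ 2 * c p ^ 2 * ENNReal.ofReal (W p ^ δ) *
          ∫⁻ ξ, g ξ p * ENNReal.ofReal ((1 + ‖ξ‖) ^ (-β)) := by
        have h1 : ∀ p, r ^ 2 * c p ^ 2 * ENNReal.ofReal (W p ^ δ) *
            ∫⁻ ξ, g ξ p * ENNReal.ofReal ((1 + ‖ξ‖) ^ (-β)) =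
            ∫⁻ ξ, r ^ 2 * c p ^ 2 * ENNReal.ofReal (W p ^ δ) *
              (g ξ p * ENNReal.ofReal ((1 + ‖ξ‖) ^ (-β))) := fun p =>
          (lintegral_const_mul'' _ (hgwm p)).symm
        simp_rw [h1]
        rw [← lintegral_tsum fun p => (hgwm p).const_mul _,
          ← lintegral_const_mul' _ _ ENNReal.ofReal_ne_top]
        refine lintegral_congr fun ξ => ?_
        rw [mul_comm _ (ENNReal.ofReal (C * A)), mul_assoc, ← ENNReal.tsum_mul_right]
        congr 1
        refine tsum_congr fun p => ?_
        rw [mul_assoc _ (g ξ p)]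
    _ ≤ ENNReal.ofReal (C * A) * ∑' p : FrequencyPair n d M, (r ^ 2 * B) *
          ENNReal.ofReal (‖boxCoeff ((2 * M : ℝ) ^ (-τ)) p.1.1‖ ^ 2 *
        (1 + ‖latticeVec p.freq‖) ^ δ * (1 + ‖latticeVec p.freq‖) ^ (-β)) := by
        refine mul_le_mul_right (ENNReal.tsum_le_tsum fun p => ?_) _
        refine (mul_le_mul_right (IsRapidDensity.lintegral_translate_le G hβ _) _).trans
          (le_of_eq ?_)
        rw [ENNReal.ofReal_mul (by positivity), ENNReal.ofReal_mul (by positivity),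
          ENNReal.ofReal_pow (norm_nonneg _), ofReal_norm]
        ring
    _ ≤ ENNReal.ofReal (C * A) * ((r ^ 2 * B) *
          ENNReal.ofReal (K * (M : ℝ) ^ (d + δ - β + τ * (n + 2 * δ - β)))) := by
        rw [ENNReal.tsum_mul_left]
        gcongr
        exact hK M hM
    _ = ENNReal.ofReal (K * B.toReal * (C * A) *
          (M : ℝ) ^ (-d + δ - β + τ * (n + 2 * δ - β))) := by
        have hB0 : 0 ≤ B.toReal := ENNReal.toReal_nonneg
        conv_lhs => rw [hBt]
        rw [hr, ← ENNReal.ofReal_pow (by positivity), ← ENNReal.ofReal_mul (by positivity),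
          ← ENNReal.ofReal_mul (by positivity), ← ENNReal.ofReal_mul (by positivity)]
        congr 1
        rw [show (d + δ - β + τ * (n + 2 * δ - β) : ℝ) =
          (-d + δ - β + τ * (n + 2 * δ - β)) + (2 * d : ℕ) by push_cast; ring,
          Real.rpow_add hM0 _ ((2 * d : ℕ) : ℝ), Real.rpow_natCast, pow_mul']
        field_simp
    _ ≤ ENNReal.ofReal η := ENNReal.ofReal_le_ofReal hMη

end

/-! ### Initial density and weak limits -/

section

open MeasureTheory Filter Topology
open scoped FourierTransform SchwartzMap ContDiff

theorem densityFourier_eq_fourier {ι : Type*} [Fintype ι] (G : EuclideanSpace ℝ ι → ℝ)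
    (ξ : EuclideanSpace ℝ ι) : densityFourier G ξ = 𝓕 (fun x => (G x : ℂ)) ξ := by
  rw [Real.fourier_eq']
  refine integral_congr_ae (.of_forall fun x => ?_)
  simp only [smul_eq_mul]
  congr 2
  push_cast
  ring

/-- A smooth compactly supported probability density is a rapid density. -/
theorem exists_isRapidDensity (ι : Type*) [Fintype ι] :
    ∃ G : EuclideanSpace ℝ ι → ℝ, IsRapidDensity G ∧ densityFourier G 0 = 1 := by
  set b : ContDiffBump (0 : EuclideanSpace ℝ ι) := default
  set G : EuclideanSpace ℝ ι → ℝ := b.normed volume with hG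
  have hcs : HasCompactSupport fun x => (G x : ℂ) :=
    b.hasCompactSupport_normed.comp_left Complex.ofReal_zero
  have hcd : ContDiff ℝ ∞ fun x => (G x : ℂ) :=
    Complex.ofRealCLM.contDiff.comp b.contDiff_normed
  set S : 𝓢(EuclideanSpace ℝ ι, ℂ) := hcs.toSchwartzMap hcd
  have hF : ∀ ξ, (𝓕 S) ξ = densityFourier G ξ := fun ξ => by
    rw [densityFourier_eq_fourier, SchwartzMap.fourier_coe]
    rfl
  refine ⟨G, ⟨b.continuous_normed, b.hasCompactSupport_normed, b.nonneg_normed, fun k => ?_⟩, ?_⟩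
  · obtain ⟨A, hA⟩ : ∃ A : ℝ, ∀ ξ, (1 + ‖ξ‖) ^ k * ‖(𝓕 S) ξ‖ ≤ A := by
      refine ⟨2 ^ k * ((Finset.Iic (k, 0)).sup fun m => SchwartzMap.seminorm ℝ m.1 m.2) (𝓕 S),
        fun ξ => ?_⟩
      have := SchwartzMap.one_add_le_sup_seminorm_apply (𝕜 := ℝ) (m := (k, 0)) le_rfl le_rfl
        (𝓕 S) ξ
      rwa [norm_iteratedFDeriv_zero] at this
    refine ⟨A, le_trans (by positivity) (hA 0), fun ξ => ?_⟩
    rw [Real.rpow_neg (by positivity), Real.rpow_natCast, ← div_eq_mul_inv,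
      le_div_iff₀ (by positivity), mul_comm, ← hF]
    exact hA ξ
  · simp only [densityFourier, inner_zero_right, Complex.ofReal_zero, mul_zero, Complex.exp_zero,
      one_mul]
    rw [integral_complex_ofReal, b.integral_normed, Complex.ofReal_one]

namespace IsRapidDensity

variable {ι : Type*} [Fintype ι] {G : EuclideanSpace ℝ ι → ℝ}

theorem isFiniteMeasure_withDensity (hG : IsRapidDensity G) :
    IsFiniteMeasure (volume.withDensity fun x => ((G x).toNNReal : ENNReal)) :=
  isFiniteMeasure_withDensity_ofReal hG.integrable.2

theorem integral_withDensity (hG : IsRapidDensity G) (f : EuclideanSpace ℝ ι → ℂ) :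
    ∫ x, f x ∂(volume.withDensity fun x => ((G x).toNNReal : ENNReal)) =
      ∫ x, f x * (G x : ℂ) := by
  rw [integral_withDensity_eq_integral_smul hG.continuous.measurable.real_toNNReal]
  refine integral_congr_ae (.of_forall fun x => ?_)
  simp only [NNReal.smul_def, Real.coe_toNNReal _ (hG.nonneg x), Complex.real_smul]
  exact mul_comm _ _

theorem mass_withDensity (hG : IsRapidDensity G) :
    ((volume.withDensity fun x => ((G x).toNNReal : ENNReal)) Set.univ) =
      ENNReal.ofReal ‖densityFourier G 0‖ := by
  simp only [densityFourier, inner_zero_right, Complex.ofReal_zero, mul_zero, Complex.exp_zero,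
    one_mul]
  rw [integral_complex_ofReal, Complex.norm_real,
    Real.norm_of_nonneg (integral_nonneg hG.nonneg), withDensity_apply _ .univ,
    Measure.restrict_univ, ofReal_integral_eq_lintegral_ofReal hG.integrable
      (.of_forall hG.nonneg)]
  rfl

theorem exists_limit_measure {G : ℕ → EuclideanSpace ℝ ι → ℝ} (hG : ∀ k, IsRapidDensity (G k))
    {K : ℕ → Set (EuclideanSpace ℝ ι)} (hK : ∀ j, IsCompact (K j))
    (hsupp : ∀ j, ∀ᶠ k in atTop, ∀ x, G k x ≠ 0 → x ∈ K j) {C : ℝ}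
    (hC : ∀ k, ‖densityFourier (G k) 0‖ ≤ C) :
    ∃ μ : Measure (EuclideanSpace ℝ ι), IsFiniteMeasure μ ∧ (∀ j, μ (K j)ᶜ = 0) ∧
      ∃ U : Ultrafilter ℕ, ∀ ξ,
        Tendsto (fun k => densityFourier (G k) ξ) U (𝓝 (fourierTransformMeasure μ ξ)) := by
  set ν : ℕ → FiniteMeasure (EuclideanSpace ℝ ι) := fun k =>
    ⟨volume.withDensity fun x => ((G k x).toNNReal : ENNReal),
      (hG k).isFiniteMeasure_withDensity⟩ with hν
  set S : ℕ → Set (FiniteMeasure (EuclideanSpace ℝ ι)) := fun j =>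
    {μ | μ.mass ≤ C.toNNReal ∧ μ (K j)ᶜ = 0} with hS
  have hSc : ∀ j, IsCompact (S j) := fun j =>
    isCompact_setOfPred_finiteMeasure_le_of_isCompact _ (hK j)
  have hνS : ∀ j, ∀ᶠ k in (hyperfilter ℕ : Filter ℕ), ν k ∈ S j := by
    intro j
    filter_upwards [Nat.hyperfilter_le_atTop (hsupp j)] with k hk
    constructor
    · rw [← ENNReal.coe_le_coe, FiniteMeasure.ennreal_mass]
      exact ((hG k).mass_withDensity).le.trans (ENNReal.ofReal_le_ofReal (hC k))
    · rw [FiniteMeasure.null_iff_toMeasure_null]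
      change (volume.withDensity fun x => ((G k x).toNNReal : ENNReal)) (K j)ᶜ = 0
      rw [withDensity_apply _ (hK j).isClosed.measurableSet.compl]
      refine (setLIntegral_congr_fun (hK j).isClosed.measurableSet.compl fun x hx => ?_).trans
        lintegral_zero
      have : G k x = 0 := by_contra fun h => hx (hk x h)
      simp [this]
  -- Measures of bounded mass carried by a fixed compact set form a weakly compact set, so a limit
  -- exists along the ultrafilter without extracting a subsequence. Each closed set `S j` then
  -- contains the limit.
  obtain ⟨μ, -, hμ⟩ := (hSc 0).ultrafilter_le_nhds ((hyperfilter ℕ).map ν)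
    (le_principal_iff.2 (hνS 0))
  have hlim : Tendsto ν (hyperfilter ℕ : Filter ℕ) (𝓝 μ) := hμ
  refine ⟨μ, inferInstance, fun j => ?_, hyperfilter ℕ, fun ξ => ?_⟩
  · have := (hSc j).isClosed.mem_of_tendsto hlim (hνS j)
    exact (FiniteMeasure.null_iff_toMeasure_null _ _).1 this.2
  · let f : BoundedContinuousFunction (EuclideanSpace ℝ ι) ℂ :=
      BoundedContinuousFunction.ofNormedAddCommGroup
        (fun x => Complex.exp (-2 * (Real.pi : ℂ) * Complex.I * ((inner ℝ x ξ : ℝ) : ℂ)))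
        (by fun_prop) 1 fun x => norm_fourier_phase.le
    have := (FiniteMeasure.tendsto_iff_forall_integral_rclike_tendsto ℂ).1 hlim f
    refine (this.congr fun k => ?_)
    exact (hG k).integral_withDensity _

/-- Both smallness statements hold for all large M, so one M serves both. The prescribed `M₀` forces
the denominators to infinity along the iteration. -/
theorem exists_refinement_le {n d : ℕ} [NeZero n] [NeZero d]
    {G : EuclideanSpace ℝ (Fin n × Fin d) → ℝ} (hG : IsRapidDensity G) {τ a β η : ℝ} (hτ : 0 < τ)
    (ha : 0 ≤ a) (had : a * (1 + τ) < d) (hβ : 0 ≤ β) (hβn : β ≤ n)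
    (hβτ : τ * n - d < β * (1 + τ)) (hη : 0 < η) (M₀ : ℕ) :
    ∃ M, M₀ ≤ M ∧ 1 ≤ M ∧ ∃ G' : EuclideanSpace ℝ (Fin n × Fin d) → ℝ, IsRapidDensity G' ∧
      (∀ x, G' x ≠ 0 → G x ≠ 0 ∧ x ∈ dyadicApproxSet τ d n M) ∧
      (∀ ξ, ‖densityFourier G' ξ - densityFourier G ξ‖ₑ * ENNReal.ofReal ((1 + ‖ξ‖) ^ a) ≤
        ENNReal.ofReal η) ∧
      ∫⁻ ξ, ‖densityFourier G' ξ - densityFourier G ξ‖ₑ ^ 2 *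
        ENNReal.ofReal ((1 + ‖ξ‖) ^ (-β)) ≤ ENNReal.ofReal η := by
  obtain ⟨M, h1, h2, hM₀, hM⟩ := ((hG.eventually_refinement_sup_le hτ ha had hη).and
    ((hG.eventually_refinement_energy_le hτ hβ hβn hβτ hη).and
      ((eventually_ge_atTop M₀).and (eventually_ge_atTop 1)))).exists
  obtain ⟨G', hG', hs, hle⟩ := hG.exists_refinement τ hM
  refine ⟨M, hM₀, hM, G', hG', hs, fun ξ => le_trans ?_ (h1 ξ),
    (lintegral_mono fun ξ => ?_).trans h2⟩
  · gcongr
    exact hle ξ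
  · gcongr
    exact hle ξ

end IsRapidDensity

theorem enorm_sub_le_tsum_enorm_sub {E : Type*} [NormedAddCommGroup E] (u : ℕ → E) (k : ℕ) :
    ‖u k - u 0‖ₑ ≤ ∑' j, ‖u (j + 1) - u j‖ₑ := by
  rw [← Finset.sum_range_sub]
  exact (enorm_sum_le _ fun j => u (j + 1) - u j).trans (ENNReal.sum_le_tsum _)

theorem tsum_ofReal_geometric_succ {r : ℝ} (hr : 0 ≤ r) (hr1 : r < 1) :
    ∑' k : ℕ, ENNReal.ofReal (r ^ (k + 1)) = ENNReal.ofReal (r / (1 - r)) := by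
  rw [← ENNReal.ofReal_tsum_of_nonneg (fun _ => by positivity)
    ((summable_nat_add_iff 1).2 (summable_geometric_of_lt_one hr hr1))]
  simp_rw [pow_succ]
  rw [tsum_mul_right, tsum_geometric_of_lt_one hr hr1, inv_mul_eq_div]

/-- The factor 1/2 in the closed condition, with ‖q‖ ≤ 2 M k, yields the strict inequality. Since
‖q‖ ≥ k, the solutions are unbounded, hence infinite in number. -/
theorem mem_wellApproxMatrices_of_frequently {n d : ℕ} [NeZero d] {τ : ℝ} (hτ : 0 < τ) {M : ℕ → ℕ}
    (hM : ∀ k, k ≤ M k) (hM1 : ∀ k, 1 ≤ M k) {x : EuclideanSpace ℝ (Fin n × Fin d)}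
    (hx : ∀ k, x ∈ dyadicApproxSet τ d n (M k)) : x ∈ wellApproxMatrices τ d n := by
  have h : ∀ k : ℕ, ∃ p : (Fin d → ℤ) × (Fin n → ℤ), (p.1 ≠ 0 ∧
      ‖(fun i : Fin n => (∑ j : Fin d, x (i, j) * (p.1 j : ℝ)) - (p.2 i : ℝ))‖ < ‖p.1‖ ^ (-τ)) ∧
      (k : ℝ) ≤ ‖p.1‖ := by
    intro k
    obtain ⟨q, hq, hqx⟩ := hx k
    choose r hr using hqx
    obtain ⟨h1, h2⟩ := norm_bounds_of_mem_dyadicBox hq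
    have hk : (k : ℝ) ≤ M k := by exact_mod_cast hM k
    have hk1 : (1 : ℝ) ≤ M k := by exact_mod_cast hM1 k
    have hq0 : 0 < ‖q‖ := by linarith
    refine ⟨(q, r), ⟨norm_pos_iff.1 hq0, ?_⟩, hk.trans h1⟩
    have hpos : (0 : ℝ) < (2 * M k : ℝ) ^ (-τ) := by positivity
    refine ((pi_norm_le_iff_of_nonneg (by positivity)).2 hr).trans_lt
      ((half_lt_self hpos).trans_le ?_)
    exact Real.rpow_le_rpow_of_nonpos hq0 h2 (by linarith)
  choose p hp hpk using h
  intro hfin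
  obtain ⟨B, hB⟩ := (hfin.image fun p : (Fin d → ℤ) × (Fin n → ℤ) => ‖p.1‖).bddAbove
  obtain ⟨k, hk⟩ := exists_nat_gt B
  exact absurd (hB ⟨p k, hp k, rfl⟩) (not_le.2 (hk.trans_le (hpk k)))

end

/-! ### The limiting measures -/

section

open MeasureTheory Filter Topology

theorem fourierTransformMeasure_smul {ι : Type*} [Fintype ι] (c : ENNReal)
    (μ : Measure (EuclideanSpace ℝ ι)) (ξ : EuclideanSpace ℝ ι) :
    fourierTransformMeasure (c • μ) ξ = c.toReal • fourierTransformMeasure μ ξ :=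
  integral_smul_measure _ _

/-- Limits of successive refinements: there are finite measures on compact sets of well
approximable matrices with prescribed Fourier decay and finite energy. -/
theorem exists_finite_measure_wellApproxMatrices {n d : ℕ} [NeZero n] [NeZero d] {τ a β : ℝ}
    (hτ : 0 < τ) (ha : 0 ≤ a) (had : a * (1 + τ) < d) (hβ : 0 ≤ β) (hβn : β ≤ n)
    (hβτ : τ * n - d < β * (1 + τ)) :
    ∃ μ : Measure (EuclideanSpace ℝ (Fin n × Fin d)), IsFiniteMeasure μ ∧ μ ≠ 0 ∧
      IsCompact μ.support ∧ μ.support ⊆ wellApproxMatrices τ d n ∧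
      (∃ C : ℝ, ∀ ξ, ‖fourierTransformMeasure μ ξ‖ ≤ C * (1 + ‖ξ‖) ^ (-a)) ∧
      ∫⁻ ξ, ‖fourierTransformMeasure μ ξ‖ₑ ^ 2 * ENNReal.ofReal ((1 + ‖ξ‖) ^ (-β)) ≠ ⊤ := by
  obtain ⟨G₀, hG₀, hG₀1⟩ := exists_isRapidDensity (Fin n × Fin d)
  have step := fun (k : ℕ) (G : {G : EuclideanSpace ℝ (Fin n × Fin d) → ℝ // IsRapidDensity G}) =>
    G.2.exists_refinement_le hτ ha had hβ hβn hβτ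
      -- The errors sum to 1/3 < 1, so the limit keeps positive mass. In the energy estimate
      -- 4^(-(k+1)) also beats the factor 2^(k+1) coming from Cauchy–Schwarz over the steps.
      (η := (1 / 4) ^ (k + 1)) (by positivity) k
  choose M hMk hM1 R hR hsupp hsup hen using step
  let Γ : ℕ → {G : EuclideanSpace ℝ (Fin n × Fin d) → ℝ // IsRapidDensity G} := fun k =>
    Nat.rec ⟨G₀, hG₀⟩ (fun k G => ⟨R k G, hR k G⟩) k
  set G : ℕ → EuclideanSpace ℝ (Fin n × Fin d) → ℝ := fun k => (Γ k).1 with hGdef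
  have hG : ∀ k, IsRapidDensity (G k) := fun k => (Γ k).2
  have hsub : ∀ j k, j ≤ k → ∀ x, G k x ≠ 0 → G j x ≠ 0 := by
    intro j k hjk
    induction k, hjk using Nat.le_induction with
    | base => exact fun x hx => hx
    | succ k _ ih => exact fun x hx => ih x (hsupp k (Γ k) x hx).1
  -- A majorant for every |Ĝ_k - Ĝ_0|, and hence for the limit transform. Weighted decay and finite
  -- energy are checked on `Δ` alone, without continuity of the energy under weak limits.
  set Δ : EuclideanSpace ℝ (Fin n × Fin d) → ENNReal := fun ξ =>
    ∑' k, ‖densityFourier (G (k + 1)) ξ - densityFourier (G k) ξ‖ₑ with hΔ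
  have hΔsup : ∀ ξ, Δ ξ * ENNReal.ofReal ((1 + ‖ξ‖) ^ a) ≤ ENNReal.ofReal (1 / 3) := by
    intro ξ
    rw [hΔ, ← ENNReal.tsum_mul_right]
    refine (ENNReal.tsum_le_tsum fun k => hsup k (Γ k) ξ).trans ?_
    rw [tsum_ofReal_geometric_succ (by norm_num) (by norm_num)]
    norm_num
  have hΔ0 : Δ 0 ≤ ENNReal.ofReal (1 / 3) := by simpa using hΔsup 0
  have hΔk : ∀ k ξ, ‖densityFourier (G k) ξ - densityFourier G₀ ξ‖ₑ ≤ Δ ξ := fun k ξ =>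
    enorm_sub_le_tsum_enorm_sub (fun k => densityFourier (G k) ξ) k
  have hmeas : ∀ k, Measurable fun ξ => densityFourier (G k) ξ := fun k =>
    (hG k).continuous_densityFourier.measurable
  set w : EuclideanSpace ℝ (Fin n × Fin d) → ENNReal := fun ξ =>
    ENNReal.ofReal ((1 + ‖ξ‖) ^ (-β)) with hw
  have hwm : Measurable w := by fun_prop
  have hΔm : Measurable Δ := by
    refine Measurable.tsum fun k => ?_
    have := hmeas k
    have := hmeas (k + 1)
    fun_prop
  have hΔen : ∫⁻ ξ, Δ ξ ^ 2 * w ξ ≤ 1 := by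
    have h1 : ∀ ξ, Δ ξ ^ 2 * w ξ ≤ ∑' k, ENNReal.ofReal (2 ^ (k + 1)) *
        (‖densityFourier (G (k + 1)) ξ - densityFourier (G k) ξ‖ₑ ^ 2 * w ξ) := by
      intro ξ
      simp_rw [← mul_assoc]
      rw [ENNReal.tsum_mul_right]
      gcongr
      refine (ENNReal_sq_tsum_le_mul (U := fun k => ENNReal.ofReal ((1 / 2) ^ (k + 1)))
        (V := fun k => ENNReal.ofReal (2 ^ (k + 1)) *
          ‖densityFourier (G (k + 1)) ξ - densityFourier (G k) ξ‖ₑ ^ 2) fun k => ?_).trans ?_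
      · rw [← mul_assoc, ← ENNReal.ofReal_mul (by positivity), ← mul_pow]
        norm_num
      · rw [tsum_ofReal_geometric_succ (by norm_num) (by norm_num)]
        norm_num
    refine (lintegral_mono h1).trans ?_
    rw [lintegral_tsum fun k => by
      have := hmeas k
      have := hmeas (k + 1)
      fun_prop]
    refine (ENNReal.tsum_le_tsum
      (g := fun k => ENNReal.ofReal ((1 / 2) ^ (k + 1))) fun k => ?_).trans ?_
    · rw [lintegral_const_mul' _ _ ENNReal.ofReal_ne_top]
      refine (mul_le_mul_right (hen k (Γ k)) _).trans (le_of_eq ?_)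
      rw [← ENNReal.ofReal_mul (by positivity), ← mul_pow]
      norm_num
    · rw [tsum_ofReal_geometric_succ (by norm_num) (by norm_num)]
      norm_num
  -- Later densities vanish wherever an earlier one does, so from index j + 1 on they all live on
  -- the j-th compact set.
  obtain ⟨μ, hμf, hμK, U, hU⟩ := IsRapidDensity.exists_limit_measure hG
    (K := fun j => tsupport G₀ ∩ dyadicApproxSet τ d n (M j (Γ j)))
    (fun j => hG₀.hasCompactSupport.isCompact.inter_right (isClosed_dyadicApproxSet _ _ _ _))
    (fun j => by
      filter_upwards [eventually_ge_atTop (j + 1)] with k hk x hx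
      exact ⟨subset_tsupport _ (hsub 0 k (Nat.zero_le k) x hx),
        (hsupp j (Γ j) x (hsub (j + 1) k hk x hx)).2⟩)
    (C := 2) (fun k => by
      have h1 : ‖densityFourier (G k) 0 - densityFourier G₀ 0‖ ≤ 1 / 3 := by
        rw [← ENNReal.ofReal_le_ofReal_iff (by norm_num), ofReal_norm]
        exact (hΔk k 0).trans hΔ0
      have h2 := norm_le_insert' (densityFourier (G k) 0) (densityFourier G₀ 0)
      rw [hG₀1, norm_one] at h2
      rw [hG₀1] at h1
      linarith)
  have hlim : ∀ ξ, ‖fourierTransformMeasure μ ξ - densityFourier G₀ ξ‖ₑ ≤ Δ ξ := fun ξ =>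
    le_of_tendsto ((hU ξ).sub_const _).enorm (.of_forall fun k => hΔk k ξ)
  have hbound : ∀ ξ, ‖fourierTransformMeasure μ ξ‖ₑ ≤ ‖densityFourier G₀ ξ‖ₑ + Δ ξ := by
    intro ξ
    refine le_trans ?_ (add_le_add_right (hlim ξ) _)
    conv_lhs => rw [← add_sub_cancel (densityFourier G₀ ξ) (fourierTransformMeasure μ ξ)]
    exact enorm_add_le _ _
  have hsuppK : ∀ j, μ.support ⊆ tsupport G₀ ∩ dyadicApproxSet τ d n (M j (Γ j)) := fun j =>
    Measure.support_subset_of_isClosed ((isClosed_tsupport _).inter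
      (isClosed_dyadicApproxSet _ _ _ _)) (mem_ae_iff.2 (hμK j))
  refine ⟨μ, hμf, ?_, ?_, fun x hx => ?_, ?_, ?_⟩
  · rintro rfl
    have h1 := (hlim 0).trans hΔ0
    rw [hG₀1, fourierTransformMeasure, integral_zero_measure, zero_sub, enorm_neg, enorm_one,
      ← ENNReal.ofReal_one, ENNReal.ofReal_le_ofReal_iff (by norm_num)] at h1
    norm_num at h1
  · exact hG₀.hasCompactSupport.isCompact.of_isClosed_subset Measure.isClosed_support
      fun x hx => (hsuppK 0 hx).1
  · exact mem_wellApproxMatrices_of_frequently hτ (fun k => hMk k (Γ k)) (fun k => hM1 k (Γ k))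
      fun k => (hsuppK k hx).2
  · obtain ⟨A, hA0, hA⟩ := hG₀.exists_rpow_decay a
    refine ⟨A + 1 / 3, fun ξ => ?_⟩
    have hpos : 0 < (1 + ‖ξ‖) ^ a := by positivity
    have h1 : ‖fourierTransformMeasure μ ξ - densityFourier G₀ ξ‖ * (1 + ‖ξ‖) ^ a ≤ 1 / 3 := by
      rw [← ENNReal.ofReal_le_ofReal_iff (by norm_num), ENNReal.ofReal_mul (norm_nonneg _),
        ofReal_norm]
      exact (mul_le_mul_left (hlim ξ) _).trans (hΔsup ξ)
    rw [← le_div_iff₀ hpos, div_eq_mul_inv, ← Real.rpow_neg (by positivity)] at h1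
    have h2 := norm_le_insert' (fourierTransformMeasure μ ξ) (densityFourier G₀ ξ)
    linarith [hA ξ]
  · have hfin : ∫⁻ ξ, ‖densityFourier G₀ ξ‖ₑ ^ 2 * w ξ ≠ ⊤ := by
      obtain ⟨A, hA0, hA⟩ := hG₀.exists_rpow_decay 0
      have hle : ∀ ξ, ‖densityFourier G₀ ξ‖ₑ ^ 2 * w ξ ≤
          ENNReal.ofReal A * (ENNReal.ofReal ((1 + ‖ξ‖) ^ (-β)) * ‖densityFourier G₀ ξ‖ₑ) := by
        intro ξ
        have h1 : ‖densityFourier G₀ ξ‖ₑ ≤ ENNReal.ofReal A := by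
          rw [← ofReal_norm]
          refine ENNReal.ofReal_le_ofReal ?_
          simpa using hA ξ
        rw [sq, mul_assoc, mul_comm (w ξ)]
        gcongr
      refine ((lintegral_mono hle).trans_lt ?_).ne
      rw [lintegral_const_mul' _ _ ENNReal.ofReal_ne_top]
      exact ENNReal.mul_lt_top ENNReal.ofReal_lt_top (hG₀.lintegral_rpow_mul_ne_top _).lt_top
    have hle : ∀ ξ, ‖fourierTransformMeasure μ ξ‖ₑ ^ 2 * w ξ ≤
        2 * (‖densityFourier G₀ ξ‖ₑ ^ 2 * w ξ) + 2 * (Δ ξ ^ 2 * w ξ) := by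
      intro ξ
      rw [← mul_assoc, ← mul_assoc, ← add_mul, ← mul_add]
      gcongr
      refine (pow_le_pow_left' (hbound ξ) 2).trans ?_
      have h := ENNReal.rpow_add_le_mul_rpow_add_rpow ‖densityFourier G₀ ξ‖ₑ (Δ ξ) one_le_two
      norm_num at h
      exact h
    refine ((lintegral_mono hle).trans_lt ?_).ne
    rw [lintegral_add_right _ (by fun_prop), lintegral_const_mul' _ _ (by simp),
      lintegral_const_mul' _ _ (by simp)]
    exact ENNReal.add_lt_top.2 ⟨ENNReal.mul_lt_top (by simp) hfin.lt_top,
      ENNReal.mul_lt_top (by simp) (hΔen.trans_lt ENNReal.one_lt_top)⟩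

end

/-! ### Conclusion: measurability and dimensions -/

section

open MeasureTheory

/-- Infinitely many solutions means a solution outside every finite set of pairs: a countable
intersection of countable unions of open sets. -/
theorem measurableSet_wellApproxMatrices (τ : ℝ) (d n : ℕ) :
    MeasurableSet (wellApproxMatrices τ d n) := by
  have h : wellApproxMatrices τ d n =
      ⋂ F : Finset ((Fin d → ℤ) × (Fin n → ℤ)), ⋃ p : (Fin d → ℤ) × (Fin n → ℤ),
        {x | p ∉ F} ∩ ({x | p.1 ≠ 0} ∩ {x : EuclideanSpace ℝ (Fin n × Fin d) |
          ‖(fun i : Fin n => (∑ j : Fin d, x (i, j) * (p.1 j : ℝ)) - (p.2 i : ℝ))‖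
            < ‖p.1‖ ^ (-τ)}) := by
    ext x
    simp only [Set.mem_iInter, Set.mem_iUnion]
    constructor
    · intro hx F
      obtain ⟨p, hp, hpF⟩ := Set.Infinite.exists_notMem_finset hx F
      exact ⟨p, hpF, hp⟩
    · intro hx hfin
      obtain ⟨p, hpF, hp⟩ := hx hfin.toFinset
      exact hpF (hfin.mem_toFinset.2 hp)
  rw [h]
  refine .iInter fun F => .iUnion fun p => (MeasurableSet.const _).inter
    ((MeasurableSet.const _).inter (IsOpen.measurableSet ?_))
  exact isOpen_lt (by fun_prop) continuous_const

theorem exists_probability_measure_wellApproxMatrices {n d : ℕ} [NeZero n] [NeZero d] {τ a : ℝ}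
    (hτ : (d : ℝ) / n < τ) (ha : 0 ≤ a) (had : a * (1 + τ) < d) :
    ∃ μ : Measure (EuclideanSpace ℝ (Fin n × Fin d)), IsProbabilityMeasure μ ∧
      IsCompact μ.support ∧ μ.support ⊆ wellApproxMatrices τ d n ∧
      ∃ C : ℝ, ∀ ξ, ‖fourierTransformMeasure μ ξ‖ ≤ C * (1 + ‖ξ‖) ^ (-a) := by
  have hn : (0 : ℝ) < n := by exact_mod_cast Nat.pos_of_neZero n
  have hd : (0 : ℝ) < d := by exact_mod_cast Nat.pos_of_neZero d
  have hτ0 : 0 < τ := (div_pos hd hn).trans hτ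
  -- The energy is not needed here, and β = n satisfies its conditions because τ n - d < n (1 + τ).
  obtain ⟨μ, hμf, hμ0, hc, hs, ⟨C, hC⟩, -⟩ := exists_finite_measure_wellApproxMatrices
    (β := n) hτ0 ha had hn.le le_rfl (by nlinarith)
  have h0 : μ Set.univ ≠ 0 := fun h => hμ0 (Measure.measure_univ_eq_zero.1 h)
  have hsup : ((μ Set.univ)⁻¹ • μ).support ⊆ μ.support :=
    Measure.support_subset_of_isClosed Measure.isClosed_support (by
      rw [mem_ae_iff, Measure.smul_apply, Measure.measure_compl_support, smul_zero])
  refine ⟨(μ Set.univ)⁻¹ • μ, ⟨?_⟩, hc.of_isClosed_subset Measure.isClosed_support hsup,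
    hsup.trans hs, ((μ Set.univ)⁻¹).toReal * C, fun ξ => ?_⟩
  · rw [Measure.smul_apply, smul_eq_mul, ENNReal.inv_mul_cancel h0 (measure_ne_top _ _)]
  · rw [fourierTransformMeasure_smul, norm_smul, Real.norm_of_nonneg ENNReal.toReal_nonneg,
      mul_assoc]
    exact mul_le_mul_of_nonneg_left (hC ξ) ENNReal.toReal_nonneg

theorem le_measureFourierDim {ι : Type*} [Fintype ι] {μ : Measure (EuclideanSpace ℝ ι)} {s : ℝ}
    (hs0 : 0 ≤ s) (hs : s ≤ Fintype.card ι) {C : ℝ}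
    (h : ∀ ξ, ‖fourierTransformMeasure μ ξ‖ ≤ C * (1 + ‖ξ‖) ^ (-(s / 2))) :
    s ≤ measureFourierDim μ := by
  refine le_csSup ⟨Fintype.card ι, fun t ht => ht.1.2⟩ ⟨⟨hs0, hs⟩, C, fun ξ hξ => (h ξ).trans ?_⟩
  have hC : 0 ≤ C := by
    have := (norm_nonneg _).trans (h 0)
    simpa using this
  have hξ0 : 0 < ‖ξ‖ := norm_pos_iff.2 hξ
  rw [neg_div]
  exact mul_le_mul_of_nonneg_left
    (Real.rpow_le_rpow_of_nonpos hξ0 (by linarith) (by linarith)) hC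

theorem fourierDim_wellApproxMatrices {n d : ℕ} [NeZero n] [NeZero d] {τ : ℝ}
    (hτ : (d : ℝ) / n < τ) : fourierDim (wellApproxMatrices τ d n) = 2 * (d : ℝ) / (1 + τ) := by
  have hn : (1 : ℝ) ≤ n := by exact_mod_cast Nat.pos_of_neZero n
  have hd : (1 : ℝ) ≤ d := by exact_mod_cast Nat.pos_of_neZero d
  have hτ0 : 0 < τ := (div_pos (by linarith) (by linarith)).trans hτ
  have hτ' : (d : ℝ) < τ * n := (div_lt_iff₀ (by linarith)).1 hτ
  have hup : ∀ t ∈ {t : ℝ | ∃ μ : Measure (EuclideanSpace ℝ (Fin n × Fin d)),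
      IsProbabilityMeasure μ ∧ IsCompact μ.support ∧ μ.support ⊆ wellApproxMatrices τ d n ∧
        t = measureFourierDim μ}, t ≤ 2 * (d : ℝ) / (1 + τ) := by
    rintro t ⟨μ, hμ, -, hs, rfl⟩
    exact measureFourierDim_le_of_support_subset hτ hs
  refine le_antisymm (Real.sSup_le hup (by positivity)) (le_of_forall_lt_imp_le_of_dense ?_)
  intro s hs
  rcases le_or_gt s 0 with h0 | h0
  · refine h0.trans (Real.sSup_nonneg ?_)
    rintro t ⟨μ, -, -, -, rfl⟩
    exact Real.sSup_nonneg fun s hs => hs.1.1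
  · rw [lt_div_iff₀ (by linarith)] at hs
    obtain ⟨μ, hμ, hc, hsup, C, hC⟩ := exists_probability_measure_wellApproxMatrices (a := s / 2) hτ
      (by linarith) (by linarith)
    refine le_trans (le_measureFourierDim h0.le ?_ hC) (le_csSup ⟨_, hup⟩ ⟨μ, hμ, hc, hsup, rfl⟩)
    rw [Fintype.card_prod, Fintype.card_fin, Fintype.card_fin, Nat.cast_mul]
    -- The cap at the ambient dimension is harmless: n (1 + τ) > n + d ≥ 2 gives 2d / (1 + τ) < n d.
    by_contra! hlt
    nlinarith [mul_pos (show (0 : ℝ) < n by linarith) (show (0 : ℝ) < d by linarith)]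

/-- The bound on s equals n d - (τ n - d) / (1 + τ), so an admissible β just above (τ n - d) / (1 +
τ) fits below n d - s. No Fourier decay is asked for (a = 0). -/
theorem ofReal_le_dimH_wellApproxMatrices {n d : ℕ} [NeZero n] [NeZero d] {τ s : ℝ}
    (hτ : (d : ℝ) / n < τ) (hs0 : 0 < s) (hs : s < n * (d - 1) + (n + d) / (1 + τ)) :
    ENNReal.ofReal s ≤ dimH (wellApproxMatrices τ d n) := by
  have hn : (1 : ℝ) ≤ n := by exact_mod_cast Nat.pos_of_neZero n
  have hd : (1 : ℝ) ≤ d := by exact_mod_cast Nat.pos_of_neZero d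
  have hτ0 : 0 < τ := (div_pos (by linarith) (by linarith)).trans hτ
  have hτ' : (d : ℝ) < τ * n := (div_lt_iff₀ (by linarith)).1 hτ
  have he : (n + d) / (1 + τ) = n - (τ * n - d) / (1 + τ) := by field_simp; ring
  have h1 : (τ * n - d) / (1 + τ) < min (n : ℝ) (n * d - s) := by
    rw [lt_min_iff]
    constructor
    · rw [div_lt_iff₀ (by linarith)]
      nlinarith
    · linarith
  obtain ⟨β, hβ1, hβ2⟩ := exists_between h1
  have hβ0 : 0 ≤ β := (div_nonneg (by linarith) (by linarith)).trans hβ1.le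
  rw [lt_min_iff] at hβ2
  rw [div_lt_iff₀ (by linarith)] at hβ1
  obtain ⟨μ, hμf, hμ0, -, hsup, -, hen⟩ := exists_finite_measure_wellApproxMatrices
    (a := 0) hτ0 le_rfl (by linarith) hβ0 hβ2.1.le hβ1
  refine ofReal_le_dimH_of_energy_ne_top hμ0
    (measure_mono_null (Set.compl_subset_compl.2 hsup) Measure.measure_compl_support) hβ0 hs0 ?_ hen
  rw [Fintype.card_prod, Fintype.card_fin, Fintype.card_fin, Nat.cast_mul]
  linarith [hβ2.2]

theorem not_isSalem_wellApproxMatrices {n d : ℕ} [NeZero n] [NeZero d] {τ : ℝ}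
    (hτ : (d : ℝ) / n < τ) (hnd : ¬ (n = 1 ∧ d = 1)) : ¬ IsSalem (wellApproxMatrices τ d n) := by
  rintro ⟨-, h⟩
  have hn : (1 : ℝ) ≤ n := by exact_mod_cast Nat.pos_of_neZero n
  have hd : (1 : ℝ) ≤ d := by exact_mod_cast Nat.pos_of_neZero d
  have hτ0 : 0 < τ := (div_pos (by linarith) (by linarith)).trans hτ
  have hτ' : (d : ℝ) < τ * n := (div_lt_iff₀ (by linarith)).1 hτ
  -- After multiplication by 1 + τ this reads d < n (d - 1)(1 + τ) + n. For d = 1 it says n > 1. For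
  -- d ≥ 2 it follows from τ n > d, the surplus exceeding n d + d (d - 2).
  have hlt : 2 * (d : ℝ) / (1 + τ) < n * (d - 1) + (n + d) / (1 + τ) := by
    rw [div_lt_iff₀ (by linarith), add_mul, div_mul_cancel₀ _ (by linarith)]
    rcases eq_or_ne d 1 with rfl | hd1
    · have hn2 : (2 : ℝ) ≤ n := by
        have := Nat.pos_of_neZero n
        exact_mod_cast (show 2 ≤ n by omega)
      norm_num
      linarith
    · have hd2 : (2 : ℝ) ≤ d := by
        have := Nat.pos_of_neZero d
        exact_mod_cast (show 2 ≤ d by omega)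
      nlinarith [mul_pos (show (0 : ℝ) < d - 1 by linarith)
        (show (0 : ℝ) < τ * n - d by linarith), mul_nonneg (show (0 : ℝ) ≤ d by linarith)
        (show (0 : ℝ) ≤ d - 2 by linarith)]
  obtain ⟨s, hs1, hs2⟩ := exists_between hlt
  have hpos : 0 < 2 * (d : ℝ) / (1 + τ) := by positivity
  have h1 := ofReal_le_dimH_wellApproxMatrices hτ (hpos.trans hs1) hs2
  rw [h, fourierDim_wellApproxMatrices hτ, ENNReal.ofReal_le_ofReal_iff hpos.le] at h1
  linarith

end

theorem theorem1 (d n : ℕ) (hd : 1 ≤ d) (hn : 1 ≤ n) (τ : ℝ) (hτ : (d : ℝ) / (n : ℝ) < τ) :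
    MeasurableSet (wellApproxMatrices τ d n) ∧
    fourierDim (wellApproxMatrices τ d n) = 2 * (d : ℝ) / (1 + τ) ∧
    (¬ (n = 1 ∧ d = 1) → ¬ IsSalem (wellApproxMatrices τ d n)) := by
  have : NeZero d := ⟨by omega⟩
  have : NeZero n := ⟨by omega⟩
  exact ⟨measurableSet_wellApproxMatrices τ d n, fourierDim_wellApproxMatrices hτ,
    not_isSalem_wellApproxMatrices hτ⟩
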